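/- **Setting.** Let $M,N\ge 1$, $K,L$ be integers with $LK>MN$. For an FDA-MIMO radar and a point target let $\mathbf a=\mathbf a_{\rm TR}(r,\theta)=\mathbf a_{\rm T}(r,\theta)\otimes\mathbf a_{\rm R}(\theta)\in\mathbb C^{MN}$ be the joint transmit-receive steering vector and $\boldsymbol\omega=(e^{j2\pi f_{\rm d}k})_{k=0}^{K-1}\in\mathbb C^K$ the Doppler vector. Here $\mathbf a_{\rm T}=\mathbf a_t(\theta)\odot\mathbf e(-r)$, and the vectors $\mathbf a_t(\theta)$, $\mathbf a_{\rm R}(\theta)$, $\mathbf e(r)$ have entries $e^{j2\pi m d_{\rm T}\sin\theta/\lambda_0}$ ($0\le m<M$), $e^{j2\pi n d_{\rm R}\sin\theta/\lambda_0}$ ($0\le n<N$), $e^{j2\pi m\Delta f\,2r/c}$ ($0\le m<M$), with $\lambda_0=c/f_0$ and $f_{\rm d}=\frac{2v}{c}f_0T_p$. The test data are $\mathbf Z=\xi\mathbf a\boldsymbol\omega^T+\mathbf N\in\mathbb C^{MN\times K}$ (with $\xi=0$ under $\mathcal H_0$) and the training data are $\mathbf Y=[\mathbf N_1,\dots,\mathbf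 N_L]\in\mathbb C^{MN\times KL}$. All $(L+1)K$ columns of $\mathbf N,\mathbf N_1,\dots,\mathbf N_L$ are i.i.d. $\mathcal{CN}(0,\mathbf R)$ with $\mathbf R$ Hermitian positive definite. Put $\mathbf S=\mathbf Y\mathbf Y^\dagger$, $\tilde{\mathbf a}=\mathbf S^{-1/2}\mathbf a$, $\tilde{\mathbf Z}=\mathbf S^{-1/2}\mathbf Z$, $\tilde{\mathbf Z}_\omega=\tilde{\mathbf Z}\boldsymbol\omega^*/\sqrt{\boldsymbol\omega^T\boldsymbol\omega^*}$, $\mathbf G=\mathbf I+\tilde{\mathbf Z}\mathbf P^\perp_{\boldsymbol\omega^*}\tilde{\mathbf Z}^\dagger$, where $\mathbf P^\perp_{\boldsymbol\omega^*}$ is the orthogonal projection onto the complement of $\boldsymbol\omega^*$, and $$\Lambda_{Rao}=\frac{|\mathbf a^\dagger(\mathbf Z\mathbf Z^\dagger+\mathbf S)^{-1}\mathbf Z\boldsymbol\omega^*|^2}{\mathbf a^\dagger(\mathbf Z\mathbf Z^\dagger+\mathbf S)^{-1}\mathbf a\;\boldsymbol\omega^T\boldsymbol\omega^*},\qquad \Lambda_{LHAMF}=\frac{|\tilde{\mathbf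 a}^\dagger\mathbf G^{-1}\tilde{\mathbf Z}_\omega|^2}{\tilde{\mathbf a}^\dagger\mathbf G^{-1}\tilde{\mathbf a}},$$ $$\Lambda'=\frac{\Lambda_{LHAMF}}{1+\tilde{\mathbf Z}_\omega^\dagger\mathbf G^{-1}\tilde{\mathbf Z}_\omega},\qquad \Lambda''=\frac{\Lambda'}{1-\Lambda'},\qquad \mathscr B=\frac{\Lambda''}{\Lambda_{LHAMF}}$$ (with the convention $0/0=0$ in the null event $\Lambda_{LHAMF}=0$). Let $d=(L+1)K-MN$, $\alpha=|\xi|^2\,\boldsymbol\omega^T\boldsymbol\omega^*\,\mathbf a^\dagger\mathbf R^{-1}\mathbf a$ and $$f_{\mathscr B}(b)=\frac{b^{d}(1-b)^{MN-2}}{\beta(d+1,MN-1)},\qquad \mathcal P_{\mathcal H_1,b}(\gamma)=\sum_{i=0}^{d-1}\binom{d}{1+i}\frac{\gamma^{1+i}}{(1+\gamma)^{d}}\,\mathrm{IG}_{i+1}\!\Big(\frac{\alpha b}{1+\gamma}\Big),\qquad \mathrm{IG}_{i+1}(h)=e^{-h}\sum_{j=0}^{i}\frac{h^j}{\Gamma(j+1)}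 .$$ **Statement.** 1. Whenever $\mathbf S$ is invertible, which holds almost surely, $\displaystyle \Lambda_{Rao}=\frac{\mathscr B\,\Lambda''}{1+\Lambda''}$. 2. The Rao detector (decide $\mathcal H_1$ if $\Lambda_{Rao}>\lambda$) is CFAR: for every $\lambda\in\mathbb R$ its false alarm probability does not depend on $\mathbf R$. For $0\le\lambda\le1$ it equals $\mathrm{PFA}=(1-\lambda)^{(L+1)K-1}$. 3. If $MN\ge2$, then for every $\xi\in\mathbb C$: $\mathscr B$ has density $f_{\mathscr B}$ on $(0,1)$; given $\mathscr B=b$, $\Lambda''$ has distribution function $\mathcal P_{\mathcal H_1,b}$ on $[0,\infty)$; and, for $0\le\lambda\le 1$, the detection probability is $$P_{\rm D}=\int_\lambda^1\Big[1-\mathcal P_{\mathcal H_1,b}\Big(\frac{\lambda}{b-\lambda}\Big)\Big]f_{\mathscr B}(b)\,db .$$ -/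

import Mathlib

open MeasureTheory Matrix
open scoped BigOperators ComplexOrder

noncomputable section

namespace FDAMIMO

/-! ### Radar model -/

/-- Parameters of a colocated FDA-MIMO radar. -/
structure Radar where
  /-- carrier frequency `f₀` of the reference element -/
  carrier : ℝ
  /-- frequency offset `Δf` between neighbouring transmit elements -/
  freqOffset : ℝ
  /-- spacing `d_T` of the transmit elements -/
  txSpacing : ℝ
  /-- spacing `d_R` of the receive elements -/
  rxSpacing : ℝ
  /-- propagation speed `c` -/
  lightSpeed : ℝ
  /-- pulse repetition interval `T_p` -/
  pri : ℝ
  carrier_pos : 0 < carrier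
  lightSpeed_pos : 0 < lightSpeed

/-- Range `r`, angle `θ` and radial velocity `v` of a point-like target. -/
structure Target where
  range : ℝ
  angle : ℝ
  velocity : ℝ

/-- `exp (j 2 π x)`. -/
def phase (x : ℝ) : ℂ := Complex.exp (2 * Real.pi * x * Complex.I)

/-- Wavelength `λ₀ = c / f₀`. -/
def Radar.wavelength (p : Radar) : ℝ := p.lightSpeed / p.carrier

/-- Normalised Doppler frequency `f_d = (2 v / c) f₀ T_p`. -/
def doppler (p : Radar) (t : Target) : ℝ :=
  2 * t.velocity / p.lightSpeed * p.carrier * p.pri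

/-- `a_t(θ)`. -/
def txAngleVec (M : ℕ) (p : Radar) (t : Target) : Fin M → ℂ := fun m =>
  phase ((m : ℕ) * (p.txSpacing * Real.sin t.angle / p.wavelength))

/-- `e(r)`. -/
def txRangeVec (M : ℕ) (p : Radar) (r : ℝ) : Fin M → ℂ := fun m =>
  phase ((m : ℕ) * (p.freqOffset * (2 * r / p.lightSpeed)))

/-- `a_T(r,θ) = a_t(θ) ⊙ e(-r)` (Hadamard product). -/
def txVec (M : ℕ) (p : Radar) (t : Target) : Fin M → ℂ := fun m =>
  txAngleVec M p t m * txRangeVec M p (-t.range) m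

/-- `a_R(θ)`. -/
def rxVec (N : ℕ) (p : Radar) (t : Target) : Fin N → ℂ := fun n =>
  phase ((n : ℕ) * (p.rxSpacing * Real.sin t.angle / p.wavelength))

/-- `a_TR(r,θ) = a_T(r,θ) ⊗ a_R(θ)` (Kronecker product); `ℂ^{MN}` is indexed by pairs. -/
def steering (M N : ℕ) (p : Radar) (t : Target) : Fin M × Fin N → ℂ := fun i =>
  txVec M p t i.1 * rxVec N p t i.2

/-- `ω_D(f_d)`, with entries `exp (j 2 π f_d k)`, `k = 0, …, K-1`. -/
def dopplerVec (K : ℕ) (p : Radar) (t : Target) : Fin K → ℂ := fun k =>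
  phase (doppler p t * (k : ℕ))

/-! ### Noise and data -/

/-- The circularly symmetric complex Gaussian law `CN(0, R)`, for positive definite `R`, through
its density `exp (-z† R⁻¹ z) / (π^n det R)`. -/
def complexGaussian {ι : Type*} [Fintype ι] [DecidableEq ι] (R : Matrix ι ι ℂ) :
    Measure (ι → ℂ) :=
  volume.withDensity fun z =>
    ENNReal.ofReal
      (Real.exp (-(star z ⬝ᵥ (R⁻¹ *ᵥ z)).re) / (Real.pi ^ Fintype.card ι * R.det.re))

/-- All `(L+1)K` noise columns: those of `N` (left summand) and those of
`N_1, …, N_L` (right summand, indexed by `(l, k)`). -/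
abbrev NoiseSpace (M N K L : ℕ) : Type :=
  Fin K ⊕ (Fin L × Fin K) → (Fin M × Fin N → ℂ)

/-- The columns are independent and identically `CN(0, R)`-distributed. -/
def noiseLaw {M N : ℕ} (K L : ℕ) (R : Matrix (Fin M × Fin N) (Fin M × Fin N) ℂ) :
    Measure (NoiseSpace M N K L) :=
  Measure.pi fun _ => complexGaussian R

/-- Test data `Z = ξ a_TR ω_Dᵀ + N`; the hypothesis `H₀` is `ξ = 0`. -/
def testData {M N K L : ℕ} (p : Radar) (t : Target) (ξ : ℂ) (w : NoiseSpace M N K L) :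
    Matrix (Fin M × Fin N) (Fin K) ℂ :=
  ξ • vecMulVec (steering M N p t) (dopplerVec K p t) + Matrix.of fun i k => w (Sum.inl k) i

/-- Training data `Y = [Z_1, …, Z_L]`. -/
def trainingData {M N K L : ℕ} (w : NoiseSpace M N K L) :
    Matrix (Fin M × Fin N) (Fin L × Fin K) ℂ :=
  Matrix.of fun i lk => w (Sum.inr lk) i

/-! ### Statistics, as functions of steering vector `a`, Doppler vector `ω`, data `Z`, `Y` -/

section Statistics

variable {ι κ τ : Type*} [Fintype ι] [DecidableEq ι] [Fintype κ] [DecidableEq κ] [Fintype τ]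

/-- Sample covariance matrix `S = Y Y†`. -/
def scm (Y : Matrix ι τ ℂ) : Matrix ι ι ℂ := Y * Yᴴ

/-- `S^{-1/2}`, through the functional calculus of Hermitian matrices. -/
def invSqrt (S : Matrix ι ι ℂ) : Matrix ι ι ℂ := cfc (fun x : ℝ => (Real.sqrt x)⁻¹) S

/-- `ωᵀ ω*` (a nonnegative real number). -/
def sqNorm (ω : κ → ℂ) : ℝ := (ω ⬝ᵥ star ω).re

/-- `P_B^⊥ = I - B (B† B)⁻¹ B†` for the one-column matrix `B = ω*`. -/
def projPerp (ω : κ → ℂ) : Matrix κ κ ℂ :=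
  1 - replicateCol (Fin 1) (star ω) *
    ((replicateCol (Fin 1) (star ω))ᴴ * replicateCol (Fin 1) (star ω))⁻¹ *
    (replicateCol (Fin 1) (star ω))ᴴ

/-- The Rao statistic
`|a† (ZZ† + S)⁻¹ Z ω*|² / (a† (ZZ† + S)⁻¹ a · ωᵀ ω*)`. -/
def raoStatistic (a : ι → ℂ) (ω : κ → ℂ) (Z : Matrix ι κ ℂ) (Y : Matrix ι τ ℂ) : ℝ :=
  ‖star a ⬝ᵥ ((Z * Zᴴ + scm Y)⁻¹ *ᵥ (Z *ᵥ star ω))‖ ^ 2 /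
    ((star a ⬝ᵥ ((Z * Zᴴ + scm Y)⁻¹ *ᵥ a)).re * sqNorm ω)

/-- `ã = S^{-1/2} a`. -/
def aTilde (a : ι → ℂ) (Y : Matrix ι τ ℂ) : ι → ℂ := invSqrt (scm Y) *ᵥ a

/-- `Z̃ = S^{-1/2} Z`. -/
def zTilde (Z : Matrix ι κ ℂ) (Y : Matrix ι τ ℂ) : Matrix ι κ ℂ := invSqrt (scm Y) * Z

/-- `Z̃_ω = Z̃ ω* / √(ωᵀ ω*)`. -/
def zTildeOmega (ω : κ → ℂ) (Z : Matrix ι κ ℂ) (Y : Matrix ι τ ℂ) : ι → ℂ :=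
  ((Real.sqrt (sqNorm ω))⁻¹ : ℂ) • (zTilde Z Y *ᵥ star ω)

/-- `(I + Z̃ P^⊥ Z̃†)⁻¹`. -/
def whitenedInv (ω : κ → ℂ) (Z : Matrix ι κ ℂ) (Y : Matrix ι τ ℂ) : Matrix ι ι ℂ :=
  (1 + zTilde Z Y * projPerp ω * (zTilde Z Y)ᴴ)⁻¹

/-- `Λ_LHAMF = |ã† (I + Z̃ P^⊥ Z̃†)⁻¹ Z̃_ω|² / (ã† (I + Z̃ P^⊥ Z̃†)⁻¹ ã)`. -/
def lhamf (a : ι → ℂ) (ω : κ → ℂ) (Z : Matrix ι κ ℂ) (Y : Matrix ι τ ℂ) : ℝ :=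
  ‖star (aTilde a Y) ⬝ᵥ (whitenedInv ω Z Y *ᵥ zTildeOmega ω Z Y)‖ ^ 2 /
    (star (aTilde a Y) ⬝ᵥ (whitenedInv ω Z Y *ᵥ aTilde a Y)).re

/-- `Λ'`. -/
def lambdaOne (a : ι → ℂ) (ω : κ → ℂ) (Z : Matrix ι κ ℂ) (Y : Matrix ι τ ℂ) : ℝ :=
  ‖star (aTilde a Y) ⬝ᵥ (whitenedInv ω Z Y *ᵥ zTildeOmega ω Z Y)‖ ^ 2 /
      (star (aTilde a Y) ⬝ᵥ (whitenedInv ω Z Y *ᵥ aTilde a Y)).re *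
    (1 / (1 + (star (zTildeOmega ω Z Y) ⬝ᵥ (whitenedInv ω Z Y *ᵥ zTildeOmega ω Z Y)).re))

/-- `Λ'' = Λ' / (1 - Λ')`. -/
def lambdaTwo (a : ι → ℂ) (ω : κ → ℂ) (Z : Matrix ι κ ℂ) (Y : Matrix ι τ ℂ) : ℝ :=
  lambdaOne a ω Z Y / (1 - lambdaOne a ω Z Y)

/-- `ℬ = Λ'' / Λ_LHAMF`. -/
def scriptB (a : ι → ℂ) (ω : κ → ℂ) (Z : Matrix ι κ ℂ) (Y : Matrix ι τ ℂ) : ℝ :=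
  lambdaTwo a ω Z Y / lhamf a ω Z Y

end Statistics

/-! ### Error probabilities and the closed-form ingredients -/

/-- Probability, for target amplitude `ξ` and noise covariance `R`, that the Rao statistic
exceeds the threshold `lam`. -/
def exceedProb {M N : ℕ} (K L : ℕ) (p : Radar) (t : Target)
    (R : Matrix (Fin M × Fin N) (Fin M × Fin N) ℂ) (ξ : ℂ) (lam : ℝ) : ℝ :=
  (noiseLaw K L R).real
    {w | lam < raoStatistic (steering M N p t) (dopplerVec K p t) (testData p t ξ w)
      (trainingData w)}

/-- False alarm probability of the Rao detector (`H₀`: no target). -/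
def pfa {M N : ℕ} (K L : ℕ) (p : Radar) (t : Target)
    (R : Matrix (Fin M × Fin N) (Fin M × Fin N) ℂ) (lam : ℝ) : ℝ :=
  exceedProb K L p t R 0 lam

/-- Detection probability of the Rao detector (`H₁`: target with amplitude `ξ`). -/
def pd {M N : ℕ} (K L : ℕ) (p : Radar) (t : Target)
    (R : Matrix (Fin M × Fin N) (Fin M × Fin N) ℂ) (ξ : ℂ) (lam : ℝ) : ℝ :=
  exceedProb K L p t R ξ lam

/-- `α = |ξ|² · ωᵀ ω* · a† R⁻¹ a`. -/
def alpha {M N : ℕ} (K : ℕ) (p : Radar) (t : Target)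
    (R : Matrix (Fin M × Fin N) (Fin M × Fin N) ℂ) (ξ : ℂ) : ℝ :=
  ‖ξ‖ ^ 2 * sqNorm (dopplerVec K p t) *
    (star (steering M N p t) ⬝ᵥ (R⁻¹ *ᵥ steering M N p t)).re

/-- Degrees of freedom `(L+1)K - MN`. -/
def dof (M N K L : ℕ) : ℕ := (L + 1) * K - M * N

/-- `IG_{i+1}(h) = exp(-h) ∑_{j=0}^{i} h^j / Γ(j+1)`. -/
def incGamma (i : ℕ) (h : ℝ) : ℝ :=
  Real.exp (-h) * ∑ j ∈ Finset.range (i + 1), h ^ j / Real.Gamma (j + 1)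

/-- `P_{H₁,b}(γ)` with `d` degrees of freedom:
`∑_{i=0}^{d-1} C(d, 1+i) γ^{1+i} / (1+γ)^d · IG_{i+1}(α b / (1+γ))`. -/
def condCdf (d : ℕ) (α b γ : ℝ) : ℝ :=
  ∑ i ∈ Finset.range d,
    (d.choose (1 + i) : ℝ) * (γ ^ (1 + i) / (1 + γ) ^ d) * incGamma i (α * b / (1 + γ))

/-- `f_ℬ(b) = b^d (1-b)^{n-2} / β(d+1, n-1)`, `n = MN ≥ 2`. -/
def fB (d n : ℕ) (b : ℝ) : ℝ :=
  b ^ d * (1 - b) ^ (n - 2) / ProbabilityTheory.beta (d + 1) (n - 1)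

end FDAMIMO

end

/-! Everything is a function of the total data matrix `X = [Z, Y]` and the unit vector `e` obtained
from `ω*` by normalising and extending by zero to the training columns. Put `ρ = |a†(XX†)⁻¹Xe|² /
a†(XX†)⁻¹a` (`raoForm`) and `r = 1 - e†X†(XX†)⁻¹Xe` (`residual`). Since `ZZ† + S` is a rank-one
update of `S + Z P^⊥ Z†`, Sherman–Morrison gives `Λ_Rao = ρ`, `Λ'' = ρ/r` and, when `ρ ≠ 0`, `ℬ = r
+ ρ` (`statistics_eq`). The decomposition of the Rao statistic is then elementary algebra.

Both forms are invariant under `X ↦ AX`, `a ↦ Aa`. Choosing `A` with `A R A† = 1` and `Aa` on a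
coordinate axis (`exists_whitening`) makes the rows of `X` independent standard Gaussian vectors,
except that one row is shifted by `m e†` with `|m|² = α` (`exists_whitened_statistics`). The
covariance survives only through `α`, which vanishes without a target; this is the CFAR property.

Let `x` be the distinguished row and `Q` the projection onto the complement of the other rows. Then
`ρ = |xQe|² / xQx†` and `r + ρ = e†Qe` (`forms_single`), so `ℬ` is a function of the other rows
alone and is independent of `x`. Its beta law comes from unitary invariance: `e` may be replaced by
a normalised independent Gaussian vector, after which `Q` may be frozen and the form is a quotient
of gamma variables (`measure_quadratic_of_invariant`). The false alarm law uses the same principle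
with the rank-one projection whose form at `e` is `ρ` itself, which also covers a single row.

For frozen `Q` with `e†Qe = b`, diagonalising `Q` together with the projection onto `Qe` turns `Λ''`
into `|z + μ|² / w`, with `z` standard complex Gaussian, `|μ|² = α b` and `w` an independent gamma
variable of shape `d` (`exists_measure_ratio_eq`). Its distribution function follows from Gaussian
moments and a binomial identity (`measure_ratio_eq_condCdf`). Finally `ρ > λ` holds exactly when `ℬ
> λ` and `Λ'' > λ/(ℬ - λ)`; integrating over `ℬ` gives the detection probability. -/

namespace FDAMIMO

/-! ### Linear algebra of the statistics -/

section Algebra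

set_option linter.unusedSectionVars false

variable {ι κ τ J : Type*} [Fintype ι] [DecidableEq ι] [Fintype κ] [DecidableEq κ] [Fintype τ]
  [Fintype J] [DecidableEq J]

lemma invSqrt_isHermitian (S : Matrix ι ι ℂ) : (invSqrt S).IsHermitian :=
  cfc_predicate (p := IsSelfAdjoint) (fun x : ℝ => (Real.sqrt x)⁻¹) S

lemma invSqrt_mul_mul_invSqrt {S : Matrix ι ι ℂ} (hS : S.PosDef) :
    invSqrt S * S * invSqrt S = 1 := by
  have hsa : IsSelfAdjoint S := hS.1
  have hfin : (spectrum ℝ S).Finite := Matrix.finite_real_spectrum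
  -- The spectrum is finite, so continuity is automatic and the behaviour of `1/√x` at zero is
  -- harmless.
  have hc : ∀ f : ℝ → ℝ, ContinuousOn f (spectrum ℝ S) := fun f => hfin.continuousOn f
  have hpos : ∀ x ∈ spectrum ℝ S, 0 < x := by
    intro x hx
    rw [hS.1.spectrum_real_eq_range_eigenvalues] at hx
    obtain ⟨i, rfl⟩ := hx
    exact hS.eigenvalues_pos i
  unfold invSqrt
  nth_rewrite 2 [← cfc_id ℝ S]
  rw [← cfc_mul _ _ S (hc _) (hc _), ← cfc_mul _ _ S (hc _) (hc _), ← cfc_one ℝ S]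
  refine cfc_congr fun x hx => ?_
  have h := hpos x hx
  have h2 : Real.sqrt x ≠ 0 := (Real.sqrt_pos.2 h).ne'
  have h3 := Real.mul_self_sqrt h.le
  simp only [id, Pi.one_apply]
  field_simp
  nlinarith

lemma posDef_scm {Y : Matrix ι τ ℂ} (h : IsUnit (scm Y)) : (scm Y).PosDef :=
  (Matrix.posSemidef_self_mul_conjTranspose Y).posDef_iff_isUnit.2 h

lemma isUnit_det_invSqrt {S : Matrix ι ι ℂ} (hS : S.PosDef) : IsUnit (invSqrt S).det := by
  have h := congrArg Matrix.det (invSqrt_mul_mul_invSqrt hS)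
  rw [det_mul, det_mul, det_one, mul_assoc] at h
  exact IsUnit.of_mul_eq_one _ h

/-- The factors cancel because `(TGT†)⁻¹ = T⁻†G⁻¹T⁻¹`. This removes `S^{-1/2}` from the statistics,
gives their invariance under whitening, and matches Gaussian exponents under a linear change of
variables. -/
lemma star_mulVec_dotProduct_inv_mulVec {T S G : Matrix ι ι ℂ}
    (hTu : IsUnit T.det) (hS : S = T * G * Tᴴ) (a z : ι → ℂ) :
    star (T *ᵥ a) ⬝ᵥ (S⁻¹ *ᵥ (T *ᵥ z)) = star a ⬝ᵥ (G⁻¹ *ᵥ z) := by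
  have hTu' : IsUnit Tᴴ.det := by rw [det_conjTranspose]; exact hTu.star
  rw [star_mulVec, hS, ← dotProduct_mulVec, mulVec_mulVec, mulVec_mulVec]
  congr 2
  rw [Matrix.mul_inv_rev, Matrix.mul_inv_rev]
  simp only [Matrix.mul_assoc, Matrix.nonsing_inv_mul _ hTu, Matrix.mul_one]
  rw [← Matrix.mul_assoc, Matrix.mul_nonsing_inv _ hTu', Matrix.one_mul]

/-- The Sherman–Morrison formula for the sesquilinear form of the inverse. -/
lemma dotProduct_inv_add_vecMulVec {G : Matrix ι ι ℂ} (hG : G.PosDef) (z x y : ι → ℂ) :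
    star x ⬝ᵥ ((G + vecMulVec z (star z))⁻¹ *ᵥ y) =
      star x ⬝ᵥ (G⁻¹ *ᵥ y) -
        (star x ⬝ᵥ (G⁻¹ *ᵥ z)) * (star z ⬝ᵥ (G⁻¹ *ᵥ y)) / (1 + star z ⬝ᵥ (G⁻¹ *ᵥ z)) := by
  set r : ℂ := star z ⬝ᵥ (G⁻¹ *ᵥ z) with hr
  have hdet : IsUnit G.det := (Matrix.isUnit_iff_isUnit_det _).1 hG.isUnit
  have hr0 : 0 ≤ r := hG.inv.posSemidef.dotProduct_mulVec_nonneg z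
  have h1 : (1 + r) ≠ 0 := by
    have : (0 : ℂ) < 1 + r := add_pos_of_pos_of_nonneg one_pos hr0
    exact this.ne'
  have hinv : (G + vecMulVec z (star z))⁻¹ =
      G⁻¹ - (1 + r)⁻¹ • vecMulVec (G⁻¹ *ᵥ z) (star z ᵥ* G⁻¹) := by
    apply Matrix.inv_eq_right_inv
    rw [add_mul, mul_sub, mul_sub, Matrix.mul_nonsing_inv _ hdet, Matrix.mul_smul,
      Matrix.mul_smul, Matrix.mul_vecMulVec, mulVec_mulVec, Matrix.mul_nonsing_inv _ hdet,
      one_mulVec, Matrix.vecMulVec_mul, vecMulVec_mul_vecMulVec, ← hr]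
    ext i j
    simp only [Matrix.add_apply, Matrix.sub_apply, Matrix.smul_apply, vecMulVec_apply,
      smul_eq_mul, Pi.smul_apply]
    field_simp
    ring
  rw [hinv, sub_mulVec, smul_mulVec, dotProduct_sub, dotProduct_smul, vecMulVec_mulVec]
  simp only [dotProduct_smul, smul_eq_mul, MulOpposite.smul_eq_mul_unop, MulOpposite.unop_op,
    ← dotProduct_mulVec]
  field_simp

/-- `a† (XX†)⁻¹ X e`. -/
noncomputable def crossTerm (X : Matrix ι J ℂ) (a : ι → ℂ) (e : J → ℂ) : ℂ :=
  star a ⬝ᵥ ((X * Xᴴ)⁻¹ *ᵥ (X *ᵥ e))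

/-- `|a† (XX†)⁻¹ X e|² / a† (XX†)⁻¹ a`. -/
noncomputable def raoForm (X : Matrix ι J ℂ) (a : ι → ℂ) (e : J → ℂ) : ℝ :=
  ‖crossTerm X a e‖ ^ 2 / (star a ⬝ᵥ ((X * Xᴴ)⁻¹ *ᵥ a)).re

/-- `1 - e† X† (XX†)⁻¹ X e`. -/
noncomputable def residual (X : Matrix ι J ℂ) (e : J → ℂ) : ℝ :=
  1 - (star (X *ᵥ e) ⬝ᵥ ((X * Xᴴ)⁻¹ *ᵥ (X *ᵥ e))).re

/-- The normalised Doppler vector, extended by zero to the training columns. -/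
noncomputable def unitDoppler (τ : Type*) (ω : κ → ℂ) : κ ⊕ τ → ℂ :=
  Sum.elim (((Real.sqrt (sqNorm ω))⁻¹ : ℂ) • star ω) 0

lemma dotProduct_star_eq_sqNorm (ω : κ → ℂ) : ω ⬝ᵥ star ω = (sqNorm ω : ℂ) := by
  have h : 0 ≤ ω ⬝ᵥ star ω := dotProduct_self_star_nonneg ω
  exact Complex.eq_re_of_ofReal_le (r := 0) (by simp)

/-- The Gram matrix in the definition is `1 × 1`. The rank-one form is what makes `Z P^⊥ Z†` differ
from `ZZ†` by a single outer product. -/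
lemma projPerp_eq {ω : κ → ℂ} (hω : 0 < sqNorm ω) :
    projPerp ω = 1 - vecMulVec (((Real.sqrt (sqNorm ω))⁻¹ : ℂ) • star ω)
      (star (((Real.sqrt (sqNorm ω))⁻¹ : ℂ) • star ω)) := by
  have h : ((replicateCol (Fin 1) (star ω))ᴴ * replicateCol (Fin 1) (star ω)) =
      (sqNorm ω : ℂ) • (1 : Matrix (Fin 1) (Fin 1) ℂ) := by
    ext i j
    rw [Subsingleton.elim j i, ← dotProduct_star_eq_sqNorm]
    simp [Matrix.mul_apply, dotProduct]
  have h2 : ((Real.sqrt (sqNorm ω) : ℂ))⁻¹ * ((Real.sqrt (sqNorm ω) : ℂ))⁻¹ =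
      (sqNorm ω : ℂ)⁻¹ := by
    rw [← mul_inv, ← Complex.ofReal_mul, Real.mul_self_sqrt hω.le]
  have h3 : ((sqNorm ω : ℂ) • (1 : Matrix (Fin 1) (Fin 1) ℂ))⁻¹ =
      (sqNorm ω : ℂ)⁻¹ • (1 : Matrix (Fin 1) (Fin 1) ℂ) := by
    apply Matrix.inv_eq_right_inv
    have : (sqNorm ω : ℂ) ≠ 0 := by exact_mod_cast hω.ne'
    rw [Matrix.smul_mul, Matrix.one_mul, smul_smul, mul_inv_cancel₀ this, one_smul]
  unfold projPerp
  rw [h, h3]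
  congr 1
  ext i j
  simp only [Matrix.mul_smul, Matrix.mul_one, Matrix.smul_apply,
    Matrix.mul_apply, vecMulVec_apply, replicateCol_apply, conjTranspose_apply, Pi.star_apply,
    Pi.smul_apply, smul_eq_mul, Finset.univ_unique, Finset.sum_singleton, star_mul',
    star_inv₀, Complex.star_def, Complex.conj_ofReal, ← h2]
  ring

lemma fromCols_mulVec_unitDoppler (Z : Matrix ι κ ℂ) (Y : Matrix ι τ ℂ) (ω : κ → ℂ) :
    fromCols Z Y *ᵥ unitDoppler τ ω = ((Real.sqrt (sqNorm ω))⁻¹ : ℂ) • (Z *ᵥ star ω) := by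
  rw [unitDoppler, fromCols_mulVec_sumElim, mulVec_zero, add_zero, mulVec_smul]

lemma fromCols_mul_conjTranspose (Z : Matrix ι κ ℂ) (Y : Matrix ι τ ℂ) :
    fromCols Z Y * (fromCols Z Y)ᴴ = Z * Zᴴ + scm Y := by
  rw [conjTranspose_fromCols_eq_fromRows_conjTranspose, fromCols_mul_fromRows, scm]

/-- The statistics in terms of the total data matrix `[Z, Y]`. -/
lemma statistics_eq {a : ι → ℂ} (ha : a ≠ 0) {ω : κ → ℂ} (hω : 0 < sqNorm ω)
    (Z : Matrix ι κ ℂ) {Y : Matrix ι τ ℂ} (hY : IsUnit (scm Y)) :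
    raoStatistic a ω Z Y = raoForm (fromCols Z Y) a (unitDoppler τ ω) ∧
    0 < residual (fromCols Z Y) (unitDoppler τ ω) ∧
    0 ≤ raoForm (fromCols Z Y) a (unitDoppler τ ω) ∧
    lambdaTwo a ω Z Y = raoForm (fromCols Z Y) a (unitDoppler τ ω) /
      residual (fromCols Z Y) (unitDoppler τ ω) ∧
    scriptB a ω Z Y = if raoForm (fromCols Z Y) a (unitDoppler τ ω) = 0 then 0 else
      residual (fromCols Z Y) (unitDoppler τ ω) +
        raoForm (fromCols Z Y) a (unitDoppler τ ω) := by
  have hS := posDef_scm hY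
  set S := scm Y with hSdef
  set s := Real.sqrt (sqNorm ω) with hs
  have hs0 : 0 < s := Real.sqrt_pos.2 hω
  have hss : s ^ 2 = sqNorm ω := Real.sq_sqrt hω.le
  set u : κ → ℂ := ((s : ℂ)⁻¹) • star ω with hu
  set z := Z *ᵥ u with hz
  have hP : projPerp ω = 1 - vecMulVec u (star u) := projPerp_eq hω
  have huu : star u ⬝ᵥ u = 1 := by
    have hsc : (s : ℂ) ≠ 0 := by exact_mod_cast hs0.ne'
    rw [hu, star_smul, smul_dotProduct, dotProduct_smul, star_star, dotProduct_star_eq_sqNorm,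
      ← hss]
    simp only [star_inv₀, Complex.star_def, Complex.conj_ofReal, smul_eq_mul]
    push_cast
    field_simp
  -- Writing the projection as `P P†` exhibits `Z P Z†` as a Gram matrix, hence positive
  -- semidefinite.
  have hPidem : projPerp ω = projPerp ω * (projPerp ω)ᴴ := by
    rw [hP]
    simp only [conjTranspose_sub, conjTranspose_one, conjTranspose_vecMulVec, star_star, mul_sub,
      sub_mul, Matrix.one_mul, Matrix.mul_one, vecMulVec_mul_vecMulVec, huu, one_smul]
    simp
  set G := S + Z * projPerp ω * Zᴴ with hGdef
  have hG : G.PosDef := by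
    refine hS.add_posSemidef ?_
    rw [hPidem, ← Matrix.mul_assoc, Matrix.mul_assoc, ← conjTranspose_mul]
    exact Matrix.posSemidef_self_mul_conjTranspose _
  -- The rank-one update: every form of `(ZZ† + S)⁻¹` becomes an expression in the three numbers
  -- `p`, `q`, `r` built from `G⁻¹`.
  have hC : Z * Zᴴ + S = G + vecMulVec z (star z) := by
    rw [hGdef, hP, hz, Matrix.mul_sub, Matrix.sub_mul, Matrix.mul_one, Matrix.mul_vecMulVec,
      Matrix.vecMulVec_mul, star_mulVec]
    abel
  have hCpos : (G + vecMulVec z (star z)).PosDef :=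
    hG.add_posSemidef (Matrix.posSemidef_vecMulVec_self_star z)
  set T := invSqrt S with hT
  have hTH := invSqrt_isHermitian S
  have hTu := isUnit_det_invSqrt hS
  have hTGT : 1 + T * Z * projPerp ω * (T * Z)ᴴ = T * G * T := by
    rw [hGdef, mul_add, add_mul, invSqrt_mul_mul_invSqrt hS, conjTranspose_mul, hTH.eq]
    simp only [Matrix.mul_assoc]
    rfl
  have hzo : zTildeOmega ω Z Y = T *ᵥ z := by
    unfold zTildeOmega zTilde
    rw [← hs, hz, hu, mulVec_smul, mulVec_smul, mulVec_mulVec]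
  have hW : whitenedInv ω Z Y = (T * G * T)⁻¹ := by
    unfold whitenedInv zTilde
    rw [← hTGT]
  have key := fun x y : ι → ℂ => star_mulVec_dotProduct_inv_mulVec (S := T * G * T) hTu
    (by rw [hT, hTH.eq]) (G := G) x y
  set p : ℂ := star a ⬝ᵥ (G⁻¹ *ᵥ a) with hp
  set q : ℂ := star a ⬝ᵥ (G⁻¹ *ᵥ z) with hq
  set r : ℂ := star z ⬝ᵥ (G⁻¹ *ᵥ z) with hr
  have hp0 : 0 < p := hG.inv.dotProduct_mulVec_pos ha
  have hr0 : 0 ≤ r := hG.inv.posSemidef.dotProduct_mulVec_nonneg z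
  obtain ⟨pr, hpr⟩ : ∃ x : ℝ, p = x := ⟨p.re, Complex.eq_re_of_ofReal_le (r := 0) (by simpa using hp0.le)⟩
  obtain ⟨rr, hrr⟩ : ∃ x : ℝ, r = x := ⟨r.re, Complex.eq_re_of_ofReal_le (r := 0) (by simpa using hr0)⟩
  have hpr0 : 0 < pr := by rw [hpr] at hp0; exact_mod_cast hp0
  have hrr0 : 0 ≤ rr := by rw [hrr] at hr0; exact_mod_cast hr0
  have hqs : star z ⬝ᵥ (G⁻¹ *ᵥ a) = star q := by
    rw [hq, star_dotProduct, star_mulVec G⁻¹, hG.inv.1.eq, ← dotProduct_mulVec]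
  have hqq : q * star q = ((‖q‖ ^ 2 : ℝ) : ℂ) := by
    rw [Complex.star_def, Complex.mul_conj, Complex.normSq_eq_norm_sq]
  have hXX : fromCols Z Y * (fromCols Z Y)ᴴ = G + vecMulVec z (star z) := by
    rw [fromCols_mul_conjTranspose, hC]
  have hXe : fromCols Z Y *ᵥ unitDoppler τ ω = z := by
    rw [fromCols_mulVec_unitDoppler, ← mulVec_smul]
  have h1r : (1 + rr) ≠ 0 := by positivity
  have h1rc : (1 + (rr : ℂ)) ≠ 0 := by exact_mod_cast h1r
  have hp1 : star a ⬝ᵥ ((G + vecMulVec z (star z))⁻¹ *ᵥ a) =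
      ((pr - ‖q‖ ^ 2 / (1 + rr) : ℝ) : ℂ) := by
    rw [dotProduct_inv_add_vecMulVec hG, ← hp, ← hq, hqs, ← hr, hqq, hpr, hrr]
    push_cast
    ring
  have hq1 : star a ⬝ᵥ ((G + vecMulVec z (star z))⁻¹ *ᵥ z) = q / ((1 + rr : ℝ) : ℂ) := by
    rw [dotProduct_inv_add_vecMulVec hG, ← hq, ← hr, hrr]
    push_cast
    field_simp
    ring
  have hr1 : star z ⬝ᵥ ((G + vecMulVec z (star z))⁻¹ *ᵥ z) = ((rr / (1 + rr) : ℝ) : ℂ) := by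
    rw [dotProduct_inv_add_vecMulVec hG, ← hr, hrr]
    push_cast
    field_simp
    ring
  -- This strict inequality, equivalent to `Λ' < 1`, is read off from positivity of `a†(ZZ† +
  -- S)⁻¹a`.
  have hD : 0 < pr - ‖q‖ ^ 2 / (1 + rr) := by
    have := hCpos.inv.dotProduct_mulVec_pos ha
    rw [hp1] at this
    exact_mod_cast this
  have hD' : 0 < pr * (1 + rr) - ‖q‖ ^ 2 := by
    have : 0 < (pr - ‖q‖ ^ 2 / (1 + rr)) * (1 + rr) := by positivity
    field_simp at this
    linarith
  have hrao : raoForm (fromCols Z Y) a (unitDoppler τ ω) =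
      ‖q‖ ^ 2 / ((1 + rr) * (pr * (1 + rr) - ‖q‖ ^ 2)) := by
    unfold raoForm crossTerm
    rw [hXX, hXe, hp1, hq1, norm_div, Complex.norm_real, Complex.ofReal_re, Real.norm_eq_abs,
      abs_of_pos (by positivity : 0 < 1 + rr)]
    have : pr - ‖q‖ ^ 2 / (1 + rr) = (pr * (1 + rr) - ‖q‖ ^ 2) / (1 + rr) := by field_simp
    rw [this]
    field_simp
  have hres : residual (fromCols Z Y) (unitDoppler τ ω) = 1 / (1 + rr) := by
    unfold residual
    rw [hXX, hXe, hr1, Complex.ofReal_re]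
    field_simp
    ring
  have hl1 : lambdaOne a ω Z Y = ‖q‖ ^ 2 / (pr * (1 + rr)) := by
    unfold lambdaOne aTilde
    rw [hzo, hW, key, key, key, ← hp, ← hq, ← hr, hpr, hrr, Complex.ofReal_re,
      Complex.ofReal_re]
    field_simp
  have hlh : lhamf a ω Z Y = ‖q‖ ^ 2 / pr := by
    unfold lhamf aTilde
    rw [hzo, hW, key, key, ← hp, ← hq, hpr, Complex.ofReal_re]
  have hl2 : lambdaTwo a ω Z Y = ‖q‖ ^ 2 / (pr * (1 + rr) - ‖q‖ ^ 2) := by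
    unfold lambdaTwo
    rw [hl1]
    have : 1 - ‖q‖ ^ 2 / (pr * (1 + rr)) = (pr * (1 + rr) - ‖q‖ ^ 2) / (pr * (1 + rr)) := by
      field_simp
    rw [this]
    field_simp
  refine ⟨?_, ?_, ?_, ?_, ?_⟩
  · unfold raoStatistic raoForm crossTerm
    have hZω : Z *ᵥ star ω = (s : ℂ) • z := by
      have hsc : (s : ℂ) ≠ 0 := by exact_mod_cast hs0.ne'
      rw [hz, hu, mulVec_smul, smul_smul, mul_inv_cancel₀ hsc, one_smul]
    rw [hXX, hXe, ← hSdef, hC, hZω, mulVec_smul, dotProduct_smul, norm_smul, Complex.norm_real,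
      Real.norm_eq_abs, abs_of_pos hs0, mul_pow, hss, mul_comm (_ : ℝ) (sqNorm ω),
      mul_div_mul_left _ _ hω.ne']
  · rw [hres]; positivity
  · rw [hrao]; positivity
  · rw [hl2, hrao, hres]; field_simp
  · unfold scriptB
    rw [hl2, hlh, hrao, hres]
    -- If `q = 0` then `Λ_LHAMF = 0`, and division by zero returns the conventional value `0`.
    by_cases hq0 : ‖q‖ = 0
    · simp [hq0]
    · rw [if_neg (by positivity)]
      field_simp
      ring


lemma forms_mul_left {A : Matrix ι ι ℂ} (hA : IsUnit A.det) (X : Matrix ι J ℂ) (a : ι → ℂ)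
    (e : J → ℂ) :
    raoForm (A * X) (A *ᵥ a) e = raoForm X a e ∧ residual (A * X) e = residual X e := by
  have h := fun x y => star_mulVec_dotProduct_inv_mulVec hA (S := (A * X) * (A * X)ᴴ)
    (G := X * Xᴴ) (by simp only [conjTranspose_mul, Matrix.mul_assoc]) x y
  unfold raoForm crossTerm residual
  simp only [← mulVec_mulVec, h, and_self]

lemma raoForm_smul {c : ℝ} (hc : 0 < c) (X : Matrix ι J ℂ) (a : ι → ℂ) (e : J → ℂ) :
    raoForm X ((c : ℂ) • a) e = raoForm X a e := by
  unfold raoForm crossTerm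
  have h : ∀ v : ι → ℂ, star ((c : ℂ) • a) ⬝ᵥ v = (c : ℂ) * (star a ⬝ᵥ v) := by
    intro v
    rw [star_smul, smul_dotProduct, Complex.star_def, Complex.conj_ofReal, smul_eq_mul]
  simp only [h, mulVec_smul, dotProduct_smul, smul_eq_mul, norm_mul, Complex.norm_real,
    Real.norm_eq_abs, abs_of_pos hc, Complex.re_ofReal_mul]
  rw [mul_pow, sq, mul_assoc c c, mul_div_mul_left _ _ hc.ne',
    mul_div_mul_left _ _ hc.ne']

/-- A unitary on the right leaves `XX†` alone, so it acts only on `e`. This converts invariance of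
the law of `X` into invariance in `e`. -/
lemma forms_mul_right {U : Matrix J J ℂ} (hU : U * Uᴴ = 1) (X : Matrix ι J ℂ) (a : ι → ℂ)
    (e : J → ℂ) : raoForm (X * U) a e = raoForm X a (U *ᵥ e) := by
  have h : X * U * (X * U)ᴴ = X * Xᴴ := by
    rw [conjTranspose_mul, Matrix.mul_assoc, ← Matrix.mul_assoc U, hU, Matrix.one_mul]
  unfold raoForm crossTerm
  rw [h, ← mulVec_mulVec e X U]

/-- The orthogonal projection onto the complement of the range of `V†`. -/
noncomputable def rowPerp (V : Matrix ι J ℂ) : Matrix J J ℂ := 1 - Vᴴ * (V * Vᴴ)⁻¹ * V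

lemma rowPerp_isHermitian (V : Matrix ι J ℂ) : (rowPerp V).IsHermitian := by
  have h : (V * Vᴴ)⁻¹.IsHermitian := (Matrix.isHermitian_mul_conjTranspose_self V).inv
  unfold rowPerp Matrix.IsHermitian
  rw [conjTranspose_sub, conjTranspose_one, conjTranspose_mul, conjTranspose_mul, h.eq,
    conjTranspose_conjTranspose, Matrix.mul_assoc]

lemma mul_rowPerp {V : Matrix ι J ℂ} (hV : IsUnit (V * Vᴴ)) : V * rowPerp V = 0 := by
  have h := (Matrix.isUnit_iff_isUnit_det _).1 hV
  unfold rowPerp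
  rw [Matrix.mul_sub, Matrix.mul_one, ← Matrix.mul_assoc, ← Matrix.mul_assoc,
    Matrix.mul_nonsing_inv _ h, Matrix.one_mul, sub_self]

lemma rowPerp_mul {V : Matrix ι J ℂ} (hV : IsUnit (V * Vᴴ)) : rowPerp V * Vᴴ = 0 := by
  have := congrArg conjTranspose (mul_rowPerp hV)
  rwa [conjTranspose_mul, (rowPerp_isHermitian V).eq, conjTranspose_zero] at this

lemma rowPerp_mul_self {V : Matrix ι J ℂ} (hV : IsUnit (V * Vᴴ)) :
    rowPerp V * rowPerp V = rowPerp V := by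
  conv_lhs => rw [show rowPerp V * rowPerp V = rowPerp V * (1 - Vᴴ * (V * Vᴴ)⁻¹ * V) from rfl]
  rw [Matrix.mul_sub, Matrix.mul_one, ← Matrix.mul_assoc, ← Matrix.mul_assoc, rowPerp_mul hV]
  simp

lemma trace_rowPerp {V : Matrix ι J ℂ} (hV : IsUnit (V * Vᴴ)) :
    (rowPerp V).trace = (Fintype.card J : ℂ) - Fintype.card ι := by
  have h := (Matrix.isUnit_iff_isUnit_det _).1 hV
  unfold rowPerp
  rw [trace_sub, trace_one, trace_mul_comm, ← Matrix.mul_assoc, Matrix.mul_nonsing_inv _ h,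
    trace_one]

lemma rowPerp_mul_right {U : Matrix J J ℂ} (hU : U * Uᴴ = 1) (hU' : Uᴴ * U = 1)
    (V : Matrix ι J ℂ) : rowPerp (V * U) = Uᴴ * rowPerp V * U := by
  have h : V * U * (V * U)ᴴ = V * Vᴴ := by
    rw [conjTranspose_mul, Matrix.mul_assoc, ← Matrix.mul_assoc U, hU, Matrix.one_mul]
  unfold rowPerp
  rw [h, Matrix.mul_sub, Matrix.sub_mul, Matrix.mul_one, hU', conjTranspose_mul]
  simp only [Matrix.mul_assoc]

/-- The statistics in terms of one row and the complement of the span of the other rows. -/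
lemma forms_single (X : Matrix ι J ℂ) (i₀ : ι) (hX : IsUnit (X * Xᴴ))
    {V : Matrix {i // i ≠ i₀} J ℂ} (hVX : V = X.submatrix Subtype.val id)
    (hV : IsUnit (V * Vᴴ)) {e : J → ℂ} (he : star e ⬝ᵥ e = 1) :
    0 < (X i₀ ⬝ᵥ (rowPerp V *ᵥ star (X i₀))).re ∧
    raoForm X (Pi.single i₀ 1) e = ‖X i₀ ⬝ᵥ (rowPerp V *ᵥ e)‖ ^ 2 /
      (X i₀ ⬝ᵥ (rowPerp V *ᵥ star (X i₀))).re ∧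
    residual X e = (star e ⬝ᵥ (rowPerp V *ᵥ e)).re - ‖X i₀ ⬝ᵥ (rowPerp V *ᵥ e)‖ ^ 2 /
      (X i₀ ⬝ᵥ (rowPerp V *ᵥ star (X i₀))).re := by
  set Q := rowPerp V with hQ
  set x := X i₀ with hx
  have hXdet := (Matrix.isUnit_iff_isUnit_det _).1 hX
  have hXpos : (X * Xᴴ).PosDef :=
    (Matrix.posSemidef_self_mul_conjTranspose X).posDef_iff_isUnit.2 hX
  set C := (X * Xᴴ)⁻¹ with hC
  have hCpos : C.PosDef := hXpos.inv
  -- `Q` fixes every vector annihilated by the other rows; `hQX` adds that on the span of all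
  -- conjugated rows only the component along row `i₀` survives `Q`.
  have hVrow : ∀ w : J → ℂ, (∀ i, i ≠ i₀ → (X *ᵥ w) i = 0) → Q *ᵥ w = w := by
    intro w hw
    have : V *ᵥ w = 0 := by
      funext i
      rw [hVX]
      exact hw i.1 i.2
    rw [hQ, rowPerp, sub_mulVec, one_mulVec, ← mulVec_mulVec, this, mulVec_zero, sub_zero]
  have hQX : ∀ b : ι → ℂ, Q *ᵥ (Xᴴ *ᵥ b) = b i₀ • (Q *ᵥ star x) := by
    intro b
    have hsplit : Xᴴ *ᵥ b = b i₀ • star x + Vᴴ *ᵥ (fun i => b i.1) := by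
      funext j
      simp only [mulVec, dotProduct, Pi.add_apply, Pi.smul_apply, smul_eq_mul,
        conjTranspose_apply, Pi.star_apply, hVX, submatrix_apply, id, hx]
      rw [← Finset.add_sum_erase _ _ (Finset.mem_univ i₀), mul_comm]
      congr 1
      refine (Finset.sum_subtype _ (fun i => ?_) _)
      simp
    rw [hsplit, mulVec_add, mulVec_smul, mulVec_mulVec, rowPerp_mul hV, zero_mulVec, add_zero]
  have hc0 : 0 < C i₀ i₀ := hCpos.diag_pos
  obtain ⟨c, hc⟩ : ∃ c : ℝ, C i₀ i₀ = c :=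
    ⟨_, Complex.eq_re_of_ofReal_le (r := 0) (by simpa using hc0.le)⟩
  have hcpos : 0 < c := by rw [hc] at hc0; exact_mod_cast hc0
  have hCs : C *ᵥ Pi.single i₀ 1 = fun i => C i i₀ := by
    funext i; simp
  -- The vector dual to row `i₀`: it lies in the span of the conjugated rows and satisfies `Xv =
  -- e_{i₀}`. Hence `v = c Qx†`, and pairing with `x` identifies `c` as `1/(xQx†)`.
  set v : J → ℂ := Xᴴ *ᵥ (C *ᵥ Pi.single i₀ 1) with hv
  have hXv : X *ᵥ v = Pi.single i₀ 1 := by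
    rw [hv, mulVec_mulVec, mulVec_mulVec, Matrix.mul_nonsing_inv _ hXdet, one_mulVec]
  have hQv : Q *ᵥ v = v := hVrow v fun i hi => by rw [hXv]; simp [hi]
  have hv2 : v = (c : ℂ) • (Q *ᵥ star x) := by
    rw [← hQv, hv, hQX, hCs, ← hc]
  have hxv : x ⬝ᵥ v = 1 := by
    have := congrFun hXv i₀
    rw [Pi.single_eq_same] at this
    exact this
  have hcc : (c : ℂ) ≠ 0 := by exact_mod_cast hcpos.ne'
  have ht : x ⬝ᵥ (Q *ᵥ star x) = ((c⁻¹ : ℝ) : ℂ) := by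
    rw [hv2, dotProduct_smul, smul_eq_mul] at hxv
    push_cast
    exact eq_inv_of_mul_eq_one_right hxv
  have hQH : Qᴴ = Q := rowPerp_isHermitian V
  have hvs : ∀ w, star v ⬝ᵥ w = (c : ℂ) * (x ⬝ᵥ (Q *ᵥ w)) := by
    intro w
    rw [hv2, star_smul, star_mulVec, star_star, hQH, smul_dotProduct, dotProduct_mulVec,
      Complex.star_def, Complex.conj_ofReal, smul_eq_mul]
  have hcross : crossTerm X (Pi.single i₀ 1) e = (c : ℂ) * (x ⬝ᵥ (Q *ᵥ e)) := by
    rw [← hvs, hv, star_mulVec, star_mulVec, hCpos.1.eq, conjTranspose_conjTranspose,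
      ← dotProduct_mulVec, ← dotProduct_mulVec, crossTerm]
  have hstars : star (Pi.single i₀ (1 : ℂ)) = (Pi.single i₀ (1 : ℂ) : ι → ℂ) := by
    funext i; by_cases hi : i = i₀ <;> simp [hi]
  have hden : star (Pi.single i₀ (1 : ℂ) : ι → ℂ) ⬝ᵥ (C *ᵥ Pi.single i₀ 1) = (c : ℂ) := by
    rw [hCs, hstars, single_dotProduct, one_mul, hc]
  refine ⟨by rw [ht, Complex.ofReal_re]; positivity, ?_, ?_⟩
  · unfold raoForm
    rw [hcross, ← hC, hden, ht, Complex.ofReal_re, Complex.ofReal_re, norm_mul, Complex.norm_real,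
      Real.norm_eq_abs, abs_of_pos hcpos]
    field_simp
  · set b := C *ᵥ (X *ᵥ e) with hb
    -- The component of `e` annihilated by all rows. Applying `Q` to `e = w + X†b` and pairing with
    -- `e` splits `e†Qe` into the residual plus `c|xQe|²`.
    set w := e - Xᴴ *ᵥ b with hw
    have hXw : X *ᵥ w = 0 := by
      rw [hw, mulVec_sub, hb, mulVec_mulVec, mulVec_mulVec, Matrix.mul_nonsing_inv _ hXdet,
        one_mulVec, sub_self]
    have hQw : Q *ᵥ w = w := hVrow w fun i _ => by rw [hXw]; rfl
    have hb0 : b i₀ = (c : ℂ) * (x ⬝ᵥ (Q *ᵥ e)) := by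
      rw [← hcross, crossTerm, hstars, single_dotProduct, one_mul]
    have hQe : Q *ᵥ e = w + b i₀ • (Q *ᵥ star x) := by
      have : e = w + Xᴴ *ᵥ b := by rw [hw, sub_add_cancel]
      rw [← hQX, ← hQw, ← mulVec_add, ← this]
    have hew : star e ⬝ᵥ (Q *ᵥ star x) = star (x ⬝ᵥ (Q *ᵥ e)) := by
      rw [star_dotProduct, star_mulVec, star_star, hQH, ← dotProduct_mulVec]
    have hee : star e ⬝ᵥ (Q *ᵥ e) = star e ⬝ᵥ e - star (X *ᵥ e) ⬝ᵥ b +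
        ((c * ‖x ⬝ᵥ (Q *ᵥ e)‖ ^ 2 : ℝ) : ℂ) := by
      have h1 : star e ⬝ᵥ w = star e ⬝ᵥ e - star (X *ᵥ e) ⬝ᵥ b := by
        rw [hw, dotProduct_sub, star_mulVec, dotProduct_mulVec]
      conv_lhs => rw [hQe, dotProduct_add, h1, dotProduct_smul, hew, hb0, smul_eq_mul, mul_assoc,
        Complex.star_def, Complex.mul_conj, Complex.normSq_eq_norm_sq]
      push_cast
      rfl
    have hre := congrArg Complex.re hee
    rw [he, Complex.add_re, Complex.sub_re, Complex.one_re, Complex.ofReal_re] at hre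
    unfold residual
    rw [← hC, ← hb, hre, ht, Complex.ofReal_re]
    field_simp
    ring

/-- Two commuting orthogonal projections, one below the other, are simultaneously unitarily
diagonalisable. -/
lemma exists_unitary_diagonal {Q P : Matrix J J ℂ} (hQ : Q.IsHermitian) (hQQ : Q * Q = Q)
    (hP : P.IsHermitian) (hPP : P * P = P) (hQP : Q * P = P) (hPQ : P * Q = P) :
    ∃ U : Matrix J J ℂ, U * Uᴴ = 1 ∧ Uᴴ * U = 1 ∧ ∃ S T : Finset J, T ⊆ S ∧
      (S.card : ℂ) = Q.trace ∧ (T.card : ℂ) = P.trace ∧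
      Q = U * diagonal (fun j => if j ∈ S then 1 else 0) * Uᴴ ∧
      P = U * diagonal (fun j => if j ∈ T then 1 else 0) * Uᴴ := by
  -- It suffices to diagonalise `Q + P`: since `(Q + P)² = Q + 3P`, both projections are quadratic
  -- polynomials in the sum.
  have hH : (Q + P).IsHermitian := hQ.add hP
  set U : Matrix J J ℂ := hH.eigenvectorUnitary.1 with hU
  have hUU : U * Uᴴ = 1 := Unitary.mul_star_self_of_mem hH.eigenvectorUnitary.2
  have hUU' : Uᴴ * U = 1 := Unitary.star_mul_self_of_mem hH.eigenvectorUnitary.2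
  set μ : J → ℂ := fun j => (hH.eigenvalues j : ℂ) with hμ
  have hspec : Q + P = U * diagonal μ * Uᴴ := by
    have := hH.spectral_theorem
    rw [Unitary.conjStarAlgAut_apply] at this
    exact this
  have hdiag : ∀ f g : J → ℂ, (U * diagonal f * Uᴴ) * (U * diagonal g * Uᴴ) =
      U * diagonal (fun j => f j * g j) * Uᴴ := by
    intro f g
    rw [← diagonal_mul_diagonal]
    simp only [Matrix.mul_assoc]
    rw [← Matrix.mul_assoc Uᴴ U, hUU', Matrix.one_mul]
  have hinj : ∀ f g : J → ℂ, U * diagonal f * Uᴴ = U * diagonal g * Uᴴ → f = g := by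
    intro f g h
    have h2 : Uᴴ * (U * diagonal f * Uᴴ) * U = Uᴴ * (U * diagonal g * Uᴴ) * U := by rw [h]
    simp only [Matrix.mul_assoc, hUU', Matrix.mul_one] at h2
    simp only [← Matrix.mul_assoc, hUU', Matrix.one_mul] at h2
    exact diagonal_injective h2
  have hsq : (Q + P) * (Q + P) = Q + (3 : ℂ) • P := by
    rw [add_mul, mul_add, mul_add, hQQ, hQP, hPQ, hPP, show (3 : ℂ) = 1 + 1 + 1 by norm_num,
      add_smul, add_smul, one_smul]
    abel
  have hlin : ∀ (α β : ℂ), α • ((Q + P) * (Q + P)) + β • (Q + P) =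
      U * diagonal (fun j => α * (μ j * μ j) + β * μ j) * Uᴴ := by
    intro α β
    have h : diagonal (fun j => α * (μ j * μ j) + β * μ j) =
        α • diagonal (fun j => μ j * μ j) + β • diagonal μ := by
      rw [← diagonal_smul, ← diagonal_smul, diagonal_add]
      rfl
    rw [hspec, hdiag, h, Matrix.mul_add, Matrix.add_mul, Matrix.mul_smul, Matrix.mul_smul,
      Matrix.smul_mul, Matrix.smul_mul]
  have hPd : P = U * diagonal (fun j => 2⁻¹ * (μ j * μ j) + (-2⁻¹) * μ j) * Uᴴ := by
    rw [← hlin, hsq]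
    module
  have hQd : Q = U * diagonal (fun j => -2⁻¹ * (μ j * μ j) + (3 / 2) * μ j) * Uᴴ := by
    rw [← hlin, hsq]
    module
  set p : J → ℂ := fun j => 2⁻¹ * (μ j * μ j) + (-2⁻¹) * μ j with hp
  set q : J → ℂ := fun j => -2⁻¹ * (μ j * μ j) + (3 / 2) * μ j with hq
  -- Idempotence forces the diagonal entries to be `0` or `1`, so traces count ones; `qp = p` gives
  -- the inclusion of supports.
  have hpp : (fun j => p j * p j) = p := hinj _ _ (by rw [← hdiag, ← hPd, hPP])
  have hqq : (fun j => q j * q j) = q := hinj _ _ (by rw [← hdiag, ← hQd, hQQ])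
  have hqp : (fun j => q j * p j) = p := hinj _ _ (by rw [← hdiag, ← hPd, ← hQd, hQP])
  have h01 : ∀ f : J → ℂ, (fun j => f j * f j) = f →
      f = fun j => if j ∈ Finset.univ.filter (fun j => f j = 1) then 1 else 0 := by
    intro f hf
    funext j
    have h := congrFun hf j
    have h2 : f j * (f j - 1) = 0 := by rw [mul_sub, h, mul_one, sub_self]
    rcases mul_eq_zero.1 h2 with h3 | h3
    · simp [h3]
    · simp [sub_eq_zero.1 h3]
  have htr : ∀ f : J → ℂ, (U * diagonal f * Uᴴ).trace = ∑ j, f j := by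
    intro f
    rw [trace_mul_comm, ← Matrix.mul_assoc, hUU', Matrix.one_mul, trace_diagonal]
  have hcard : ∀ S : Finset J, (∑ j, if j ∈ S then (1 : ℂ) else 0) = S.card := by
    intro S
    simp
  refine ⟨U, hUU, hUU', Finset.univ.filter (fun j => q j = 1),
    Finset.univ.filter (fun j => p j = 1), ?_, ?_, ?_, ?_, ?_⟩
  · intro j hj
    have h := congrFun hqp j
    simp only [Finset.mem_filter, Finset.mem_univ, true_and] at hj ⊢
    rw [hj, mul_one] at h
    exact h
  · rw [← hcard, ← h01 q hqq, hQd, htr]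
  · rw [← hcard, ← h01 p hpp, hPd, htr]
  · rw [← h01 q hqq]; exact hQd
  · rw [← h01 p hpp]; exact hPd

/-- Unitary matrices act transitively on the unit sphere. -/
lemma exists_unitary_mulVec_eq {e f : J → ℂ} (he : star e ⬝ᵥ e = 1) (hf : star f ⬝ᵥ f = 1) :
    ∃ U : Matrix J J ℂ, U * Uᴴ = 1 ∧ Uᴴ * U = 1 ∧ U *ᵥ e = f := by
  -- A Householder reflection carries `e` to `c f` once the phase `c` makes `⟨e, c f⟩` real; the
  -- phase is then divided out.
  suffices h : ∃ H : Matrix J J ℂ, ∃ c : ℂ, Hᴴ = H ∧ H * H = 1 ∧ star c * c = 1 ∧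
      H *ᵥ e = c • f by
    obtain ⟨H, c, hH, hHH, hc, hHe⟩ := h
    have hc' : c * star c = 1 := by rw [mul_comm, hc]
    refine ⟨star c • H, ?_, ?_, ?_⟩
    · rw [conjTranspose_smul, hH, Matrix.smul_mul, Matrix.mul_smul, hHH, smul_smul, star_star, hc,
        one_smul]
    · rw [conjTranspose_smul, hH, Matrix.smul_mul, Matrix.mul_smul, hHH, smul_smul, star_star,
        hc', one_smul]
    · rw [smul_mulVec, hHe, smul_smul, hc, one_smul]
  set z := star e ⬝ᵥ f with hz
  obtain ⟨c, hc, hcz⟩ : ∃ c : ℂ, star c * c = 1 ∧ c * z = (‖z‖ : ℂ) := by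
    by_cases hz0 : z = 0
    · exact ⟨1, by simp, by simp [hz0]⟩
    · have hn : (‖z‖ : ℂ) ≠ 0 := by simpa using hz0
      have hzz : z * star z = (‖z‖ : ℂ) ^ 2 := by
        rw [Complex.star_def, Complex.mul_conj, Complex.normSq_eq_norm_sq]; push_cast; rfl
      refine ⟨star z / ‖z‖, ?_, ?_⟩
      · have hns : star (‖z‖ : ℂ) = (‖z‖ : ℂ) := Complex.conj_ofReal _
        rw [star_div₀, star_star, hns, div_mul_div_comm, hzz]
        field_simp
      · rw [div_mul_eq_mul_div, mul_comm, hzz]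
        field_simp
  set t : ℝ := ‖z‖ with ht
  set w := e - c • f with hw
  have hcc : c * star c = 1 := by rw [mul_comm, hc]
  have hef : star e ⬝ᵥ (c • f) = (t : ℂ) := by rw [dotProduct_smul, ← hz, smul_eq_mul, hcz]
  have hfe : star (c • f) ⬝ᵥ e = (t : ℂ) := by
    rw [star_dotProduct, hef, Complex.star_def, Complex.conj_ofReal]
  have hff : star (c • f) ⬝ᵥ (c • f) = 1 := by
    rw [star_smul, smul_dotProduct, dotProduct_smul, hf, smul_eq_mul, smul_eq_mul, mul_one, hc]
  have hwe : star w ⬝ᵥ e = 1 - (t : ℂ) := by rw [hw, star_sub, sub_dotProduct, he, hfe]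
  have hww : star w ⬝ᵥ w = 2 * (1 - (t : ℂ)) := by
    conv_lhs => rw [hw, dotProduct_sub, ← hw, hwe, hw, star_sub, sub_dotProduct, hef, hff]
    ring
  by_cases h1 : (1 - (t : ℂ)) = 0
  · rw [h1, mul_zero, dotProduct_star_self_eq_zero, hw, sub_eq_zero] at hww
    exact ⟨1, c, by simp, by simp, hc, by rw [one_mulVec, hww]⟩
  -- The reflection across the complement of `w = e - c f`; the coefficient is `2/|w|²` because
  -- `|w|² = 2(1 - t)`.
  · refine ⟨1 - (1 - (t : ℂ))⁻¹ • vecMulVec w (star w), c, ?_, ?_, hc, ?_⟩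
    · rw [conjTranspose_sub, conjTranspose_one, conjTranspose_smul, conjTranspose_vecMulVec,
        star_star, star_inv₀, star_sub, star_one, Complex.star_def, Complex.conj_ofReal]
    · rw [sub_mul, Matrix.one_mul, mul_sub, Matrix.mul_one, Matrix.smul_mul,
        Matrix.mul_smul, vecMulVec_mul_vecMulVec, hww]
      ext i j
      simp only [Matrix.sub_apply, Matrix.smul_apply, vecMulVec_apply, Pi.smul_apply, smul_eq_mul]
      field_simp
      ring
    · rw [sub_mulVec, one_mulVec, smul_mulVec, vecMulVec_mulVec, hwe, op_smul_eq_smul, smul_smul,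
        inv_mul_cancel₀ h1, one_smul, hw, sub_sub_cancel]

/-- `R^{-1/2}` whitens, and a unitary then rotates the image of `a` onto the chosen axis without
spoiling this. The length `c` is the source of the factor `a†R⁻¹a` in `α`. -/
lemma exists_whitening {R : Matrix ι ι ℂ} (hR : R.PosDef) {a : ι → ℂ} (ha : a ≠ 0) (i₀ : ι) :
    ∃ A : Matrix ι ι ℂ, IsUnit A.det ∧ A * R * Aᴴ = 1 ∧ ∃ c : ℝ, 0 < c ∧
      A *ᵥ a = (c : ℂ) • Pi.single i₀ 1 ∧ c ^ 2 = (star a ⬝ᵥ (R⁻¹ *ᵥ a)).re := by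
  set T := invSqrt R with hT
  have hTH : Tᴴ = T := invSqrt_isHermitian R
  have hTRT : T * R * T = 1 := invSqrt_mul_mul_invSqrt hR
  have hTu : IsUnit T.det := isUnit_det_invSqrt hR
  have hRinv : R⁻¹ = T * T := by
    apply Matrix.inv_eq_right_inv
    have h1 : R * T = T⁻¹ := by
      rw [← Matrix.inv_eq_right_inv (show T * (R * T) = 1 by rw [← Matrix.mul_assoc, hTRT])]
    rw [← Matrix.mul_assoc, h1, Matrix.nonsing_inv_mul _ hTu]
  set b := T *ᵥ a with hb
  have hbb : star b ⬝ᵥ b = star a ⬝ᵥ (R⁻¹ *ᵥ a) := by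
    rw [hb, star_mulVec, hTH, hRinv, ← dotProduct_mulVec, mulVec_mulVec]
  have hpos : 0 < star a ⬝ᵥ (R⁻¹ *ᵥ a) := hR.inv.dotProduct_mulVec_pos ha
  obtain ⟨s, hs⟩ : ∃ s : ℝ, star a ⬝ᵥ (R⁻¹ *ᵥ a) = s :=
    ⟨_, Complex.eq_re_of_ofReal_le (r := 0) (by simpa using hpos.le)⟩
  have hs0 : 0 < s := by rw [hs] at hpos; exact_mod_cast hpos
  set c := Real.sqrt s with hc
  have hc0 : 0 < c := Real.sqrt_pos.2 hs0
  have hcc : (c : ℂ) ≠ 0 := by exact_mod_cast hc0.ne'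
  have hcs : c ^ 2 = s := Real.sq_sqrt hs0.le
  have hstars : star (Pi.single i₀ (1 : ℂ)) = (Pi.single i₀ (1 : ℂ) : ι → ℂ) := by
    funext i; by_cases hi : i = i₀ <;> simp [hi]
  obtain ⟨U, hU, hU', hUb⟩ := exists_unitary_mulVec_eq (e := (c : ℂ)⁻¹ • b)
    (f := Pi.single i₀ 1) (by
      rw [star_smul, smul_dotProduct, dotProduct_smul, hbb, hs, ← hcs, star_inv₀,
        Complex.star_def, Complex.conj_ofReal]
      push_cast
      simp only [smul_eq_mul]
      field_simp) (by rw [hstars]; simp)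
  refine ⟨U * T, ?_, ?_, c, hc0, ?_, by rw [hs, Complex.ofReal_re, hcs]⟩
  · rw [det_mul]
    refine IsUnit.mul (IsUnit.of_mul_eq_one (Uᴴ.det) ?_) hTu
    rw [← det_mul, hU, det_one]
  · rw [conjTranspose_mul, hTH, Matrix.mul_assoc, Matrix.mul_assoc, ← Matrix.mul_assoc R,
      ← Matrix.mul_assoc T, ← Matrix.mul_assoc T, hTRT, Matrix.one_mul, hU]
  · rw [← mulVec_mulVec, ← hb, ← hUb, mulVec_smul, smul_smul, mul_inv_cancel₀ hcc, one_smul]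

end Algebra

/-! ### Complex Gaussian vectors -/

section Gaussian

set_option linter.unusedSectionVars false

variable {ι J : Type*} [Fintype ι] [DecidableEq ι] [Fintype J] [DecidableEq J]

/-- The standard circularly symmetric complex Gaussian law. -/
noncomputable def stdComplex : Measure ℂ :=
  volume.withDensity fun z => ENNReal.ofReal (Real.exp (-‖z‖ ^ 2) / Real.pi)

lemma integral_exp_neg_norm_sq_div_pi : ∫ z : ℂ, Real.exp (-‖z‖ ^ 2) / Real.pi = 1 := by
  have h := GaussianFourier.integral_rexp_neg_mul_sq_norm (V := ℂ) (b := 1) one_pos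
  simp only [Complex.finrank_real_complex, neg_mul, one_mul] at h
  rw [integral_div, h]
  norm_num [Real.pi_ne_zero]

lemma integrable_exp_neg_norm_sq_div_pi :
    Integrable (fun z : ℂ => Real.exp (-‖z‖ ^ 2) / Real.pi) :=
  .of_integral_ne_zero (by rw [integral_exp_neg_norm_sq_div_pi]; exact one_ne_zero)

instance : IsProbabilityMeasure stdComplex := by
  constructor
  rw [stdComplex, withDensity_apply _ MeasurableSet.univ, Measure.restrict_univ,
    ← ofReal_integral_eq_lintegral_ofReal integrable_exp_neg_norm_sq_div_pi
      (Filter.Eventually.of_forall fun z => by positivity), integral_exp_neg_norm_sq_div_pi,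
    ENNReal.ofReal_one]

/-- For the identity covariance the exponent is a sum over coordinates, so the density factorises.
-/
lemma complexGaussian_one :
    complexGaussian (1 : Matrix J J ℂ) = Measure.pi fun _ : J => stdComplex := by
  refine (Measure.pi_eq fun s hs => ?_).symm
  set g : ℂ → ℝ := fun z => Real.exp (-‖z‖ ^ 2) / Real.pi with hg
  have hdens : ∀ z : J → ℂ, Real.exp (-(star z ⬝ᵥ ((1 : Matrix J J ℂ)⁻¹ *ᵥ z)).re) /
      (Real.pi ^ Fintype.card J * (1 : Matrix J J ℂ).det.re) = ∏ j, g (z j) := by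
    intro z
    have h1 : (star z ⬝ᵥ z).re = ∑ j, ‖z j‖ ^ 2 := by
      simp only [dotProduct, Pi.star_apply, Complex.star_def, Complex.re_sum]
      refine Finset.sum_congr rfl fun j _ => ?_
      rw [mul_comm, Complex.mul_conj, Complex.normSq_eq_norm_sq, Complex.ofReal_re]
    rw [inv_one, one_mulVec, h1, det_one, Complex.one_re, mul_one, Finset.prod_div_distrib,
      Finset.prod_const, Finset.card_univ, ← Real.exp_sum, Finset.sum_neg_distrib]
  have hi : Integrable (fun z : J → ℂ => ∏ j, g (z j)) :=
    Integrable.fintype_prod fun _ => integrable_exp_neg_norm_sq_div_pi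
  have hnn : ∀ z, 0 ≤ g z := fun z => by positivity
  rw [complexGaussian, withDensity_apply _ (MeasurableSet.univ_pi hs)]
  simp only [hdens, stdComplex]
  rw [← ofReal_integral_eq_lintegral_ofReal hi.integrableOn
    (Filter.Eventually.of_forall fun z => Finset.prod_nonneg fun j _ => hnn _),
    ← integral_indicator (MeasurableSet.univ_pi hs)]
  have hprod : (Set.univ.pi s).indicator (fun z : J → ℂ => ∏ j, g (z j)) =
      fun z => ∏ j, (s j).indicator g (z j) := by
    funext z
    by_cases hz : z ∈ Set.univ.pi s
    · rw [Set.indicator_of_mem hz]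
      exact Finset.prod_congr rfl fun j _ => (Set.indicator_of_mem (hz j trivial) _).symm
    · rw [Set.indicator_of_notMem hz]
      simp only [Set.mem_pi, Set.mem_univ, true_implies, not_forall] at hz
      obtain ⟨j, hj⟩ := hz
      exact (Finset.prod_eq_zero (Finset.mem_univ j) (Set.indicator_of_notMem hj _)).symm
  rw [hprod, integral_fintype_prod_volume_eq_prod (fun j => (s j).indicator g),
    ENNReal.ofReal_prod_of_nonneg fun j _ => integral_nonneg fun z =>
      Set.indicator_nonneg (fun z _ => hnn z) z]
  refine Finset.prod_congr rfl fun j _ => ?_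
  rw [withDensity_apply _ (hs j), integral_indicator (hs j),
    ofReal_integral_eq_lintegral_ofReal integrable_exp_neg_norm_sq_div_pi.integrableOn
      (Filter.Eventually.of_forall hnn)]

lemma measurable_mulVec (A : Matrix ι J ℂ) : Measurable (fun z : J → ℂ => A *ᵥ z) := by
  refine measurable_pi_lambda _ fun i => ?_
  simp only [mulVec, dotProduct]
  fun_prop

/-- As a real-linear map, `A` has determinant `|det A|²`, exactly the factor by which `det R`
changes, while the exponent is invariant. -/
lemma map_mulVec_complexGaussian {A : Matrix ι ι ℂ} (hA : IsUnit A.det) (R : Matrix ι ι ℂ) :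
    (complexGaussian R).map (fun z => A *ᵥ z) = complexGaussian (A * R * Aᴴ) := by
  have hdet : (0 : ℝ) < ‖A.det‖ ^ 2 := by have := hA.ne_zero; positivity
  set f : (ι → ℂ) →ₗ[ℝ] (ι → ℂ) := (Matrix.toLin' A).restrictScalars ℝ with hf
  have hfdet : LinearMap.det f = ‖A.det‖ ^ 2 := by
    rw [hf, LinearMap.det_restrictScalars, LinearMap.det_toLin', Algebra.norm_complex_apply,
      Complex.normSq_eq_norm_sq]
  have hmap := Measure.map_linearMap_addHaar_eq_smul_addHaar (volume : Measure (ι → ℂ))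
    (f := f) (by rw [hfdet]; exact hdet.ne')
  have hAm := measurable_mulVec A
  have hdens : ∀ z, ENNReal.ofReal (Real.exp (-(star (A *ᵥ z) ⬝ᵥ
      ((A * R * Aᴴ)⁻¹ *ᵥ (A *ᵥ z))).re) / (Real.pi ^ Fintype.card ι * (A * R * Aᴴ).det.re)) =
      ENNReal.ofReal |(LinearMap.det f)⁻¹| * ENNReal.ofReal (Real.exp (-(star z ⬝ᵥ
        (R⁻¹ *ᵥ z)).re) / (Real.pi ^ Fintype.card ι * R.det.re)) := by
    intro z
    have h2 : (A * R * Aᴴ).det.re = ‖A.det‖ ^ 2 * R.det.re := by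
      rw [det_mul, det_mul, det_conjTranspose, mul_right_comm, Complex.star_def,
        Complex.mul_conj, Complex.normSq_eq_norm_sq, Complex.re_ofReal_mul]
    rw [star_mulVec_dotProduct_inv_mulVec hA rfl, h2, ← ENNReal.ofReal_mul (abs_nonneg _), hfdet,
      abs_of_pos (inv_pos.2 hdet)]
    congr 1
    rw [mul_left_comm, mul_comm (‖A.det‖ ^ 2), ← div_div _ _ (‖A.det‖ ^ 2), div_eq_inv_mul]
  have hcont : ∀ R : Matrix ι ι ℂ, Measurable fun z : ι → ℂ => ENNReal.ofReal
      (Real.exp (-(star z ⬝ᵥ (R⁻¹ *ᵥ z)).re) / (Real.pi ^ Fintype.card ι * R.det.re)) := by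
    intro R
    apply Measurable.ennreal_ofReal
    apply Measurable.div_const
    apply Real.measurable_exp.comp
    apply Measurable.neg
    apply Complex.measurable_re.comp
    simp only [mulVec, dotProduct]
    fun_prop
  ext s hs
  have hfA : (f : (ι → ℂ) → (ι → ℂ)) = fun z => A *ᵥ z := rfl
  have hvol : (volume : Measure (ι → ℂ)).map (fun z => A *ᵥ z) =
      ENNReal.ofReal |(LinearMap.det f)⁻¹| • volume := by rw [← hfA, hmap]
  have hc0 : ENNReal.ofReal |(LinearMap.det f)⁻¹| ≠ 0 := by
    rw [hfdet, abs_of_pos (inv_pos.2 hdet)]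
    simpa using hA.ne_zero
  rw [Measure.map_apply hAm hs, complexGaussian, withDensity_apply _ (hAm hs), complexGaussian,
    withDensity_apply _ hs, ← ENNReal.mul_right_inj hc0 ENNReal.ofReal_ne_top,
    ← lintegral_const_mul _ (hcont R)]
  simp only [← hdens]
  rw [← setLIntegral_map hs (hcont (A * R * Aᴴ)) hAm, hvol, Measure.restrict_smul,
    lintegral_smul_measure, smul_eq_mul]

instance : IsProbabilityMeasure (complexGaussian (1 : Matrix J J ℂ)) := by
  rw [complexGaussian_one]; infer_instance

/-- The law of a vector of independent standard complex Gaussian coordinates. -/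
noncomputable abbrev stdVec (J : Type*) [Fintype J] : Measure (J → ℂ) :=
  Measure.pi fun _ => stdComplex

lemma measurePreserving_mulVec {U : Matrix J J ℂ} (hU : U * Uᴴ = 1) :
    MeasurePreserving (fun z => U *ᵥ z) (stdVec J) (stdVec J) := by
  refine ⟨measurable_mulVec U, ?_⟩
  have hdet : IsUnit U.det := by
    refine IsUnit.of_mul_eq_one (Uᴴ.det) ?_
    rw [← det_mul, hU, det_one]
  rw [stdVec, ← complexGaussian_one, map_mulVec_complexGaussian hdet, Matrix.mul_one, hU]

/-- The total mass is inherited from the standard law through whitening, so no determinant integral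
has to be evaluated. -/
lemma isProbabilityMeasure_complexGaussian {R : Matrix ι ι ℂ} {A : Matrix ι ι ℂ}
    (hA : IsUnit A.det) (hAR : A * R * Aᴴ = 1) : IsProbabilityMeasure (complexGaussian R) := by
  have h : IsProbabilityMeasure ((complexGaussian R).map (fun z => A *ᵥ z)) := by
    rw [map_mulVec_complexGaussian hA, hAR]; infer_instance
  exact Measure.isProbabilityMeasure_of_map (f := fun z => A *ᵥ z)

lemma measurePreserving_curry_pi {ι κ X : Type*} [Fintype ι] [Fintype κ] [MeasurableSpace X]
    (μ : Measure X) [IsProbabilityMeasure μ] :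
    MeasurePreserving (MeasurableEquiv.curry ι κ X) (Measure.pi fun _ => μ)
      (Measure.pi fun _ => Measure.pi fun _ => μ) := by
  refine ⟨(MeasurableEquiv.curry ι κ X).measurable, ?_⟩
  have := Measure.infinitePi_map_curry (ι := ι) (κ := κ) (fun _ _ => μ)
  simpa only [Measure.infinitePi_eq_pi] using this

/-- Transposing the noise matrix: independent columns with independent entries are the same thing as
independent rows with independent entries. -/
lemma measurePreserving_swap_pi {X : Type*} [MeasurableSpace X] (μ : Measure X)
    [IsProbabilityMeasure μ] : MeasurePreserving (fun (w : J → ι → X) i j => w j i)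
      (Measure.pi fun _ => Measure.pi fun _ => μ) (Measure.pi fun _ => Measure.pi fun _ => μ) := by
  have h1 := (measurePreserving_curry_pi (ι := J) (κ := ι) μ).symm
  have h2 := measurePreserving_piCongrLeft (fun _ : ι × J => μ) (Equiv.prodComm J ι)
  have h3 := (measurePreserving_curry_pi (ι := ι) (κ := J) μ).comp (h2.comp h1)
  convert h3 using 1
  funext w i j
  rfl

/-- Whitening the noise columns gives independent standard rows. -/
lemma measurePreserving_whiten {R A : Matrix ι ι ℂ} (hA : IsUnit A.det) (hAR : A * R * Aᴴ = 1) :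
    MeasurePreserving (fun (w : J → ι → ℂ) i j => (A *ᵥ w j) i)
      (Measure.pi fun _ => complexGaussian R) (Measure.pi fun _ => stdVec J) := by
  have := isProbabilityMeasure_complexGaussian hA hAR
  have h1 : MeasurePreserving (fun (w : J → ι → ℂ) j => A *ᵥ w j)
      (Measure.pi fun _ => complexGaussian R) (Measure.pi fun _ => stdVec ι) := by
    refine measurePreserving_pi _ _ fun j => ⟨measurable_mulVec A, ?_⟩
    rw [map_mulVec_complexGaussian hA, hAR, complexGaussian_one]
  exact (measurePreserving_swap_pi stdComplex).comp h1

end Gaussian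

/-! ### Almost sure linear independence -/

section Independence

set_option linter.unusedSectionVars false

variable {ι J J' : Type*} [Fintype ι] [Fintype J] [Fintype J']

lemma stdVec_absolutelyContinuous : stdVec J ≪ volume := by
  classical
  rw [stdVec, ← complexGaussian_one]
  exact withDensity_absolutelyContinuous _ _

/-- The preimage of a proper subspace under a surjection is a proper subspace, hence Lebesgue null.
-/
lemma stdVec_apply_mem_submodule (f : (J → ℂ) →ₗ[ℂ] (J' → ℂ)) (hf : Function.Surjective f)
    (W : Submodule ℂ (J' → ℂ)) (hW : W ≠ ⊤) : stdVec J {x | f x ∈ W} = 0 := by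
  refine stdVec_absolutelyContinuous ?_
  have h := Measure.addHaar_submodule (volume : Measure (J → ℂ))
    ((W.comap f).restrictScalars ℝ) ?_
  · exact h
  · intro h
    rw [Submodule.restrictScalars_eq_top_iff] at h
    apply hW
    rw [← Submodule.map_comap_eq_of_surjective hf W, h, Submodule.map_top,
      LinearMap.range_eq_top.2 hf]

/-- By induction: fewer vectors than the dimension span a proper subspace, which a further
independent Gaussian vector almost surely avoids. The map `f` allows keeping only the training
coordinates. -/
lemma ae_linearIndependent_fin (f : (J → ℂ) →ₗ[ℂ] (J' → ℂ)) (hf : Function.Surjective f) :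
    ∀ n : ℕ, n ≤ Fintype.card J' →
      ∀ᵐ x ∂(Measure.pi fun _ : Fin n => stdVec J), LinearIndependent ℂ fun i => f (x i) := by
  intro n
  induction n with
  | zero => exact fun _ => Filter.Eventually.of_forall fun x => linearIndependent_empty_type
  | succ n ih =>
    intro hn
    have hfc : Continuous f := f.continuous_of_finiteDimensional
    have h1 := measurePreserving_piFinSuccAbove (fun _ : Fin (n + 1) => stdVec J) 0
    have h2 := (Measure.measurePreserving_swap (μ := stdVec J)
      (ν := Measure.pi fun _ : Fin n => stdVec J)).comp h1
    -- Linear independence is an open condition; this supplies the measurability needed for Fubini.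
    have hopen : IsOpen {z : (Fin n → J → ℂ) × (J → ℂ) | LinearIndependent ℂ
        (Fin.cons (f z.2) (fun i => f (z.1 i)) : Fin (n + 1) → J' → ℂ)} := by
      refine (isOpen_setOfPred_linearIndependent (𝕜 := ℂ)).preimage ?_
      refine continuous_pi fun i => ?_
      refine Fin.cases ?_ (fun i => ?_) i
      · exact hfc.comp continuous_snd
      · exact hfc.comp ((continuous_apply i).comp continuous_fst)
    have h3 : ∀ᵐ z ∂((Measure.pi fun _ : Fin n => stdVec J).prod (stdVec J)),
        LinearIndependent ℂ (Fin.cons (f z.2) (fun i => f (z.1 i)) : Fin (n + 1) → J' → ℂ) := by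
      rw [Measure.ae_prod_iff_ae_ae hopen.measurableSet]
      filter_upwards [ih (by omega)] with x hx
      have hW : Submodule.span ℂ (Set.range fun i => f (x i)) ≠ ⊤ := by
        intro h
        have := finrank_range_le_card (R := ℂ) (fun i => f (x i))
        rw [Set.finrank, h, finrank_top, Module.finrank_fintype_fun_eq_card, Fintype.card_fin]
          at this
        omega
      have h0 := stdVec_apply_mem_submodule f hf _ hW
      filter_upwards [measure_eq_zero_iff_ae_notMem.1 h0] with y hy
      exact linearIndependent_finCons.2 ⟨hx, hy⟩
    filter_upwards [h2.quasiMeasurePreserving.ae h3] with x hx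
    convert hx using 1
    funext i
    refine Fin.cases ?_ (fun i => ?_) i
    · rfl
    · rfl

lemma ae_linearIndependent (f : (J → ℂ) →ₗ[ℂ] (J' → ℂ)) (hf : Function.Surjective f)
    (h : Fintype.card ι ≤ Fintype.card J') :
    ∀ᵐ x ∂(Measure.pi fun _ : ι => stdVec J), LinearIndependent ℂ fun i => f (x i) := by
  have h1 := measurePreserving_piCongrLeft (fun _ : Fin (Fintype.card ι) => stdVec J)
    (Fintype.equivFin ι)
  filter_upwards [h1.quasiMeasurePreserving.ae (ae_linearIndependent_fin f hf _ h)] with x hx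
  rw [← linearIndependent_equiv (Fintype.equivFin ι).symm]
  convert hx using 1
  funext i
  obtain ⟨j, rfl⟩ := (Fintype.equivFin ι).surjective i
  rw [Function.comp_apply, Equiv.symm_apply_apply, MeasurableEquiv.coe_piCongrLeft,
    Equiv.piCongrLeft_apply_apply]

lemma isUnit_mul_conjTranspose_of_linearIndependent [DecidableEq ι] {V : Matrix ι J ℂ}
    (hV : LinearIndependent ℂ fun i => V i) : IsUnit (V * Vᴴ) :=
  (Matrix.PosDef.mul_conjTranspose_self V (Matrix.vecMul_injective_iff.2 hV)).isUnit

end Independence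

/-! ### Erlang and beta laws -/

section Erlang

/-- The gamma law with shape parameter `k + 1` and rate one. -/
noncomputable def erlang (k : ℕ) : Measure ℝ :=
  (volume.restrict (Set.Ioi 0)).withDensity fun x =>
    ENNReal.ofReal (x ^ k * Real.exp (-x) / k.factorial)

/-- The beta law with parameters `p + 1` and `q + 1`. -/
noncomputable def betaNat (p q : ℕ) : Measure ℝ :=
  (volume.restrict (Set.Ioo 0 1)).withDensity fun b =>
    ENNReal.ofReal ((p + q + 1).factorial / (p.factorial * q.factorial) * (b ^ p * (1 - b) ^ q))

lemma measurable_erlang_density (k : ℕ) :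
    Measurable fun x : ℝ => ENNReal.ofReal (x ^ k * Real.exp (-x) / k.factorial) := by
  fun_prop

lemma lintegral_erlang (k : ℕ) {f : ℝ → ENNReal} (hf : Measurable f) :
    ∫⁻ x, f x ∂erlang k = ∫⁻ x in Set.Ioi 0,
      ENNReal.ofReal (x ^ k * Real.exp (-x) / k.factorial) * f x := by
  rw [erlang, lintegral_withDensity_eq_lintegral_mul _ (measurable_erlang_density k) hf]
  rfl

/-- Polar coordinates followed by `x = r²`; the area `π` of the unit disc cancels the normalisation
of the density. -/
lemma map_norm_sq_stdComplex : stdComplex.map (fun z => ‖z‖ ^ 2) = erlang 0 := by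
  ext A hA
  have hm : Measurable fun z : ℂ => ‖z‖ ^ 2 := by fun_prop
  set g : ℝ → ℝ := A.indicator fun x => Real.exp (-x) with hg
  have hgnn : ∀ x, 0 ≤ g x := Set.indicator_nonneg fun x _ => (Real.exp_pos _).le
  have hgi : IntegrableOn g (Set.Ioi 0) := (integrableOn_exp_neg_Ioi 0).indicator hA
  have h1 : stdComplex ((fun z : ℂ => ‖z‖ ^ 2) ⁻¹' A) =
      ENNReal.ofReal (∫ z : ℂ, g (‖z‖ ^ 2) / Real.pi) := by
    rw [stdComplex, withDensity_apply _ (hm hA), ← ofReal_integral_eq_lintegral_ofReal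
      integrable_exp_neg_norm_sq_div_pi.integrableOn
      (Filter.Eventually.of_forall fun z => by positivity), ← integral_indicator (hm hA)]
    congr 2
    funext z
    by_cases hz : ‖z‖ ^ 2 ∈ A
    · rw [Set.indicator_of_mem (show z ∈ (fun z : ℂ => ‖z‖ ^ 2) ⁻¹' A from hz), hg,
        Set.indicator_of_mem hz]
    · rw [Set.indicator_of_notMem (show z ∉ (fun z : ℂ => ‖z‖ ^ 2) ⁻¹' A from hz), hg,
        Set.indicator_of_notMem hz, zero_div]
  have h2 : erlang 0 A = ENNReal.ofReal (∫ x in Set.Ioi 0, g x) := by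
    rw [ofReal_integral_eq_lintegral_ofReal hgi (Filter.Eventually.of_forall hgnn), erlang,
      withDensity_apply _ hA, ← lintegral_indicator hA]
    congr 1
    funext x
    by_cases hx : x ∈ A <;> simp [hg, hx]
  rw [Measure.map_apply hm hA, h1, h2]
  congr 1
  have h3 := integral_fun_norm_addHaar (volume : Measure ℂ) (fun r => g (r ^ 2) / Real.pi)
  have h4 := integral_comp_rpow_Ioi g (two_ne_zero (α := ℝ))
  have hball : (volume : Measure ℂ).real (Metric.ball 0 1) = Real.pi := by
    simp [Measure.real, Complex.volume_ball]
  rw [h3, ← h4, hball, Complex.finrank_real_complex]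
  simp only [smul_eq_mul, nsmul_eq_mul]
  rw [← integral_const_mul, ← integral_const_mul]
  refine setIntegral_congr_fun measurableSet_Ioi fun x hx => ?_
  have := Real.pi_ne_zero
  norm_num [Real.rpow_two]
  field_simp

lemma lintegral_mul_left {s : ℝ} (hs : 0 < s) {f : ℝ → ENNReal} (hf : Measurable f) :
    ∫⁻ x, f x = ENNReal.ofReal s * ∫⁻ b, f (s * b) := by
  conv_lhs => rw [← Real.smul_map_volume_mul_left hs.ne']
  rw [lintegral_smul_measure, lintegral_map hf (by fun_prop), abs_of_pos hs, smul_eq_mul]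

/-- The change of variables `x = s b`, `y = s (1 - b)` in the positive quadrant. -/
lemma lintegral_Ioi_Ioi {H : ℝ → ℝ → ENNReal} (hH : Measurable (Function.uncurry H)) :
    ∫⁻ x in Set.Ioi 0, ∫⁻ y in Set.Ioi 0, H x y =
      ∫⁻ s in Set.Ioi 0, ∫⁻ b in Set.Ioo 0 1, ENNReal.ofReal s * H (s * b) (s * (1 - b)) := by
  -- No planar Jacobian is needed: translate `y = s - x` for fixed `x`, swap by Tonelli, then scale
  -- `x = s b` for fixed `s`.
  set F : ℝ → ℝ → ENNReal := fun x s =>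
    {z : ℝ × ℝ | 0 < z.1 ∧ z.1 < z.2}.indicator (fun z => H z.1 (z.2 - z.1)) (x, s) with hF
  have hset : MeasurableSet {z : ℝ × ℝ | 0 < z.1 ∧ z.1 < z.2} :=
    (measurableSet_lt measurable_const measurable_fst).inter
      (measurableSet_lt measurable_fst measurable_snd)
  have hFm : Measurable (Function.uncurry F) := by
    refine Measurable.indicator ?_ hset
    exact hH.comp (measurable_fst.prodMk (measurable_snd.sub measurable_fst))
  have hF1 : ∀ {x s}, 0 < x → x < s → F x s = H x (s - x) := fun {x s} h h' =>
    Set.indicator_of_mem (s := {z : ℝ × ℝ | 0 < z.1 ∧ z.1 < z.2}) (a := (x, s)) ⟨h, h'⟩ _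
  have hF0 : ∀ {x s}, ¬ (0 < x ∧ x < s) → F x s = 0 := fun {x s} h =>
    Set.indicator_of_notMem (s := {z : ℝ × ℝ | 0 < z.1 ∧ z.1 < z.2}) (a := (x, s)) h _
  have h1 : ∀ x, (Set.Ioi 0).indicator (fun x => ∫⁻ y in Set.Ioi 0, H x y) x = ∫⁻ s, F x s := by
    intro x
    by_cases hx : 0 < x
    · rw [Set.indicator_of_mem (Set.mem_Ioi.2 hx), ← lintegral_indicator measurableSet_Ioi,
        ← lintegral_sub_right_eq_self _ x]
      refine lintegral_congr fun s => ?_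
      by_cases hs : x < s
      · rw [Set.indicator_of_mem (Set.mem_Ioi.2 (sub_pos.2 hs)), hF1 hx hs]
      · rw [Set.indicator_of_notMem (by simpa using hs), hF0 fun h => hs h.2]
    · rw [Set.indicator_of_notMem (by simpa using hx), lintegral_congr fun s => hF0 fun h => hx h.1]
      simp
  have h2 : ∀ s, ∫⁻ x, F x s = (Set.Ioi 0).indicator (fun s => ∫⁻ b in Set.Ioo 0 1,
      ENNReal.ofReal s * H (s * b) (s * (1 - b))) s := by
    intro s
    by_cases hs : 0 < s
    · have hFs : Measurable fun x => F x s := hFm.comp (measurable_id.prodMk measurable_const)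
      rw [Set.indicator_of_mem (Set.mem_Ioi.2 hs), lintegral_mul_left hs hFs,
        ← lintegral_indicator measurableSet_Ioo,
        ← lintegral_const_mul _
          (show Measurable fun b => F (s * b) s from hFs.comp (measurable_const_mul s))]
      refine lintegral_congr fun b => ?_
      by_cases hb : b ∈ Set.Ioo (0 : ℝ) 1
      · rw [Set.indicator_of_mem hb,
          hF1 (mul_pos hs hb.1) (mul_lt_of_lt_one_right hs hb.2), mul_sub, mul_one]
      · rw [Set.indicator_of_notMem hb, hF0, mul_zero]
        rintro ⟨h3, h4⟩
        exact hb ⟨pos_of_mul_pos_right h3 hs.le, by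
          by_contra h5
          exact absurd h4 (not_lt.2 (le_mul_of_one_le_right hs.le (not_lt.1 h5)))⟩
    · rw [Set.indicator_of_notMem (by simpa using hs),
        lintegral_congr fun x => hF0 fun h => hs (h.1.trans h.2)]
      simp
  rw [← lintegral_indicator measurableSet_Ioi, lintegral_congr h1,
    lintegral_lintegral_swap hFm.aemeasurable, lintegral_congr h2,
    lintegral_indicator measurableSet_Ioi]

/-- In the coordinates sum and fraction the joint density separates into a power of `s` times `exp
(-s)`, and `b ^ p (1 - b) ^ q`. -/
lemma lintegral_erlang_erlang (p q : ℕ) {f : ℝ → ℝ → ENNReal}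
    (hf : Measurable (Function.uncurry f)) :
    ∫⁻ x, ∫⁻ y, f x y ∂erlang q ∂erlang p = ∫⁻ s in Set.Ioi 0, ∫⁻ b in Set.Ioo 0 1,
      ENNReal.ofReal (s ^ (p + q + 1) * Real.exp (-s) * (b ^ p * (1 - b) ^ q) /
        (p.factorial * q.factorial)) * f (s * b) (s * (1 - b)) := by
  have hfx : ∀ x, Measurable (f x) := fun x => hf.comp (measurable_const.prodMk measurable_id)
  simp only [lintegral_erlang q (hfx _)]
  rw [lintegral_erlang p (Measurable.lintegral_prod_right' (f := fun z : ℝ × ℝ =>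
    ENNReal.ofReal (z.2 ^ q * Real.exp (-z.2) / q.factorial) * f z.1 z.2) (by
      exact (by fun_prop : Measurable fun z : ℝ × ℝ => ENNReal.ofReal
        (z.2 ^ q * Real.exp (-z.2) / q.factorial)).mul hf))]
  have h1 : ∀ x, ENNReal.ofReal (x ^ p * Real.exp (-x) / p.factorial) *
      ∫⁻ y in Set.Ioi 0, ENNReal.ofReal (y ^ q * Real.exp (-y) / q.factorial) * f x y =
      ∫⁻ y in Set.Ioi 0, ENNReal.ofReal (x ^ p * Real.exp (-x) / p.factorial) *
        (ENNReal.ofReal (y ^ q * Real.exp (-y) / q.factorial) * f x y) := fun x =>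
    (lintegral_const_mul _ ((measurable_erlang_density q).mul (hfx x))).symm
  simp only [h1]
  rw [lintegral_Ioi_Ioi (H := fun x y => ENNReal.ofReal (x ^ p * Real.exp (-x) / p.factorial) *
        (ENNReal.ofReal (y ^ q * Real.exp (-y) / q.factorial) * f x y)) (by
      exact (by fun_prop : Measurable fun z : ℝ × ℝ => ENNReal.ofReal
        (z.1 ^ p * Real.exp (-z.1) / p.factorial)).mul
        ((by fun_prop : Measurable fun z : ℝ × ℝ => ENNReal.ofReal
        (z.2 ^ q * Real.exp (-z.2) / q.factorial)).mul hf))]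
  refine setLIntegral_congr_fun measurableSet_Ioi fun s hs => ?_
  refine setLIntegral_congr_fun measurableSet_Ioo fun b hb => ?_
  have hs' : (0 : ℝ) < s := hs
  have hb0 : 0 < b := hb.1
  have hb1 : 0 < 1 - b := sub_pos.2 hb.2
  rw [← mul_assoc, ← mul_assoc, ← ENNReal.ofReal_mul hs'.le, ← ENNReal.ofReal_mul (by positivity)]
  congr 2
  have : Real.exp (-s) = Real.exp (-(s * b)) * Real.exp (-(s * (1 - b))) := by
    rw [← Real.exp_add]; congr 1; ring
  rw [this, mul_pow, mul_pow]
  field_simp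
  ring

lemma isProbabilityMeasure_erlang_zero : IsProbabilityMeasure (erlang 0) := by
  rw [← map_norm_sq_stdComplex]
  exact Measure.isProbabilityMeasure_map (by fun_prop)

/-- Product measures are formed before the total mass is known to be one. -/
instance (k : ℕ) : SFinite (erlang k) := by unfold erlang; infer_instance

/-- Integrating out the fraction contributes `∫ b ^ k = 1/(k + 1)`, which turns `k!` into `(k +
1)!`. It also yields the normalisation of all these laws by induction. -/
lemma map_add_erlang (k : ℕ) :
    ((erlang k).prod (erlang 0)).map (fun z => z.1 + z.2) = erlang (k + 1) := by
  ext A hA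
  have hm : Measurable fun z : ℝ × ℝ => z.1 + z.2 := by fun_prop
  have hf : Measurable (Function.uncurry fun x y : ℝ => A.indicator (1 : ℝ → ENNReal) (x + y)) :=
    (measurable_one.indicator hA).comp hm
  have h1 : ((erlang k).prod (erlang 0)) ((fun z => z.1 + z.2) ⁻¹' A) =
      ∫⁻ x, ∫⁻ y, A.indicator (1 : ℝ → ENNReal) (x + y) ∂erlang 0 ∂erlang k := by
    rw [← lintegral_indicator_one (hm hA), lintegral_prod _ (by
      exact (measurable_one.indicator (hm hA)).aemeasurable)]
    rfl
  have hbeta : ∫⁻ b in Set.Ioo (0 : ℝ) 1, ENNReal.ofReal (b ^ k) =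
      ENNReal.ofReal ((k + 1 : ℝ)⁻¹) := by
    rw [← ofReal_integral_eq_lintegral_ofReal]
    · rw [← integral_Ioc_eq_integral_Ioo, ← intervalIntegral.integral_of_le zero_le_one,
        integral_pow]
      simp
    · exact ((continuous_pow k).integrableOn_Icc).mono_set Set.Ioo_subset_Icc_self
    · filter_upwards [ae_restrict_mem measurableSet_Ioo] with b hb
      exact pow_nonneg hb.1.le _
  rw [Measure.map_apply hm hA, h1, lintegral_erlang_erlang k 0 hf, ← lintegral_indicator_one hA,
    lintegral_erlang _ (measurable_one.indicator hA)]
  refine setLIntegral_congr_fun measurableSet_Ioi fun s hs => ?_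
  have hs' : (0 : ℝ) < s := hs
  have h2 : ∀ b, s * b + s * (1 - b) = s := fun b => by ring
  simp only [h2]
  rw [lintegral_mul_const _ (by fun_prop)]
  congr 1
  have h3 : ∀ b : ℝ, ENNReal.ofReal (s ^ (k + 0 + 1) * Real.exp (-s) * (b ^ k * (1 - b) ^ 0) /
      (k.factorial * (0 : ℕ).factorial)) =
      ENNReal.ofReal (s ^ (k + 1) * Real.exp (-s) / k.factorial) * ENNReal.ofReal (b ^ k) := by
    intro b
    rw [← ENNReal.ofReal_mul (by positivity)]
    congr 1
    simp
    ring
  simp only [h3]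
  rw [lintegral_const_mul _ (by fun_prop), hbeta, ← ENNReal.ofReal_mul (by positivity),
    Nat.factorial_succ]
  congr 1
  push_cast
  field_simp

instance isProbabilityMeasure_erlang (k : ℕ) : IsProbabilityMeasure (erlang k) := by
  induction k with
  | zero => exact isProbabilityMeasure_erlang_zero
  | succ k ih =>
    have := isProbabilityMeasure_erlang_zero
    rw [← map_add_erlang]
    exact Measure.isProbabilityMeasure_map (by fun_prop)

lemma measure_div_add_erlang (p q : ℕ) {A : Set ℝ} (hA : MeasurableSet A) :
    ((erlang p).prod (erlang q)) {z | z.1 / (z.1 + z.2) ∈ A} = betaNat p q A := by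
  have hm : Measurable fun z : ℝ × ℝ => z.1 / (z.1 + z.2) := by fun_prop
  have hf : Measurable (Function.uncurry fun x y : ℝ =>
      A.indicator (1 : ℝ → ENNReal) (x / (x + y))) := (measurable_one.indicator hA).comp hm
  have h1 : ((erlang p).prod (erlang q)) {z | z.1 / (z.1 + z.2) ∈ A} =
      ∫⁻ x, ∫⁻ y, A.indicator (1 : ℝ → ENNReal) (x / (x + y)) ∂erlang q ∂erlang p := by
    rw [show {z : ℝ × ℝ | z.1 / (z.1 + z.2) ∈ A} = (fun z => z.1 / (z.1 + z.2)) ⁻¹' A from rfl,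
      ← lintegral_indicator_one (hm hA), lintegral_prod _ (by
      exact (measurable_one.indicator (hm hA)).aemeasurable)]
    rfl
  have hdens : Measurable fun b : ℝ => ENNReal.ofReal
      ((p + q + 1).factorial / (p.factorial * q.factorial) * (b ^ p * (1 - b) ^ q)) := by
    fun_prop
  -- The integral over the sum is the total mass of a gamma law, inserted as a factor one so that
  -- the two sides can be compared pointwise.
  have hone : ∫⁻ s in Set.Ioi 0,
      ENNReal.ofReal (s ^ (p + q + 1) * Real.exp (-s) / (p + q + 1).factorial) = 1 := by
    have := lintegral_erlang (p + q + 1) (f := fun _ => 1) measurable_const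
    simpa using this.symm
  rw [h1, lintegral_erlang_erlang p q hf, betaNat, withDensity_apply _ hA,
    ← lintegral_indicator hA, ← one_mul (∫⁻ b in Set.Ioo 0 1, _), ← hone,
    ← lintegral_mul_const _ (measurable_erlang_density _)]
  refine setLIntegral_congr_fun measurableSet_Ioi fun s hs => ?_
  have hs' : (0 : ℝ) < s := hs
  rw [← lintegral_const_mul _ (hdens.indicator hA)]
  refine setLIntegral_congr_fun measurableSet_Ioo fun b hb => ?_
  have h2 : s * b / (s * b + s * (1 - b)) = b := by
    rw [show s * b + s * (1 - b) = s by ring]; field_simp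
  rw [h2]
  by_cases hbA : b ∈ A
  · rw [Set.indicator_of_mem hbA, Set.indicator_of_mem hbA, Pi.one_apply, mul_one,
      ← ENNReal.ofReal_mul (by positivity)]
    congr 1
    field_simp
  · rw [Set.indicator_of_notMem hbA, Set.indicator_of_notMem hbA, mul_zero, mul_zero]

end Erlang

/-! ### Quadratic forms of projections -/

section Projections

set_option linter.unusedSectionVars false

variable {J : Type*} [Fintype J] [DecidableEq J]

lemma map_sum_norm_sq {S : Finset J} {k : ℕ} (hS : S.card = k + 1) :
    (stdVec J).map (fun x => ∑ j ∈ S, ‖x j‖ ^ 2) = erlang k := by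
  have hind : ProbabilityTheory.iIndepFun (fun (j : J) (x : J → ℂ) => ‖x j‖ ^ 2) (stdVec J) :=
    ProbabilityTheory.iIndepFun_pi (X := fun _ z => ‖z‖ ^ 2) (μ := fun _ : J => stdComplex)
      fun _ => by fun_prop
  have hm : ∀ j : J, Measurable fun x : J → ℂ => ‖x j‖ ^ 2 := fun j => by fun_prop
  have hsing : ∀ j : J, (stdVec J).map (fun x => ‖x j‖ ^ 2) = erlang 0 := by
    intro j
    rw [← map_norm_sq_stdComplex, ← (measurePreserving_eval (fun _ : J => stdComplex) j).map_eq,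
      Measure.map_map (by fun_prop) (by fun_prop)]
    rfl
  induction k generalizing S with
  | zero =>
    obtain ⟨j, rfl⟩ := Finset.card_eq_one.1 hS
    simpa using hsing j
  | succ k ih =>
    obtain ⟨j, S', hj, rfl, hS'⟩ := Finset.card_eq_succ.1 hS
    have h := hind.indepFun_finsetSum_of_notMem hm hj
    have hsum : (∑ i ∈ S', fun x : J → ℂ => ‖x i‖ ^ 2) = fun x => ∑ i ∈ S', ‖x i‖ ^ 2 := by
      funext x; simp
    rw [hsum, ProbabilityTheory.indepFun_iff_map_prod_eq_prod_map_map
      (Measurable.aemeasurable (by fun_prop)) (hm j).aemeasurable, ih hS', hsing] at h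
    rw [← map_add_erlang, ← h, Measure.map_map (by fun_prop) (by fun_prop)]
    congr 1
    funext x
    rw [Finset.sum_insert hj, add_comm]
    rfl

lemma dotProduct_unitary_diagonal (U : Matrix J J ℂ) (S : Finset J) (x y : J → ℂ) :
    star x ⬝ᵥ ((U * diagonal (fun j => if j ∈ S then 1 else 0) * Uᴴ) *ᵥ y) =
      ∑ j ∈ S, star ((Uᴴ *ᵥ x) j) * (Uᴴ *ᵥ y) j := by
  have h : star x ᵥ* U = star (Uᴴ *ᵥ x) := by rw [star_mulVec, conjTranspose_conjTranspose]
  rw [← mulVec_mulVec, ← mulVec_mulVec, dotProduct_mulVec, h]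
  simp [dotProduct, mulVec_diagonal, Finset.sum_ite_mem]

lemma re_sum_star_mul_self (S : Finset J) (v : J → ℂ) :
    ∑ j ∈ S, star (v j) * v j = ((∑ j ∈ S, ‖v j‖ ^ 2 : ℝ) : ℂ) := by
  push_cast
  refine Finset.sum_congr rfl fun j _ => ?_
  rw [mul_comm, Complex.star_def, Complex.mul_conj, Complex.normSq_eq_norm_sq]
  push_cast
  rfl

lemma sum_norm_sq_unitary {U : Matrix J J ℂ} (hU : U * Uᴴ = 1) (x : J → ℂ) :
    ∑ j, ‖(Uᴴ *ᵥ x) j‖ ^ 2 = ∑ j, ‖x j‖ ^ 2 := by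
  have h1 : star (Uᴴ *ᵥ x) ⬝ᵥ (Uᴴ *ᵥ x) = star x ⬝ᵥ x := by
    rw [star_mulVec, conjTranspose_conjTranspose, ← dotProduct_mulVec, mulVec_mulVec, hU,
      one_mulVec]
  have h2 := re_sum_star_mul_self Finset.univ (Uᴴ *ᵥ x)
  have h3 := re_sum_star_mul_self Finset.univ x
  rw [show (∑ j, star ((Uᴴ *ᵥ x) j) * (Uᴴ *ᵥ x) j) = star (Uᴴ *ᵥ x) ⬝ᵥ (Uᴴ *ᵥ x) from rfl, h1]
    at h2
  exact_mod_cast h2.symm.trans h3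

lemma indepFun_comp_finset {β β' : Type*} [MeasurableSpace β] [MeasurableSpace β']
    {S T : Finset J} (hST : Disjoint S T)
    {φ : (S → ℂ) → β} {ψ : (T → ℂ) → β'} (hφ : Measurable φ) (hψ : Measurable ψ) :
    ProbabilityTheory.IndepFun (fun x : J → ℂ => φ fun j => x j) (fun x => ψ fun j => x j)
      (stdVec J) := by
  have hind : ProbabilityTheory.iIndepFun (fun (j : J) (x : J → ℂ) => x j) (stdVec J) :=
    ProbabilityTheory.iIndepFun_pi (X := fun _ z => z) (μ := fun _ : J => stdComplex)
      fun _ => by fun_prop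
  exact (hind.indepFun_finset S T hST fun j => by fun_prop).comp hφ hψ

lemma map_sum_norm_sq_prod {S T : Finset J} (hST : Disjoint S T) {p q : ℕ}
    (hS : S.card = p + 1) (hT : T.card = q + 1) :
    (stdVec J).map (fun x => (∑ j ∈ S, ‖x j‖ ^ 2, ∑ j ∈ T, ‖x j‖ ^ 2)) =
      (erlang p).prod (erlang q) := by
  have h := indepFun_comp_finset hST (φ := fun y : S → ℂ => ∑ j, ‖y j‖ ^ 2)
    (ψ := fun y : T → ℂ => ∑ j, ‖y j‖ ^ 2) (by fun_prop) (by fun_prop)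
  have hc : ∀ (S : Finset J) (x : J → ℂ), ∑ j : S, ‖x j‖ ^ 2 = ∑ j ∈ S, ‖x j‖ ^ 2 :=
    fun S x => Finset.sum_coe_sort S fun j => ‖x j‖ ^ 2
  simp only [hc] at h
  rw [ProbabilityTheory.indepFun_iff_map_prod_eq_prod_map_map
      (Measurable.aemeasurable (by fun_prop)) (Measurable.aemeasurable (by fun_prop)),
    map_sum_norm_sq hS, map_sum_norm_sq hT] at h
  exact h

/-- In an eigenbasis of `Q` the quotient is a sum of squared moduli over the support of `Q`, divided
by itself plus the sum over the complement, and these two sums are independent gamma variables. -/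
lemma measure_quadratic_div {Q : Matrix J J ℂ} (hQ : Q.IsHermitian) (hQQ : Q * Q = Q) {p q : ℕ}
    (htr : Q.trace = p + 1) (hcard : Fintype.card J = p + 1 + (q + 1)) {A : Set ℝ}
    (hA : MeasurableSet A) :
    stdVec J {g | (star g ⬝ᵥ (Q *ᵥ g)).re / ∑ j, ‖g j‖ ^ 2 ∈ A} = betaNat p q A := by
  obtain ⟨U, hU, hU', S, T, -, hS, -, hQd, -⟩ := exists_unitary_diagonal hQ hQQ
    (P := 0) (by simp [Matrix.IsHermitian]) (by simp) (by simp) (by simp)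
  have hScard : S.card = p + 1 := by rw [htr] at hS; exact_mod_cast hS
  have hSc : Sᶜ.card = q + 1 := by rw [Finset.card_compl, hScard, hcard]; omega
  have hmp : MeasurePreserving (fun z => Uᴴ *ᵥ z) (stdVec J) (stdVec J) :=
    measurePreserving_mulVec (by rw [conjTranspose_conjTranspose, hU'])
  set E : Set (J → ℂ) := {g | (∑ j ∈ S, ‖g j‖ ^ 2) /
    ((∑ j ∈ S, ‖g j‖ ^ 2) + ∑ j ∈ Sᶜ, ‖g j‖ ^ 2) ∈ A} with hE
  have hset : {g : J → ℂ | (star g ⬝ᵥ (Q *ᵥ g)).re / ∑ j, ‖g j‖ ^ 2 ∈ A} =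
      (fun z => Uᴴ *ᵥ z) ⁻¹' E := by
    ext g
    simp only [Set.mem_ofPred_eq, Set.mem_preimage, hE]
    rw [hQd, dotProduct_unitary_diagonal, re_sum_star_mul_self, Complex.ofReal_re,
      ← sum_norm_sq_unitary hU g, Finset.sum_add_sum_compl]
  have hmeas : MeasurableSet {z : ℝ × ℝ | z.1 / (z.1 + z.2) ∈ A} := by
    exact (by fun_prop : Measurable fun z : ℝ × ℝ => z.1 / (z.1 + z.2)) hA
  have hm2 : Measurable fun x : J → ℂ => (∑ j ∈ S, ‖x j‖ ^ 2, ∑ j ∈ Sᶜ, ‖x j‖ ^ 2) := by fun_prop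
  have hEm : MeasurableSet E := hm2 hmeas
  rw [hset, hmp.measure_preimage hEm.nullMeasurableSet, ← measure_div_add_erlang p q hA,
    ← map_sum_norm_sq_prod disjoint_compl_right hScard hSc, Measure.map_apply hm2 hmeas]
  rfl

/-- The quadratic form of a unitarily invariant random projection at a unit vector is
beta distributed. -/
lemma measure_quadratic_of_invariant {Ω : Type*} [MeasurableSpace Ω] (P : Measure Ω)
    [IsProbabilityMeasure P] {Q : Ω → Matrix J J ℂ} (hQm : ∀ i j, Measurable fun ω => Q ω i j)
    {p q : ℕ} (hQ : ∀ᵐ ω ∂P, (Q ω).IsHermitian ∧ Q ω * Q ω = Q ω ∧ (Q ω).trace = p + 1)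
    (hcard : Fintype.card J = p + 1 + (q + 1))
    (hinv : ∀ U : Matrix J J ℂ, U * Uᴴ = 1 → Uᴴ * U = 1 → ∀ e : J → ℂ, ∀ A : Set ℝ,
      MeasurableSet A → P {ω | (star e ⬝ᵥ (Q ω *ᵥ e)).re ∈ A} =
        P {ω | (star (U *ᵥ e) ⬝ᵥ (Q ω *ᵥ (U *ᵥ e))).re ∈ A})
    {e : J → ℂ} (he : star e ⬝ᵥ e = 1) {A : Set ℝ} (hA : MeasurableSet A) :
    P {ω | (star e ⬝ᵥ (Q ω *ᵥ e)).re ∈ A} = betaNat p q A := by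
  have : Nonempty J := Fintype.card_pos_iff.1 (by omega)
  have hm : Measurable fun z : (J → ℂ) × Ω =>
      (star z.1 ⬝ᵥ (Q z.2 *ᵥ z.1)).re / ∑ j, ‖z.1 j‖ ^ 2 := by
    refine Measurable.div (Complex.measurable_re.comp ?_) (by fun_prop)
    simp only [dotProduct, mulVec, Pi.star_apply]
    refine Finset.measurable_sum _ fun i _ => Measurable.mul ?_
      (Finset.measurable_sum _ fun j _ => Measurable.mul ?_ (by fun_prop))
    · exact continuous_star.measurable.comp (by fun_prop)
    · exact (hQm i j).comp measurable_snd
  -- The vector `e` is randomised by an independent Gaussian `g`. The two ways of slicing this event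
  -- give the two sides of the claim.
  set E : Set ((J → ℂ) × Ω) :=
    {z | (star z.1 ⬝ᵥ (Q z.2 *ᵥ z.1)).re / ∑ j, ‖z.1 j‖ ^ 2 ∈ A} with hE
  have hEm : MeasurableSet E := hm hA
  have hne : ∀ᵐ g ∂(stdVec J), g ≠ 0 := by
    have : stdVec J {0} = 0 := stdVec_absolutelyContinuous (measure_singleton _)
    exact measure_eq_zero_iff_ae_notMem.1 this
  -- For fixed `g`, a unitary taking `e` to `g/|g|` and invariance show that the slice has the
  -- measure wanted for `e`.
  have h1 : ∀ᵐ g ∂(stdVec J), P (Prod.mk g ⁻¹' E) = P {ω | (star e ⬝ᵥ (Q ω *ᵥ e)).re ∈ A} := by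
    filter_upwards [hne] with g hg
    set n : ℝ := ∑ j, ‖g j‖ ^ 2 with hn
    have hgn : star g ⬝ᵥ g = (n : ℂ) := re_sum_star_mul_self Finset.univ g
    have hn0 : 0 < n := by
      have h : (0 : ℂ) < star g ⬝ᵥ g := dotProduct_star_self_pos_iff.2 hg
      rw [hgn] at h
      exact_mod_cast h
    set s := Real.sqrt n with hs
    have hs0 : 0 < s := Real.sqrt_pos.2 hn0
    have hss : s ^ 2 = n := Real.sq_sqrt hn0.le
    have hsc : (s : ℂ) ≠ 0 := by exact_mod_cast hs0.ne'
    have hform : ∀ v : J → ℂ, star ((s : ℂ)⁻¹ • g) ⬝ᵥ v = (s : ℂ)⁻¹ * (star g ⬝ᵥ v) := by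
      intro v
      rw [star_smul, smul_dotProduct, star_inv₀, Complex.star_def, Complex.conj_ofReal,
        smul_eq_mul]
    obtain ⟨U, hU, hU', hUe⟩ := exists_unitary_mulVec_eq he (f := (s : ℂ)⁻¹ • g) (by
      rw [hform, dotProduct_smul, hgn, ← hss, smul_eq_mul]
      push_cast
      field_simp)
    rw [hinv U hU hU' e A hA, hUe]
    congr 1
    ext ω
    simp only [hE, Set.mem_preimage, Set.mem_ofPred_eq]
    rw [hform, mulVec_smul, dotProduct_smul, smul_eq_mul, ← mul_assoc, ← Complex.ofReal_inv,
      ← Complex.ofReal_mul, Complex.re_ofReal_mul, ← hn, ← hss]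
    have : (star g ⬝ᵥ Q ω *ᵥ g).re / s ^ 2 = s⁻¹ * s⁻¹ * (star g ⬝ᵥ Q ω *ᵥ g).re := by
      field_simp
    rw [this]
  have h2 : ∀ᵐ ω ∂P, stdVec J ((fun g => (g, ω)) ⁻¹' E) = betaNat p q A := by
    filter_upwards [hQ] with ω hω
    exact measure_quadratic_div hω.1 hω.2.1 hω.2.2 hcard hA
  have h3 := Measure.prod_apply (μ := stdVec J) (ν := P) hEm
  have h4 := Measure.prod_apply_symm (μ := stdVec J) (ν := P) hEm
  rw [lintegral_congr_ae h1, lintegral_const, measure_univ, mul_one] at h3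
  rw [lintegral_congr_ae h2, lintegral_const, measure_univ, mul_one] at h4
  rw [← h3, h4]

lemma isHermitian_smul_vecMulVec (r : ℝ) (v : J → ℂ) :
    ((r : ℂ) • vecMulVec v (star v)).IsHermitian := by
  rw [Matrix.IsHermitian, conjTranspose_smul, conjTranspose_vecMulVec, star_star,
    Complex.star_def, Complex.conj_ofReal]

/-- For a fixed projection, the ratio statistic of a shifted Gaussian row reduces to one noncentral
coordinate and an independent gamma variable. -/
lemma exists_measure_ratio_eq {Q : Matrix J J ℂ} (hQ : Q.IsHermitian) (hQQ : Q * Q = Q) {k : ℕ}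
    (htr : Q.trace = k + 2) {e : J → ℂ} {b : ℝ} (hb : 0 < b)
    (hbe : star e ⬝ᵥ (Q *ᵥ e) = b) (m : ℂ) :
    ∃ μ : ℂ, ‖μ‖ ^ 2 = ‖m‖ ^ 2 * b ∧ ∀ A : Set ℝ, MeasurableSet A →
      stdVec J {x | ‖(x + m • star e) ⬝ᵥ (Q *ᵥ e)‖ ^ 2 /
        (b * ((x + m • star e) ⬝ᵥ (Q *ᵥ star (x + m • star e))).re -
          ‖(x + m • star e) ⬝ᵥ (Q *ᵥ e)‖ ^ 2) ∈ A} =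
      (stdComplex.prod (erlang k)) {z | ‖z.1 + μ‖ ^ 2 / z.2 ∈ A} := by
  have hbc : (b : ℂ) ≠ 0 := by exact_mod_cast hb.ne'
  set u := Q *ᵥ e with hu
  have hQu : Q *ᵥ u = u := by rw [hu, mulVec_mulVec, hQQ]
  have huQ : star u ᵥ* Q = star u := by
    have := congrArg star hQu
    rwa [star_mulVec, hQ.eq] at this
  have hue : star u ⬝ᵥ e = b := by
    rw [← hbe, hu, star_mulVec, hQ.eq, ← dotProduct_mulVec]
  have huu : star u ⬝ᵥ u = b := by
    conv_lhs => rw [hu, dotProduct_mulVec, ← hu, huQ, hue]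
  -- The projection onto the line through `u = Qe`, whose squared length is `b`. It lies below `Q`,
  -- so both are diagonal in one unitary basis and `P` occupies a single coordinate.
  set P : Matrix J J ℂ := ((b⁻¹ : ℝ) : ℂ) • vecMulVec u (star u) with hP
  have hPP : P * P = P := by
    rw [hP, Matrix.smul_mul, Matrix.mul_smul, vecMulVec_mul_vecMulVec, huu, vecMulVec_smul,
      smul_smul, smul_smul]
    congr 1
    push_cast
    field_simp
  have hQP : Q * P = P := by rw [hP, Matrix.mul_smul, Matrix.mul_vecMulVec, hQu]
  have hPQ : P * Q = P := by rw [hP, Matrix.smul_mul, Matrix.vecMulVec_mul, huQ]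
  have hPtr : P.trace = 1 := by
    rw [hP, trace_smul, trace_vecMulVec, dotProduct_comm, huu, smul_eq_mul]
    push_cast
    field_simp
  have hPe : P *ᵥ e = Q *ᵥ e := by
    rw [hP, smul_mulVec, vecMulVec_mulVec, hue, op_smul_eq_smul, smul_smul, ← hu]
    push_cast
    rw [inv_mul_cancel₀ hbc, one_smul]
  obtain ⟨U, hU, hU', S, T, hTS, hS, hT, hQd, hPd⟩ := exists_unitary_diagonal hQ hQQ
    (isHermitian_smul_vecMulVec b⁻¹ u) hPP hQP hPQ
  rw [← hP] at hT hPd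
  have hScard : S.card = k + 2 := by rw [htr] at hS; exact_mod_cast hS
  have hTcard : T.card = 1 := by rw [hPtr] at hT; exact_mod_cast hT
  obtain ⟨j₀, rfl⟩ := Finset.card_eq_one.1 hTcard
  have hj₀ : j₀ ∈ S := hTS (Finset.mem_singleton_self _)
  set f := Uᴴ *ᵥ e with hf
  -- Since `Pe = Qe`, inside the support of `Q` the vector `e` has only its `j₀` coordinate. Hence
  -- the shift moves only that coordinate.
  have hfs : ∀ j ∈ S, j ≠ j₀ → f j = 0 := by
    intro j hj hjj
    have h1 : Uᴴ *ᵥ (P *ᵥ e) = Uᴴ *ᵥ (Q *ᵥ e) := by rw [hPe]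
    rw [hPd, hQd] at h1
    simp only [← mulVec_mulVec] at h1
    rw [mulVec_mulVec _ Uᴴ U, mulVec_mulVec _ Uᴴ U, hU', one_mulVec, one_mulVec] at h1
    have h2 := congrFun h1 j
    simpa [mulVec_diagonal, hj, hjj] using h2.symm
  have hfb : ‖f j₀‖ ^ 2 = b := by
    have h1 := dotProduct_unitary_diagonal U S e e
    rw [← hQd, ← hu, hbe, re_sum_star_mul_self, ← hf] at h1
    have h2 : b = ∑ j ∈ S, ‖f j‖ ^ 2 := by exact_mod_cast h1
    rw [h2, Finset.sum_eq_single_of_mem j₀ hj₀ fun j hj hjj => by rw [hfs j hj hjj]; simp]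
  refine ⟨m * star (f j₀), by rw [norm_mul, norm_star, mul_pow, hfb], fun A hA => ?_⟩
  -- Rows are paired without conjugation, so the Gaussian row is rotated by the transpose of `U`.
  have hUT : ∀ x : J → ℂ, Uᴴ *ᵥ star x = star (Uᵀ *ᵥ x) := by
    intro x
    funext j
    simp [mulVec, dotProduct, conjTranspose_apply]
  have hmp : MeasurePreserving (fun z => Uᵀ *ᵥ z) (stdVec J) (stdVec J) := by
    refine measurePreserving_mulVec ?_
    have := congrArg transpose hU'
    rw [transpose_mul, transpose_one] at this
    exact this
  set S' := S.erase j₀ with hS'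
  have hS'card : S'.card = k + 1 := by rw [hS', Finset.card_erase_of_mem hj₀, hScard]; rfl
  set F : ℂ × ℝ → ℝ := fun z => ‖z.1 + m * star (f j₀)‖ ^ 2 / z.2 with hF
  set G : (J → ℂ) → ℂ × ℝ := fun z => (z j₀, ∑ j ∈ S', ‖z j‖ ^ 2) with hG
  have hFm : Measurable F := by fun_prop
  have hGm : Measurable G := by fun_prop
  have hGmap : (stdVec J).map G = stdComplex.prod (erlang k) := by
    have h := indepFun_comp_finset (S := {j₀}) (T := S') (by simp [hS'])
      (φ := fun y => y ⟨j₀, Finset.mem_singleton_self _⟩)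
      (ψ := fun y : S' → ℂ => ∑ j, ‖y j‖ ^ 2) (by fun_prop) (by fun_prop)
    have hc : ∀ x : J → ℂ, ∑ j : S', ‖x j‖ ^ 2 = ∑ j ∈ S', ‖x j‖ ^ 2 :=
      fun x => Finset.sum_coe_sort S' fun j => ‖x j‖ ^ 2
    simp only [hc] at h
    rw [ProbabilityTheory.indepFun_iff_map_prod_eq_prod_map_map
      (Measurable.aemeasurable (by fun_prop)) (Measurable.aemeasurable (by fun_prop)),
      map_sum_norm_sq hS'card,
      (measurePreserving_eval (fun _ : J => stdComplex) j₀).map_eq] at h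
    exact h
  have hstat : ∀ x : J → ℂ, ‖(x + m • star e) ⬝ᵥ u‖ ^ 2 /
      (b * ((x + m • star e) ⬝ᵥ (Q *ᵥ star (x + m • star e))).re -
        ‖(x + m • star e) ⬝ᵥ u‖ ^ 2) = F (G (Uᵀ *ᵥ x)) := by
    intro x
    set y := x + m • star e with hy
    have hUy : Uᴴ *ᵥ star y = star (Uᵀ *ᵥ x + m • star f) := by
      rw [hy, star_add, star_smul, star_star, mulVec_add, hUT, mulVec_smul, star_add, star_smul,
        star_star]
    set w := Uᵀ *ᵥ x + m • star f with hw
    have hw0 : w j₀ = (Uᵀ *ᵥ x) j₀ + m * star (f j₀) := rfl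
    have hwj : ∀ j ∈ S', w j = (Uᵀ *ᵥ x) j := by
      intro j hj
      rw [hw, Pi.add_apply, Pi.smul_apply, Pi.star_apply,
        hfs j (Finset.mem_of_mem_erase hj) (Finset.ne_of_mem_erase hj), star_zero, smul_zero,
        add_zero]
    have h1 : y ⬝ᵥ u = w j₀ * f j₀ := by
      have := dotProduct_unitary_diagonal U S (star y) e
      rw [← hQd, star_star, hUy, ← hu, ← hf] at this
      rw [this, Finset.sum_eq_single_of_mem j₀ hj₀ fun j hj hjj => by rw [hfs j hj hjj, mul_zero],
        Pi.star_apply, star_star]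
    have h2 : (y ⬝ᵥ (Q *ᵥ star y)).re = ‖w j₀‖ ^ 2 + ∑ j ∈ S', ‖(Uᵀ *ᵥ x) j‖ ^ 2 := by
      have := dotProduct_unitary_diagonal U S (star y) (star y)
      rw [← hQd, re_sum_star_mul_self, star_star, hUy] at this
      rw [this, Complex.ofReal_re, ← Finset.add_sum_erase _ _ hj₀, Pi.star_apply, norm_star]
      congr 1
      refine Finset.sum_congr rfl fun j hj => ?_
      rw [Pi.star_apply, norm_star, hwj j hj]
    rw [h1, h2, norm_mul, mul_pow, hfb, hF, hG]
    dsimp only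
    rw [← hw0]
    -- The `j₀` term cancels in the denominator, leaving the `k + 1` remaining coordinates; the
    -- common factor `b` drops out.
    rw [show b * (‖w j₀‖ ^ 2 + ∑ j ∈ S', ‖(Uᵀ *ᵥ x) j‖ ^ 2) - ‖w j₀‖ ^ 2 * b =
      b * ∑ j ∈ S', ‖(Uᵀ *ᵥ x) j‖ ^ 2 by ring, mul_comm (‖w j₀‖ ^ 2) b,
      mul_div_mul_left _ _ hb.ne']
  simp only [hstat]
  rw [← hGmap, show {z : ℂ × ℝ | ‖z.1 + m * star (f j₀)‖ ^ 2 / z.2 ∈ A} = F ⁻¹' A from rfl,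
    Measure.map_apply hGm (hFm hA)]
  exact hmp.measure_preimage (hGm (hFm hA)).nullMeasurableSet

end Projections

/-! ### The conditional distribution function -/

section CondCdf

open Finset in
-- Induction on `d`. After clearing `(1 + γ) ^ d`, Pascal's rule and the increment of the truncated
-- exponential give a recursion whose inhomogeneous term is the new inner sum.
lemma sum_choose_eq_sum_choose_succ (d : ℕ) {γ : ℝ} (hγ : 0 ≤ γ) (h : ℝ) :
    ∑ j ∈ range d, γ / (1 + γ) ^ (j + 1) *
      ∑ i ∈ range (j + 1), (j.choose i : ℝ) * ((γ * h) ^ i / i.factorial) =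
    ∑ i ∈ range d, (d.choose (1 + i) : ℝ) * (γ ^ (1 + i) / (1 + γ) ^ d) *
      ∑ j ∈ range (i + 1), h ^ j / j.factorial := by
  set E : ℕ → ℝ := fun i => ∑ j ∈ range (i + 1), h ^ j / j.factorial with hE
  have h1γ : (1 + γ) ≠ 0 := by positivity
  set r : ℕ → ℝ := fun d => ∑ i ∈ range d, (d.choose (i + 1) : ℝ) * γ ^ (i + 1) * E i with hr
  have hr' : ∀ d : ℕ, ∑ i ∈ range d, (d.choose (1 + i) : ℝ) * (γ ^ (1 + i) / (1 + γ) ^ d) * E i =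
      r d / (1 + γ) ^ d := by
    intro d
    rw [hr, sum_div]
    refine sum_congr rfl fun i _ => ?_
    rw [add_comm 1 i]
    ring
  have hrec : ∀ d : ℕ, r (d + 1) = (1 + γ) * r d +
      γ * ∑ i ∈ range (d + 1), (d.choose i : ℝ) * ((γ * h) ^ i / i.factorial) := by
    intro d
    have h1 : r (d + 1) = ∑ i ∈ range (d + 1), (d.choose i : ℝ) * γ ^ (i + 1) * E i +
        ∑ i ∈ range (d + 1), (d.choose (i + 1) : ℝ) * γ ^ (i + 1) * E i := by
      rw [hr, ← sum_add_distrib]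
      refine sum_congr rfl fun i _ => ?_
      rw [Nat.choose_succ_succ]
      push_cast
      ring
    have h2 : ∑ i ∈ range (d + 1), (d.choose (i + 1) : ℝ) * γ ^ (i + 1) * E i = r d := by
      rw [sum_range_succ, Nat.choose_succ_self]
      simp [hr]
    have hEs : ∀ i, E (i + 1) = E i + h ^ (i + 1) / (i + 1).factorial := fun i =>
      sum_range_succ _ _
    have h3 : ∑ i ∈ range (d + 1), (d.choose i : ℝ) * γ ^ (i + 1) * E i =
        γ * r d + γ * ∑ i ∈ range (d + 1), (d.choose i : ℝ) * ((γ * h) ^ i / i.factorial) := by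
      rw [sum_range_succ', sum_range_succ' (fun i => (d.choose i : ℝ) * _), mul_add, ← add_assoc,
        hr, mul_sum, mul_sum, mul_sum, ← sum_add_distrib]
      congr 1
      · refine sum_congr rfl fun i _ => ?_
        rw [hEs]
        ring
      · simp
    rw [h1, h2, h3]
    ring
  rw [hr']
  induction d with
  | zero => simp [hr]
  | succ d ih =>
    rw [sum_range_succ, ih, hrec]
    field_simp
    ring

/-- This arrangement, one term per order of the gamma tail, is the form produced by the Gaussian
integration. -/
lemma condCdf_eq_sum (d : ℕ) {γ : ℝ} (hγ : 0 ≤ γ) (α b : ℝ) :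
    condCdf d α b γ = Real.exp (-(α * b / (1 + γ))) * ∑ j ∈ Finset.range d, γ / (1 + γ) ^ (j + 1) *
      ∑ i ∈ Finset.range (j + 1),
        (j.choose i : ℝ) * ((γ * (α * b / (1 + γ))) ^ i / i.factorial) := by
  rw [sum_choose_eq_sum_choose_succ d hγ, Finset.mul_sum]
  refine Finset.sum_congr rfl fun i _ => ?_
  unfold incGamma
  simp only [Real.Gamma_nat_eq_factorial]
  ring

/-- `exp (-t) ∑_{j ≤ k} t ^ j / j!`. -/
noncomputable def erlangTail (k : ℕ) (t : ℝ) : ℝ :=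
  Real.exp (-t) * ∑ j ∈ Finset.range (k + 1), t ^ j / j.factorial

/-- The derivatives of consecutive terms telescope, leaving the gamma density. -/
lemma hasDerivAt_erlangTail (k : ℕ) (t : ℝ) :
    HasDerivAt (fun t => -erlangTail k t) (t ^ k * Real.exp (-t) / k.factorial) t := by
  induction k with
  | zero =>
    have h : HasDerivAt (fun t : ℝ => -Real.exp (-t)) (Real.exp (-t)) t := by
      have := (HasDerivAt.exp (hasDerivAt_neg t)).neg
      rw [mul_neg_one, neg_neg] at this
      exact this
    simpa [erlangTail] using h
  | succ k ih =>
    have h1 : HasDerivAt (fun t : ℝ => Real.exp (-t) * (t ^ (k + 1) / (k + 1).factorial))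
        (-Real.exp (-t) * (t ^ (k + 1) / (k + 1).factorial) +
          Real.exp (-t) * (((k + 1 : ℕ) : ℝ) * t ^ k / (k + 1).factorial)) t := by
      have h2 : HasDerivAt (fun t : ℝ => Real.exp (-t)) (-Real.exp (-t)) t := by
        simpa using (hasDerivAt_neg t).exp
      exact h2.mul ((hasDerivAt_pow (k + 1) t).div_const _)
    have h3 : (fun t => -erlangTail (k + 1) t) = fun t =>
        -erlangTail k t - Real.exp (-t) * (t ^ (k + 1) / (k + 1).factorial) := by
      funext t
      unfold erlangTail
      rw [Finset.sum_range_succ _ (k + 1)]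
      ring
    rw [h3]
    refine (ih.sub h1).congr_deriv ?_
    rw [Nat.factorial_succ]
    push_cast
    field_simp
    ring

lemma tendsto_erlangTail (k : ℕ) :
    Filter.Tendsto (fun t => -erlangTail k t) Filter.atTop (nhds 0) := by
  have h : Filter.Tendsto (fun t => ∑ j ∈ Finset.range (k + 1),
      (t ^ j * Real.exp (-t)) / j.factorial) Filter.atTop
      (nhds (∑ j ∈ Finset.range (k + 1), (0 : ℝ) / j.factorial)) :=
    tendsto_finsetSum _ fun j _ =>
      (Real.tendsto_pow_mul_exp_neg_atTop_nhds_zero j).div_const _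
  have h2 := h.neg
  simp only [zero_div, Finset.sum_const_zero, neg_zero] at h2
  refine h2.congr fun t => ?_
  unfold erlangTail
  rw [Finset.mul_sum]
  congr 1
  refine Finset.sum_congr rfl fun j _ => ?_
  ring

lemma erlang_Ici (k : ℕ) {t : ℝ} (ht : 0 ≤ t) :
    erlang k (Set.Ici t) = ENNReal.ofReal (erlangTail k t) := by
  have hnn : ∀ x ∈ Set.Ioi t, 0 ≤ x ^ k * Real.exp (-x) / k.factorial := fun x hx => by
    have : (0 : ℝ) < x := lt_of_le_of_lt ht hx
    positivity
  have hint : IntegrableOn (fun x : ℝ => x ^ k * Real.exp (-x) / k.factorial) (Set.Ioi t) :=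
    integrableOn_Ioi_deriv_of_nonneg' (fun x _ => hasDerivAt_erlangTail k x) hnn
      (tendsto_erlangTail k)
  have hval := integral_Ioi_of_hasDerivAt_of_nonneg' (a := t)
    (fun x _ => hasDerivAt_erlangTail k x) hnn (tendsto_erlangTail k)
  rw [sub_neg_eq_add, zero_add] at hval
  rw [← hval, ofReal_integral_eq_lintegral_ofReal hint
    ((ae_restrict_iff' measurableSet_Ioi).2 (Filter.Eventually.of_forall hnn)), erlang,
    withDensity_apply _ measurableSet_Ici, Measure.restrict_restrict measurableSet_Ici]
  refine setLIntegral_congr ?_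
  by_cases h0 : t = 0
  · rw [h0, Set.inter_eq_right.2 Set.Ioi_subset_Ici_self]
    exact Filter.EventuallyEq.rfl
  · have h1 : Set.Ici t ∩ Set.Ioi 0 = Set.Ici t := Set.inter_eq_left.2 fun x hx =>
      Set.mem_Ioi.2 (lt_of_lt_of_le (lt_of_le_of_ne ht (Ne.symm h0)) (Set.mem_Ici.1 hx))
    rw [h1]
    exact Ioi_ae_eq_Ici.symm

lemma erlang_Iic_zero (k : ℕ) : erlang k (Set.Iic 0) = 0 := by
  rw [erlang, withDensity_apply _ measurableSet_Iic, Measure.restrict_restrict measurableSet_Iic,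
    Set.Iic_inter_Ioi, Set.Ioc_self, Measure.restrict_empty, lintegral_zero_measure]

/-- The weight `x ^ a exp (-x)` is `a!` times a gamma density of total mass one. -/
lemma lintegral_norm_sq_pow (a : ℕ) :
    ∫⁻ z, ENNReal.ofReal ((‖z‖ ^ 2) ^ a) ∂stdComplex = ENNReal.ofReal a.factorial := by
  have h1 : ∫⁻ x, ENNReal.ofReal (x ^ a) ∂erlang 0 =
      ∫⁻ z, ENNReal.ofReal ((‖z‖ ^ 2) ^ a) ∂stdComplex := by
    rw [← map_norm_sq_stdComplex, lintegral_map (by fun_prop) (by fun_prop)]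
  have h2 := lintegral_erlang a (f := fun _ => 1) measurable_const
  simp only [lintegral_const, measure_univ, mul_one] at h2
  rw [← h1, lintegral_erlang 0 (by fun_prop), ← mul_one (ENNReal.ofReal (a.factorial : ℝ)), h2,
    ← lintegral_const_mul _ (measurable_erlang_density a)]
  refine setLIntegral_congr_fun measurableSet_Ioi fun x hx => ?_
  have hx' : (0 : ℝ) < x := hx
  rw [← ENNReal.ofReal_mul (by positivity), ← ENNReal.ofReal_mul (by positivity)]
  congr 1
  simp
  field_simp

lemma integrable_norm_sq_pow (a : ℕ) : Integrable (fun z : ℂ => (‖z‖ ^ 2) ^ a) stdComplex := by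
  rw [← lintegral_ofReal_ne_top_iff_integrable (by fun_prop)
    (Filter.Eventually.of_forall fun z => by positivity), lintegral_norm_sq_pow]
  exact ENNReal.ofReal_ne_top

lemma integral_norm_sq_pow (a : ℕ) : ∫ z, (‖z‖ ^ 2) ^ a ∂stdComplex = a.factorial := by
  rw [integral_eq_lintegral_of_nonneg_ae (Filter.Eventually.of_forall fun z => by positivity)
    (by fun_prop), lintegral_norm_sq_pow, ENNReal.toReal_ofReal (by positivity)]

lemma integrable_pow_mul_star_pow (a b : ℕ) :
    Integrable (fun z : ℂ => z ^ a * star z ^ b) stdComplex := by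
  refine ((integrable_norm_sq_pow a).add (integrable_norm_sq_pow b)).mono'
    (by fun_prop) (Filter.Eventually.of_forall fun z => ?_)
  simp only [norm_mul, norm_pow, norm_star, Pi.add_apply]
  rw [← pow_mul, ← pow_mul, mul_comm 2 a, mul_comm 2 b, pow_mul, pow_mul]
  nlinarith [sq_nonneg (‖z‖ ^ a - ‖z‖ ^ b), sq_nonneg (‖z‖ ^ a), sq_nonneg (‖z‖ ^ b)]

/-- Rotation invariance in the plane is unitary invariance for a one-element index type. -/
lemma integral_comp_mul_left_stdComplex {c : ℂ} (hc : c * star c = 1) {f : ℂ → ℂ}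
    (hf : Continuous f) : ∫ z, f (c * z) ∂stdComplex = ∫ z, f z ∂stdComplex := by
  have h1 := measurePreserving_eval (fun _ : Unit => stdComplex) ()
  have h2 : MeasurePreserving (fun z => (c • (1 : Matrix Unit Unit ℂ)) *ᵥ z) (stdVec Unit)
      (stdVec Unit) := measurePreserving_mulVec (by
    rw [conjTranspose_smul, conjTranspose_one, Matrix.smul_mul, Matrix.one_mul, smul_smul, hc,
      one_smul])
  have hcomp : ∀ g : ℂ → ℂ, Continuous g →
      ∫ z, g z ∂stdComplex = ∫ x, g (x ()) ∂(stdVec Unit) := by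
    intro g hg
    rw [← h1.map_eq, integral_map h1.measurable.aemeasurable hg.aestronglyMeasurable]
  rw [hcomp (fun z => f (c * z)) (by fun_prop), hcomp f hf]
  conv_rhs => rw [← h2.map_eq]
  rw [integral_map (f := fun x : Unit → ℂ => f (x ())) h2.measurable.aemeasurable
    (hf.comp (continuous_apply ())).aestronglyMeasurable]
  simp [smul_mulVec]

lemma integral_pow_mul_star_pow (a b : ℕ) :
    ∫ z, z ^ a * star z ^ b ∂stdComplex = if a = b then (a.factorial : ℂ) else 0 := by
  split_ifs with hab
  · subst hab
    have h : ∀ z : ℂ, z ^ a * star z ^ a = (((‖z‖ ^ 2) ^ a : ℝ) : ℂ) := by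
      intro z
      rw [← mul_pow, Complex.star_def, Complex.mul_conj, Complex.normSq_eq_norm_sq]
      push_cast
      rfl
    simp only [h]
    rw [integral_complex_ofReal, integral_norm_sq_pow]
    push_cast
    rfl
  · have hd : ((a : ℂ) - b) ≠ 0 := by
      rw [sub_ne_zero]
      exact_mod_cast hab
    -- Rotation by the angle `π/(a - b)` multiplies the integrand by `-1`, so the integral equals
    -- its own negative.
    set c : ℂ := Complex.exp (((Real.pi / ((a : ℝ) - b) : ℝ) : ℂ) * Complex.I) with hc
    have hcs : star c = Complex.exp (-(((Real.pi / ((a : ℝ) - b) : ℝ) : ℂ) * Complex.I)) := by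
      rw [hc, Complex.star_def, ← Complex.exp_conj, map_mul, Complex.conj_ofReal, Complex.conj_I,
        mul_neg]
    have hcc : c * star c = 1 := by rw [hcs, hc, ← Complex.exp_add, add_neg_cancel, Complex.exp_zero]
    have hcab : c ^ a * star c ^ b = -1 := by
      rw [hcs, hc, ← Complex.exp_nat_mul, ← Complex.exp_nat_mul, ← Complex.exp_add,
        ← Complex.exp_pi_mul_I]
      congr 1
      push_cast
      field_simp
      ring
    have h := integral_comp_mul_left_stdComplex hcc (f := fun z => z ^ a * star z ^ b)
      (by fun_prop)
    have h2 : ∀ z : ℂ, (c * z) ^ a * star (c * z) ^ b = (-1) * (z ^ a * star z ^ b) := by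
      intro z
      rw [← hcab, star_mul', mul_pow, mul_pow]
      ring
    simp only [h2] at h
    rw [integral_const_mul] at h
    linear_combination (-1 / 2 : ℂ) * h

/-- Expanding `(ν + z) ^ k` and its conjugate, orthogonality of the mixed moments leaves only the
diagonal terms. -/
lemma integral_norm_add_sq_pow (ν : ℂ) (k : ℕ) :
    ∫ z, (‖z + ν‖ ^ 2) ^ k ∂stdComplex =
      k.factorial * ∑ i ∈ Finset.range (k + 1),
        (k.choose i : ℝ) * ((‖ν‖ ^ 2) ^ i / i.factorial) := by
  have hexp : ∀ z : ℂ, (((‖z + ν‖ ^ 2) ^ k : ℝ) : ℂ) =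
      ∑ i ∈ Finset.range (k + 1), ∑ j ∈ Finset.range (k + 1),
        (ν ^ i * k.choose i * (star ν ^ j * k.choose j)) * (z ^ (k - i) * star z ^ (k - j)) := by
    intro z
    have h : ((‖z + ν‖ ^ 2 : ℝ) : ℂ) = (ν + z) * (star ν + star z) := by
      rw [← star_add, add_comm z ν, Complex.star_def, Complex.mul_conj,
        Complex.normSq_eq_norm_sq]
    rw [Complex.ofReal_pow, h, mul_pow, add_pow, add_pow, Finset.sum_mul_sum]
    refine Finset.sum_congr rfl fun i _ => Finset.sum_congr rfl fun j _ => ?_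
    ring
  have h1 : ((∫ z, (‖z + ν‖ ^ 2) ^ k ∂stdComplex : ℝ) : ℂ) =
      ((k.factorial * ∑ i ∈ Finset.range (k + 1),
        (k.choose i : ℝ) * ((‖ν‖ ^ 2) ^ i / i.factorial) : ℝ) : ℂ) := by
    rw [← integral_complex_ofReal]
    simp only [hexp]
    rw [integral_finsetSum _ fun i _ => integrable_finsetSum _ fun j _ =>
      (integrable_pow_mul_star_pow _ _).const_mul _]
    rw [Finset.mul_sum]
    push_cast
    refine Finset.sum_congr rfl fun i hi => ?_
    rw [integral_finsetSum _ fun j _ => (integrable_pow_mul_star_pow _ _).const_mul _]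
    rw [Finset.sum_eq_single_of_mem i hi]
    · have hik : i ≤ k := Nat.lt_succ_iff.1 (Finset.mem_range.1 hi)
      rw [integral_const_mul, integral_pow_mul_star_pow, if_pos rfl]
      have hν : ν ^ i * star ν ^ i = ((‖ν‖ : ℂ) ^ 2) ^ i := by
        rw [← mul_pow, Complex.star_def, Complex.mul_conj, Complex.normSq_eq_norm_sq]
        push_cast
        rfl
      have hch : ((k.choose i : ℂ)) * i.factorial * (k - i).factorial = k.factorial := by
        exact_mod_cast Nat.choose_mul_factorial_mul_factorial hik
      have hi0 : (i.factorial : ℂ) ≠ 0 := by exact_mod_cast i.factorial_ne_zero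
      rw [← hν, ← hch]
      field_simp
    · intro j hj hji
      have hik : i ≤ k := Nat.lt_succ_iff.1 (Finset.mem_range.1 hi)
      have hjk : j ≤ k := Nat.lt_succ_iff.1 (Finset.mem_range.1 hj)
      rw [integral_const_mul, integral_pow_mul_star_pow, if_neg (by omega), mul_zero]
  exact_mod_cast h1

lemma integral_stdComplex (f : ℂ → ℝ) :
    ∫ z, f z ∂stdComplex = ∫ z, Real.exp (-‖z‖ ^ 2) / Real.pi * f z := by
  rw [stdComplex, integral_withDensity_eq_integral_toReal_smul (by fun_prop)
    (Filter.Eventually.of_forall fun z => ENNReal.ofReal_lt_top)]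
  refine integral_congr_ae (Filter.Eventually.of_forall fun z => ?_)
  dsimp only
  rw [ENNReal.toReal_ofReal (by positivity), smul_eq_mul]

/-- Completing the square: the tilted density is Gaussian with scale `c = (1 + s)^{-1/2}`, and `z =
c x + (c² - 1) μ` gives `z + μ = c (x + c μ)`. What remains is a moment of a shifted standard
Gaussian. -/
lemma integral_exp_mul_norm_add_sq_pow {s : ℝ} (hs : 0 ≤ s) (μ : ℂ) (k : ℕ) :
    ∫ z, Real.exp (-(s * ‖z + μ‖ ^ 2)) * (‖z + μ‖ ^ 2) ^ k ∂stdComplex =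
      Real.exp (-(s * ‖μ‖ ^ 2 / (1 + s))) / (1 + s) ^ (k + 1) *
        (k.factorial * ∑ i ∈ Finset.range (k + 1),
          (k.choose i : ℝ) * ((‖μ‖ ^ 2 / (1 + s)) ^ i / i.factorial)) := by
  have h1s : 0 < 1 + s := by positivity
  set c : ℝ := Real.sqrt (1 + s)⁻¹ with hc
  have hcc : c ^ 2 = (1 + s)⁻¹ := Real.sq_sqrt (by positivity)
  have hc0 : 0 < c := Real.sqrt_pos.2 (by positivity)
  set ν : ℂ := (c : ℂ) * μ with hν
  have hνn : ‖ν‖ ^ 2 = ‖μ‖ ^ 2 / (1 + s) := by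
    rw [hν, norm_mul, mul_pow, Complex.norm_real, Real.norm_eq_abs, abs_of_pos hc0, hcc]
    field_simp
  rw [← hνn, ← integral_norm_add_sq_pow, integral_stdComplex, integral_stdComplex]
  set F : ℂ → ℝ := fun z => Real.exp (-‖z‖ ^ 2) / Real.pi *
    (Real.exp (-(s * ‖z + μ‖ ^ 2)) * (‖z + μ‖ ^ 2) ^ k) with hF
  have hsub : ∫ z, F z = c ^ 2 * ∫ x : ℂ, F (c • x + ((c ^ 2 : ℝ) * μ - μ)) := by
    rw [Measure.integral_comp_smul volume (fun x => F (x + ((c ^ 2 : ℝ) * μ - μ))) c,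
      integral_add_right_eq_self F, Complex.finrank_real_complex, abs_of_pos (by positivity),
      smul_eq_mul]
    field_simp
  rw [hsub, ← integral_const_mul, ← integral_const_mul]
  refine integral_congr_ae (Filter.Eventually.of_forall fun x => ?_)
  simp only [hF]
  have hw : c • x + ((c ^ 2 : ℝ) * μ - μ) + μ = (c : ℂ) * (x + ν) := by
    rw [hν, Complex.real_smul]
    push_cast
    ring
  have hwn : ‖(c : ℂ) * (x + ν)‖ ^ 2 = c ^ 2 * ‖x + ν‖ ^ 2 := by
    rw [norm_mul, mul_pow, Complex.norm_real, Real.norm_eq_abs, abs_of_pos hc0]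
  rw [hw, hwn]
  have hexp : -‖c • x + ((c ^ 2 : ℝ) * μ - μ)‖ ^ 2 + -(s * (c ^ 2 * ‖x + ν‖ ^ 2)) =
      -‖x‖ ^ 2 + -(s * ‖μ‖ ^ 2 / (1 + s)) := by
    have h1 : s * ‖μ‖ ^ 2 / (1 + s) = (1 - c ^ 2) * ‖μ‖ ^ 2 := by
      rw [hcc]; field_simp; ring
    have h2 : s * c ^ 2 = 1 - c ^ 2 := by rw [hcc]; field_simp; ring
    rw [h1, ← mul_assoc, h2, hν]
    simp only [Complex.sq_norm, Complex.normSq_apply, Complex.add_re, Complex.add_im,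
      Complex.sub_re, Complex.sub_im, Complex.re_ofReal_mul, Complex.im_ofReal_mul,
      Complex.smul_re, Complex.smul_im, smul_eq_mul]
    ring
  have hE := congrArg Real.exp hexp
  rw [Real.exp_add, Real.exp_add] at hE
  have hgoal : ∀ A B C D n p : ℝ, A * B = C * D →
      c ^ 2 * (A / p * (B * (c ^ 2 * n) ^ k)) = D / (1 + s) ^ (k + 1) * (C / p * n ^ k) := by
    intro A B C D n p h
    rw [mul_pow, hcc]
    calc (1 + s)⁻¹ * (A / p * (B * ((1 + s)⁻¹ ^ k * n ^ k)))
        = (A * B) * ((1 + s)⁻¹ ^ (k + 1) * n ^ k / p) := by ring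
      _ = D / (1 + s) ^ (k + 1) * (C / p * n ^ k) := by rw [h, inv_pow]; ring
  exact hgoal _ _ _ _ _ _ hE

/-- A non-integrable function would have integral zero, whereas the closed form is positive because
its `i = 0` summand is `1`. -/
lemma integrable_exp_mul_norm_add_sq_pow {s : ℝ} (hs : 0 < s) (μ : ℂ) (k : ℕ) :
    Integrable (fun z => Real.exp (-(s * ‖z + μ‖ ^ 2)) * (‖z + μ‖ ^ 2) ^ k) stdComplex := by
  refine Integrable.of_integral_ne_zero ?_
  rw [integral_exp_mul_norm_add_sq_pow hs.le]
  refine (mul_pos (by positivity) (mul_pos (by positivity) ?_)).ne'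
  refine Finset.sum_pos' (fun i _ => by positivity) ⟨0, by simp, by simp⟩

/-- For fixed `z` and `γ > 0` the event is `w ≥ |z + μ|²/γ`, whose probability is a gamma tail;
integrating that tail term by term over `z` uses the tilted moments with `s = 1/γ`. -/
lemma measure_ratio_eq_condCdf (k : ℕ) {α b γ : ℝ} (hγ : 0 ≤ γ) {μ : ℂ} (hμ : ‖μ‖ ^ 2 = α * b) :
    (stdComplex.prod (erlang k)) {z | ‖z.1 + μ‖ ^ 2 / z.2 ∈ Set.Iic γ} =
      ENNReal.ofReal (condCdf (k + 1) α b γ) := by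
  have hm : MeasurableSet {z : ℂ × ℝ | ‖z.1 + μ‖ ^ 2 / z.2 ∈ Set.Iic γ} :=
    (by fun_prop : Measurable fun z : ℂ × ℝ => ‖z.1 + μ‖ ^ 2 / z.2) measurableSet_Iic
  rw [Measure.prod_apply hm]
  have hpos : ∀ᵐ w ∂(erlang k), 0 < w := by
    filter_upwards [measure_eq_zero_iff_ae_notMem.1 (erlang_Iic_zero k)] with w hw
    simpa using hw
  -- At `γ = 0` the substitution `s = 1/γ` is unavailable; both sides vanish since `z + μ ≠ 0`
  -- almost surely.
  rcases hγ.eq_or_lt with rfl | hγ0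
  · have h0 : condCdf (k + 1) α b 0 = 0 := by
      unfold condCdf
      refine Finset.sum_eq_zero fun i _ => ?_
      rw [zero_pow (by omega)]
      simp
    have hsing : stdComplex {-μ} = 0 := by
      rw [stdComplex]
      exact withDensity_absolutelyContinuous _ _ (measure_singleton _)
    rw [h0, ENNReal.ofReal_zero, lintegral_eq_zero_iff (measurable_measure_prodMk_left hm)]
    filter_upwards [measure_eq_zero_iff_ae_notMem.1 hsing] with z hz
    refine measure_eq_zero_iff_ae_notMem.2 ?_
    filter_upwards [hpos] with w hw h
    have h1 : ‖z + μ‖ ^ 2 / w ≤ 0 := h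
    have h2 : 0 < ‖z + μ‖ := norm_pos_iff.2 fun h3 => hz (eq_neg_of_add_eq_zero_left h3)
    have : 0 < ‖z + μ‖ ^ 2 / w := by positivity
    linarith
  · set s := γ⁻¹ with hs
    have hs0 : 0 < s := inv_pos.2 hγ0
    have h1 : ∀ z, erlang k (Prod.mk z ⁻¹' {z : ℂ × ℝ | ‖z.1 + μ‖ ^ 2 / z.2 ∈ Set.Iic γ}) =
        ENNReal.ofReal (erlangTail k (s * ‖z + μ‖ ^ 2)) := by
      intro z
      rw [← erlang_Ici k (by positivity)]
      refine measure_congr ?_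
      filter_upwards [hpos] with w hw
      refine propext ?_
      change ‖z + μ‖ ^ 2 / w ≤ γ ↔ s * ‖z + μ‖ ^ 2 ≤ w
      rw [div_le_iff₀ hw, hs, inv_mul_le_iff₀ hγ0]
    have hexp : ∀ z, erlangTail k (s * ‖z + μ‖ ^ 2) = ∑ j ∈ Finset.range (k + 1),
        s ^ j / j.factorial * (Real.exp (-(s * ‖z + μ‖ ^ 2)) * (‖z + μ‖ ^ 2) ^ j) := by
      intro z
      rw [erlangTail, Finset.mul_sum]
      refine Finset.sum_congr rfl fun j _ => ?_
      rw [mul_pow]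
      ring
    have hint : ∀ j ∈ Finset.range (k + 1), Integrable (fun z => s ^ j / j.factorial *
        (Real.exp (-(s * ‖z + μ‖ ^ 2)) * (‖z + μ‖ ^ 2) ^ j)) stdComplex := fun j _ =>
      (integrable_exp_mul_norm_add_sq_pow hs0 μ j).const_mul _
    simp only [h1, hexp]
    rw [← ofReal_integral_eq_lintegral_ofReal (integrable_finsetSum _ hint)
      (Filter.Eventually.of_forall fun z => Finset.sum_nonneg fun j _ => by positivity),
      integral_finsetSum _ hint, condCdf_eq_sum _ hγ, Finset.mul_sum]
    congr 1
    refine Finset.sum_congr rfl fun j _ => ?_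
    have e1 : s * ‖μ‖ ^ 2 / (1 + s) = α * b / (1 + γ) := by rw [hs, hμ]; field_simp; ring
    have e2 : ‖μ‖ ^ 2 / (1 + s) = γ * (α * b / (1 + γ)) := by rw [hs, hμ]; field_simp; ring
    have e3 : s ^ j / (1 + s) ^ (j + 1) = γ / (1 + γ) ^ (j + 1) := by
      rw [hs, show 1 + γ⁻¹ = (1 + γ) / γ by field_simp; ring, div_pow, inv_pow]
      field_simp
      ring
    rw [integral_const_mul, integral_exp_mul_norm_add_sq_pow hs0.le, e1, e2, ← e3]
    field_simp

lemma condCdf_nonneg (k : ℕ) {α b γ : ℝ} (hα : 0 ≤ α) (hb : 0 ≤ b) (hγ : 0 ≤ γ) :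
    0 ≤ condCdf k α b γ := by
  rw [condCdf_eq_sum _ hγ]
  exact mul_nonneg (Real.exp_pos _).le (Finset.sum_nonneg fun j _ =>
    mul_nonneg (by positivity) (Finset.sum_nonneg fun i _ => by positivity))

/-- The bound is inherited from the probabilistic meaning, taking a real shift `μ = √(αb)`. -/
lemma condCdf_le_one (k : ℕ) {α b γ : ℝ} (hα : 0 ≤ α) (hb : 0 ≤ b) (hγ : 0 ≤ γ) :
    condCdf (k + 1) α b γ ≤ 1 := by
  have h := measure_ratio_eq_condCdf k hγ (μ := (Real.sqrt (α * b) : ℂ)) (α := α) (b := b) (by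
    rw [Complex.norm_real, Real.norm_eq_abs, sq_abs, Real.sq_sqrt (by positivity)])
  have h2 : ENNReal.ofReal (condCdf (k + 1) α b γ) ≤ 1 := h ▸ prob_le_one
  exact ENNReal.ofReal_le_one.1 h2

end CondCdf

/-! ### Laws of the whitened statistics -/

section Whitened

set_option linter.unusedSectionVars false

variable {ι J Ω : Type*} [Fintype ι] [DecidableEq ι] [Fintype J] [DecidableEq J]
  [MeasurableSpace Ω]

/-! ### Measurability of matrix expressions. -/

lemma measurable_det {f : Ω → Matrix ι ι ℂ} (hf : ∀ i j, Measurable fun w => f w i j) :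
    Measurable fun w => (f w).det := by
  simp only [det_apply]
  exact Finset.measurable_sum _ fun σ _ => Measurable.const_smul
    (Finset.measurable_prod _ fun i _ => hf _ _) _

/-- The adjugate formula with a totalised reciprocal of the determinant is measurable everywhere,
singular matrices included. -/
lemma measurable_inv_apply {f : Ω → Matrix ι ι ℂ} (hf : ∀ i j, Measurable fun w => f w i j)
    (i j : ι) : Measurable fun w => (f w)⁻¹ i j := by
  simp only [Matrix.inv_def, Matrix.smul_apply, Ring.inverse_eq_inv', adjugate_apply, smul_eq_mul]
  refine (measurable_det hf).inv.mul (measurable_det fun k l => ?_)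
  by_cases hk : k = j
  · simp only [hk, updateRow_self]
    exact measurable_const
  · simp only [updateRow_ne hk]
    exact hf k l

lemma measurable_mul_apply {κ τ : Type*} {f : Ω → Matrix κ ι ℂ} {g : Ω → Matrix ι τ ℂ}
    (hf : ∀ i j, Measurable fun w => f w i j) (hg : ∀ i j, Measurable fun w => g w i j) (i : κ)
    (j : τ) : Measurable fun w => (f w * g w) i j := by
  simp only [Matrix.mul_apply]
  exact Finset.measurable_sum _ fun k _ => (hf _ _).mul (hg _ _)

lemma measurable_conjTranspose_apply {κ τ : Type*} {f : Ω → Matrix κ τ ℂ}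
    (hf : ∀ i j, Measurable fun w => f w i j) (i : τ) (j : κ) :
    Measurable fun w => (f w)ᴴ i j := by
  simp only [conjTranspose_apply]
  exact continuous_star.measurable.comp (hf j i)

lemma measurable_gram_inv_apply {f : Ω → Matrix ι J ℂ} (hf : ∀ i j, Measurable fun w => f w i j)
    (i j : ι) : Measurable fun w => (f w * (f w)ᴴ)⁻¹ i j :=
  measurable_inv_apply (measurable_mul_apply hf (measurable_conjTranspose_apply hf)) i j

lemma measurable_rowPerp_apply {f : Ω → Matrix ι J ℂ} (hf : ∀ i j, Measurable fun w => f w i j)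
    (i j : J) : Measurable fun w => rowPerp (f w) i j := by
  simp only [rowPerp, Matrix.sub_apply]
  exact measurable_const.sub (measurable_mul_apply (measurable_mul_apply
    (measurable_conjTranspose_apply hf) (measurable_gram_inv_apply hf)) hf i j)

lemma measurable_mulVec_apply {κ : Type*} {f : Ω → Matrix κ ι ℂ} {v : Ω → ι → ℂ}
    (hf : ∀ i j, Measurable fun w => f w i j) (hv : ∀ j, Measurable fun w => v w j) (i : κ) :
    Measurable fun w => (f w *ᵥ v w) i := by
  simp only [mulVec, dotProduct]
  exact Finset.measurable_sum _ fun k _ => (hf _ _).mul (hv _)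

lemma measurable_dotProduct {u v : Ω → ι → ℂ} (hu : ∀ j, Measurable fun w => u w j)
    (hv : ∀ j, Measurable fun w => v w j) : Measurable fun w => u w ⬝ᵥ v w := by
  simp only [dotProduct]
  exact Finset.measurable_sum _ fun k _ => (hu _).mul (hv _)

lemma measurable_star_apply {v : Ω → ι → ℂ} (hv : ∀ j, Measurable fun w => v w j) (j : ι) :
    Measurable fun w => star (v w) j := by
  simp only [Pi.star_apply]
  exact continuous_star.measurable.comp (hv j)

/-- The law of independent standard Gaussian rows. -/
noncomputable abbrev rowsLaw (ι J : Type*) [Fintype ι] [Fintype J] : Measure (ι → J → ℂ) :=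
  Measure.pi fun _ => stdVec J

lemma measurable_entry (i : ι) (j : J) : Measurable fun w : ι → J → ℂ => Matrix.of w i j := by
  simp only [Matrix.of_apply]
  fun_prop

lemma measurePreserving_mul_right {U : Matrix J J ℂ} (hU : Uᴴ * U = 1) :
    MeasurePreserving (fun (w : ι → J → ℂ) i j => (Matrix.of w * U) i j)
      (rowsLaw ι J) (rowsLaw ι J) := by
  have h : MeasurePreserving (fun z => Uᵀ *ᵥ z) (stdVec J) (stdVec J) := by
    refine measurePreserving_mulVec ?_
    have := congrArg transpose hU
    rw [transpose_mul, transpose_one] at this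
    exact this
  convert measurePreserving_pi (fun _ : ι => stdVec J) (fun _ => stdVec J) (fun _ => h) using 1
  funext w i j
  simp [Matrix.mul_apply, mulVec, dotProduct, mul_comm]

/-- The sine of the angle between the Doppler direction and the span of Gaussian rows. -/
lemma map_rowPerp_form {e : J → ℂ} (he : star e ⬝ᵥ e = 1) {p : ℕ}
    {q : ℕ} (hι : Fintype.card ι = q + 1) (hJ : Fintype.card J = p + 1 + (q + 1)) :
    (rowsLaw ι J).map (fun V => (star e ⬝ᵥ (rowPerp (Matrix.of V) *ᵥ e)).re) =
      betaNat p q := by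
  have hm : ∀ e : J → ℂ, Measurable fun V : ι → J → ℂ =>
      (star e ⬝ᵥ (rowPerp (Matrix.of V) *ᵥ e)).re := fun e =>
    Complex.measurable_re.comp (measurable_dotProduct (fun _ => measurable_const)
      (measurable_mulVec_apply (measurable_rowPerp_apply measurable_entry)
        fun _ => measurable_const))
  ext A hA
  rw [Measure.map_apply (hm e) hA]
  refine measure_quadratic_of_invariant (rowsLaw ι J)
    (Q := fun V => rowPerp (Matrix.of V)) (measurable_rowPerp_apply measurable_entry)
    ?_ hJ ?_ he hA
  -- Almost surely the rows are independent, so the complementary projection has rank `|J| - |ι| = p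
  -- + 1`.
  · filter_upwards [ae_linearIndependent (ι := ι) (LinearMap.id : (J → ℂ) →ₗ[ℂ] (J → ℂ))
      Function.surjective_id (by omega)] with V hV
    have hVu := isUnit_mul_conjTranspose_of_linearIndependent (V := (Matrix.of V)) hV
    refine ⟨rowPerp_isHermitian _, rowPerp_mul_self hVu, ?_⟩
    rw [trace_rowPerp hVu, hJ, hι]
    push_cast
    ring
  · intro U hU hU' e A hA
    have hmp := measurePreserving_mul_right (ι := ι) hU'
    refine (hmp.measure_preimage (hm e hA).nullMeasurableSet).symm.trans ?_
    congr 1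
    ext V
    change (star e ⬝ᵥ (rowPerp (of V * U) *ᵥ e)).re ∈ A ↔ _ ∈ A
    rw [rowPerp_mul_right hU hU', ← mulVec_mulVec, ← mulVec_mulVec, dotProduct_mulVec (star e),
      star_mulVec]

/-- The law of the Rao form without a target. -/
lemma measure_raoForm {e : J → ℂ} (he : star e ⬝ᵥ e = 1) (i₀ : ι)
    {q : ℕ} (hι : Fintype.card ι ≤ Fintype.card J) (hJ : Fintype.card J = q + 2) {A : Set ℝ}
    (hA : MeasurableSet A) :
    rowsLaw ι J {w | raoForm (Matrix.of w) (Pi.single i₀ 1) e ∈ A} = betaNat 0 q A := by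
  set a : ι → ℂ := Pi.single i₀ 1 with ha
  have ha0 : a ≠ 0 := by rw [ha]; simp
  set d : (ι → J → ℂ) → ℝ := fun w =>
    (star a ⬝ᵥ (((Matrix.of w) * (Matrix.of w)ᴴ)⁻¹ *ᵥ a)).re with hd
  set v : (ι → J → ℂ) → J → ℂ := fun w =>
    (Matrix.of w)ᴴ *ᵥ (((Matrix.of w) * (Matrix.of w)ᴴ)⁻¹ *ᵥ a) with hv
  have hdm : Measurable d := Complex.measurable_re.comp
    (measurable_dotProduct (fun _ => measurable_const) (measurable_mulVec_apply
      (measurable_gram_inv_apply measurable_entry) fun _ => measurable_const))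
  have hvm : ∀ j, Measurable fun w => v w j := measurable_mulVec_apply
    (measurable_conjTranspose_apply measurable_entry) (measurable_mulVec_apply
      (measurable_gram_inv_apply measurable_entry) fun _ => measurable_const)
  -- The Rao form at `e` is `e†Qe` for the rank-one projection onto `v = X†(XX†)⁻¹a`, because `v†v =
  -- a†(XX†)⁻¹a`. Rank one gives the first beta parameter `1`.
  set Q : (ι → J → ℂ) → Matrix J J ℂ := fun w =>
    (((d w)⁻¹ : ℝ) : ℂ) • vecMulVec (v w) (star (v w)) with hQ
  have hQm : ∀ i j, Measurable fun w => Q w i j := by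
    intro i j
    simp only [hQ, Matrix.smul_apply, vecMulVec_apply, smul_eq_mul]
    exact (Complex.measurable_ofReal.comp hdm.inv).mul
      ((hvm i).mul (measurable_star_apply hvm j))
  have hvs : ∀ w x, star (v w) ⬝ᵥ x = crossTerm (Matrix.of w) a x := by
    intro w x
    rw [hv, crossTerm, star_mulVec, star_mulVec, conjTranspose_conjTranspose, ← dotProduct_mulVec,
      ← dotProduct_mulVec, (Matrix.isHermitian_mul_conjTranspose_self _).inv.eq]
  have hform : ∀ w x, (star x ⬝ᵥ (Q w *ᵥ x)).re = raoForm (Matrix.of w) a x := by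
    intro w x
    have h1 : star x ⬝ᵥ v w = star (star (v w) ⬝ᵥ x) := by rw [star_dotProduct]
    rw [hQ]
    dsimp only
    rw [smul_mulVec, vecMulVec_mulVec, op_smul_eq_smul, dotProduct_smul, dotProduct_smul,
      h1, hvs, smul_eq_mul, smul_eq_mul, Complex.re_ofReal_mul, Complex.star_def,
      Complex.mul_conj, Complex.normSq_eq_norm_sq, Complex.ofReal_re, raoForm, div_eq_inv_mul]
  have hraom : ∀ x, Measurable fun w : ι → J → ℂ => raoForm (Matrix.of w) a x := by
    intro x
    simp only [← hform]
    exact Complex.measurable_re.comp (measurable_dotProduct (fun _ => measurable_const)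
      (measurable_mulVec_apply hQm fun _ => measurable_const))
  simp only [← hform]
  refine measure_quadratic_of_invariant (rowsLaw ι J) hQm ?_ (by omega) ?_ he hA
  · filter_upwards [ae_linearIndependent (ι := ι) (LinearMap.id : (J → ℂ) →ₗ[ℂ] (J → ℂ))
      Function.surjective_id hι] with w hw
    have hwu := isUnit_mul_conjTranspose_of_linearIndependent (V := (Matrix.of w)) hw
    have hpos := (Matrix.posSemidef_self_mul_conjTranspose (Matrix.of w)).posDef_iff_isUnit.2
      hwu
    have hpa := hpos.inv.dotProduct_mulVec_pos ha0
    have hda : star a ⬝ᵥ (((Matrix.of w) * (Matrix.of w)ᴴ)⁻¹ *ᵥ a) = (d w : ℂ) :=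
      Complex.eq_re_of_ofReal_le (r := 0) (by simpa using hpa.le)
    have hd0 : 0 < d w := by rw [hda] at hpa; exact_mod_cast hpa
    have hdc : (d w : ℂ) ≠ 0 := by exact_mod_cast hd0.ne'
    have hvv : star (v w) ⬝ᵥ v w = d w := by
      rw [hvs, crossTerm, ← hda, hv]
      dsimp only
      rw [mulVec_mulVec, mulVec_mulVec,
        Matrix.mul_assoc, Matrix.nonsing_inv_mul _ ((Matrix.isUnit_iff_isUnit_det _).1 hwu), one_mulVec]
    refine ⟨isHermitian_smul_vecMulVec _ _, ?_, ?_⟩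
    · rw [hQ]
      dsimp only
      rw [Matrix.smul_mul, Matrix.mul_smul, vecMulVec_mul_vecMulVec, hvv, vecMulVec_smul,
        smul_smul, smul_smul]
      congr 1
      push_cast
      field_simp
    · rw [hQ]
      dsimp only
      rw [trace_smul, trace_vecMulVec, dotProduct_comm, hvv, smul_eq_mul]
      push_cast
      field_simp
      norm_num
  · intro U hU hU' x A hA
    have hmp := measurePreserving_mul_right (ι := ι) hU'
    simp only [hform]
    refine (hmp.measure_preimage (hraom x hA).nullMeasurableSet).symm.trans ?_
    congr 1
    ext w
    change raoForm (of w * U) a x ∈ A ↔ _ ∈ A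
    rw [forms_mul_right hU]

/-- Adding a multiple of `e†` to one row. -/
noncomputable def shiftRow (i₀ : ι) (m : ℂ) (e : J → ℂ) (w : ι → J → ℂ) : Matrix ι J ℂ :=
  Matrix.of (Function.update w i₀ (w i₀ + m • star e))

lemma measurePreserving_split (i₀ : ι) :
    MeasurePreserving (fun w : ι → J → ℂ => (w i₀, fun i : {i // i ≠ i₀} => w i.1)) (rowsLaw ι J)
      ((stdVec J).prod (rowsLaw {i // i ≠ i₀} J)) := by
  have h1 := measurePreserving_piEquivPiSubtypeProd (fun _ : ι => stdVec J) (fun i => i = i₀)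
  have h2 := @measurePreserving_eval {i // i = i₀} _ (Subtype.fintype _) _
    (fun _ => stdVec J) _ ⟨i₀, rfl⟩
  exact (h2.prod (MeasurePreserving.id _)).comp h1

/-- Almost surely, the statistics only depend on one row and a projection given by the others. -/
lemma ae_statistics (i₀ : ι) (m : ℂ) {e : J → ℂ} (he : star e ⬝ᵥ e = 1)
    (hcard : Fintype.card ι ≤ Fintype.card J)
    (hX : ∀ᵐ w ∂rowsLaw ι J, IsUnit (shiftRow i₀ m e w * (shiftRow i₀ m e w)ᴴ)) :
    ∀ᵐ w ∂rowsLaw ι J,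
      residual (shiftRow i₀ m e w) e + raoForm (shiftRow i₀ m e w) (Pi.single i₀ 1) e =
        (star e ⬝ᵥ (rowPerp (Matrix.of fun i : {i // i ≠ i₀} => w i.1) *ᵥ e)).re ∧
      raoForm (shiftRow i₀ m e w) (Pi.single i₀ 1) e / residual (shiftRow i₀ m e w) e =
        ‖(w i₀ + m • star e) ⬝ᵥ
            (rowPerp (Matrix.of fun i : {i // i ≠ i₀} => w i.1) *ᵥ e)‖ ^ 2 /
          ((star e ⬝ᵥ (rowPerp (Matrix.of fun i : {i // i ≠ i₀} => w i.1) *ᵥ e)).re *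
            ((w i₀ + m • star e) ⬝ᵥ (rowPerp (Matrix.of fun i : {i // i ≠ i₀} => w i.1) *ᵥ
              star (w i₀ + m • star e))).re -
          ‖(w i₀ + m • star e) ⬝ᵥ
            (rowPerp (Matrix.of fun i : {i // i ≠ i₀} => w i.1) *ᵥ e)‖ ^ 2) := by
  filter_upwards [hX, ae_linearIndependent (ι := ι) (LinearMap.id : (J → ℂ) →ₗ[ℂ] (J → ℂ))
      Function.surjective_id hcard] with w hXw hw
  have hV : IsUnit ((Matrix.of fun i : {i // i ≠ i₀} => w i.1) *
      (Matrix.of fun i : {i // i ≠ i₀} => w i.1)ᴴ) :=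
    isUnit_mul_conjTranspose_of_linearIndependent
      (V := (Matrix.of fun i : {i // i ≠ i₀} => w i.1))
      (hw.comp (Subtype.val : {i // i ≠ i₀} → ι) Subtype.val_injective)
  have hrow : shiftRow i₀ m e w i₀ = w i₀ + m • star e := Function.update_self ..
  have hsub : (Matrix.of fun i : {i // i ≠ i₀} => w i.1) =
      (shiftRow i₀ m e w).submatrix Subtype.val id := by
    funext i
    exact (Function.update_of_ne i.2 _ w).symm
  obtain ⟨ht, hrao, hres⟩ := forms_single (shiftRow i₀ m e w) i₀ hXw hsub hV he
  rw [hrow] at ht hrao hres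
  refine ⟨by rw [hrao, hres]; ring, ?_⟩
  rw [hrao, hres]
  set t := ((w i₀ + m • star e) ⬝ᵥ (rowPerp (Matrix.of fun i : {i // i ≠ i₀} => w i.1) *ᵥ
    star (w i₀ + m • star e))).re
  set N := ‖(w i₀ + m • star e) ⬝ᵥ
    (rowPerp (Matrix.of fun i : {i // i ≠ i₀} => w i.1) *ᵥ e)‖ ^ 2
  set b := (star e ⬝ᵥ (rowPerp (Matrix.of fun i : {i // i ≠ i₀} => w i.1) *ᵥ e)).re
  -- Clearing the inner denominator: `(N/t)/(b - N/t) = N/(bt - N)`.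
  rw [div_div, mul_sub, mul_div_cancel₀ _ ht.ne', mul_comm t b]

lemma betaNat_Iic_zero (p q : ℕ) : betaNat p q (Set.Iic 0) = 0 := by
  rw [betaNat, withDensity_apply _ measurableSet_Iic, Measure.restrict_restrict measurableSet_Iic,
    show Set.Iic (0 : ℝ) ∩ Set.Ioo 0 1 = ∅ by
      ext x; simp only [Set.mem_inter_iff, Set.mem_Iic, Set.mem_Ioo, Set.mem_empty_iff_false]
      constructor
      · rintro ⟨h1, h2, -⟩; linarith
      · exact False.elim,
    Measure.restrict_empty, lintegral_zero_measure]

/-- Almost surely the sum equals `e†Qe`, which does not see the shifted row; hence the law is the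
same for every `m`. With `q + 1` remaining rows, `Q` has rank `k + 2`. -/
lemma measure_lossFactor (i₀ : ι) (m : ℂ) {e : J → ℂ} (he : star e ⬝ᵥ e = 1) {k q : ℕ}
    (hι : Fintype.card ι = q + 2) (hJ : Fintype.card J = k + 1 + (q + 2))
    (hX : ∀ᵐ w ∂rowsLaw ι J, IsUnit (shiftRow i₀ m e w * (shiftRow i₀ m e w)ᴴ))
    {s : Set ℝ} (hs : MeasurableSet s) :
    rowsLaw ι J {w | residual (shiftRow i₀ m e w) e +
      raoForm (shiftRow i₀ m e w) (Pi.single i₀ 1) e ∈ s} = betaNat (k + 1) q s := by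
  have hι' : Fintype.card {i // i ≠ i₀} = q + 1 := by
    rw [Fintype.card_subtype_compl, hι, Fintype.card_subtype_eq]; rfl
  have hm : Measurable fun V : {i // i ≠ i₀} → J → ℂ =>
      (star e ⬝ᵥ (rowPerp (Matrix.of V) *ᵥ e)).re :=
    Complex.measurable_re.comp (measurable_dotProduct (fun _ => measurable_const)
      (measurable_mulVec_apply (measurable_rowPerp_apply measurable_entry)
        fun _ => measurable_const))
  have hmap := map_rowPerp_form (ι := {i // i ≠ i₀}) he (p := k + 1) hι' (by omega)
  have hsnd := (measurePreserving_snd (μ := stdVec J)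
    (ν := rowsLaw {i // i ≠ i₀} J)).comp (measurePreserving_split (J := J) i₀)
  rw [← hmap, Measure.map_apply hm hs, ← hsnd.measure_preimage (hm hs).nullMeasurableSet]
  refine measure_congr ?_
  filter_upwards [ae_statistics i₀ m he (by omega) hX] with w hw
  refine propext ?_
  change _ ∈ s ↔ _ ∈ s
  rw [hw.1]
  rfl

lemma measurable_condCdf (d : ℕ) (α : ℝ) {g : ℝ → ℝ} (hg : Measurable g) :
    Measurable fun b => condCdf d α b (g b) := by
  unfold condCdf incGamma
  fun_prop

/-- The joint law of the loss factor and the ratio statistic. -/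
lemma measure_lossFactor_ratio (i₀ : ι) (m : ℂ) {e : J → ℂ} (he : star e ⬝ᵥ e = 1) {k q : ℕ}
    (hι : Fintype.card ι = q + 2) (hJ : Fintype.card J = k + 1 + (q + 2))
    (hX : ∀ᵐ w ∂rowsLaw ι J, IsUnit (shiftRow i₀ m e w * (shiftRow i₀ m e w)ᴴ))
    {s : Set ℝ} (hs : MeasurableSet s) {g : ℝ → ℝ} (hg : Measurable g) (hg0 : ∀ b, 0 ≤ g b) :
    rowsLaw ι J {w | residual (shiftRow i₀ m e w) e +
        raoForm (shiftRow i₀ m e w) (Pi.single i₀ 1) e ∈ s ∧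
      raoForm (shiftRow i₀ m e w) (Pi.single i₀ 1) e / residual (shiftRow i₀ m e w) e ≤
        g (residual (shiftRow i₀ m e w) e +
          raoForm (shiftRow i₀ m e w) (Pi.single i₀ 1) e)} =
      ∫⁻ b in s, ENNReal.ofReal (condCdf (k + 1) (‖m‖ ^ 2) b (g b)) ∂betaNat (k + 1) q := by
  have hι' : Fintype.card {i // i ≠ i₀} = q + 1 := by
    rw [Fintype.card_subtype_compl, hι, Fintype.card_subtype_eq]; rfl
  set B : ({i // i ≠ i₀} → J → ℂ) → ℝ := fun V =>
    (star e ⬝ᵥ (rowPerp (Matrix.of V) *ᵥ e)).re with hB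
  have hBm : Measurable B :=
    Complex.measurable_re.comp (measurable_dotProduct (fun _ => measurable_const)
      (measurable_mulVec_apply (measurable_rowPerp_apply measurable_entry)
        fun _ => measurable_const))
  have hmap : (rowsLaw {i // i ≠ i₀} J).map B = betaNat (k + 1) q :=
    map_rowPerp_form (ι := {i // i ≠ i₀}) he (p := k + 1) hι' (by omega)
  set T : (J → ℂ) × ({i // i ≠ i₀} → J → ℂ) → ℝ := fun z =>
    ‖(z.1 + m • star e) ⬝ᵥ (rowPerp (Matrix.of z.2) *ᵥ e)‖ ^ 2 /
      (B z.2 * ((z.1 + m • star e) ⬝ᵥ (rowPerp (Matrix.of z.2) *ᵥ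
        star (z.1 + m • star e))).re -
      ‖(z.1 + m • star e) ⬝ᵥ (rowPerp (Matrix.of z.2) *ᵥ e)‖ ^ 2) with hT
  have hTm : Measurable T := by
    have hx : ∀ j, Measurable fun z : (J → ℂ) × ({i // i ≠ i₀} → J → ℂ) =>
        (z.1 + m • star e) j := by
      intro j
      simp only [Pi.add_apply]
      fun_prop
    have hQ : ∀ i j, Measurable fun z : (J → ℂ) × ({i // i ≠ i₀} → J → ℂ) =>
        rowPerp (Matrix.of z.2) i j := measurable_rowPerp_apply fun i j => by fun_prop
    have hN : Measurable fun z : (J → ℂ) × ({i // i ≠ i₀} → J → ℂ) =>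
        ‖(z.1 + m • star e) ⬝ᵥ (rowPerp (Matrix.of z.2) *ᵥ e)‖ ^ 2 := by
      have h : Measurable fun z : (J → ℂ) × ({i // i ≠ i₀} → J → ℂ) =>
          (z.1 + m • star e) ⬝ᵥ (rowPerp (Matrix.of z.2) *ᵥ e) :=
        measurable_dotProduct (u := fun z : (J → ℂ) × ({i // i ≠ i₀} → J → ℂ) =>
          z.1 + m • star e) (v := fun z => rowPerp (Matrix.of z.2) *ᵥ e) hx
          (measurable_mulVec_apply (f := fun z : (J → ℂ) × ({i // i ≠ i₀} → J → ℂ) =>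
            rowPerp (Matrix.of z.2)) hQ fun _ => measurable_const)
      exact h.norm.pow_const 2
    have ht : Measurable fun z : (J → ℂ) × ({i // i ≠ i₀} → J → ℂ) =>
        ((z.1 + m • star e) ⬝ᵥ (rowPerp (Matrix.of z.2) *ᵥ star (z.1 + m • star e))).re :=
      Complex.measurable_re.comp
        (measurable_dotProduct (u := fun z : (J → ℂ) × ({i // i ≠ i₀} → J → ℂ) =>
          z.1 + m • star e) (v := fun z => rowPerp (Matrix.of z.2) *ᵥ star (z.1 + m • star e)) hx
          (measurable_mulVec_apply (f := fun z : (J → ℂ) × ({i // i ≠ i₀} → J → ℂ) =>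
            rowPerp (Matrix.of z.2)) hQ (measurable_star_apply hx)))
    have hb : Measurable fun z : (J → ℂ) × ({i // i ≠ i₀} → J → ℂ) => B z.2 :=
      hBm.comp measurable_snd
    exact hN.div ((hb.mul ht).sub hN)
  -- A threshold depending on `b` serves both the joint distribution function (constant `g`) and the
  -- detection event.
  set E : Set ((J → ℂ) × ({i // i ≠ i₀} → J → ℂ)) :=
    {z | B z.2 ∈ s ∧ T z ≤ g (B z.2)} with hE
  have hEm : MeasurableSet E := ((hBm.comp measurable_snd) hs).inter
    (measurableSet_le hTm (hg.comp (hBm.comp measurable_snd)))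
  have hsplit := measurePreserving_split (J := J) i₀
  have h1 : rowsLaw ι J {w | residual (shiftRow i₀ m e w) e +
        raoForm (shiftRow i₀ m e w) (Pi.single i₀ 1) e ∈ s ∧
      raoForm (shiftRow i₀ m e w) (Pi.single i₀ 1) e / residual (shiftRow i₀ m e w) e ≤
        g (residual (shiftRow i₀ m e w) e +
          raoForm (shiftRow i₀ m e w) (Pi.single i₀ 1) e)} =
      ((stdVec J).prod (rowsLaw {i // i ≠ i₀} J)) E := by
    rw [← hsplit.measure_preimage hEm.nullMeasurableSet]
    refine measure_congr ?_
    filter_upwards [ae_statistics i₀ m he (by omega) hX] with w hw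
    refine propext ?_
    change (_ ∈ s ∧ _ ≤ g _) ↔ (_ ∈ s ∧ _ ≤ g _)
    rw [hw.1, hw.2]
  have hBpos : ∀ᵐ V ∂rowsLaw {i // i ≠ i₀} J, 0 < B V := by
    have h := betaNat_Iic_zero (k + 1) q
    rw [← hmap, Measure.map_apply hBm measurableSet_Iic] at h
    filter_upwards [measure_eq_zero_iff_ae_notMem.1 h] with V hV
    simpa using hV
  -- Conditioning on the other rows freezes `Q`. The slice depends on `V` only through `B V`, so the
  -- outer integral can be pushed forward to the beta law.
  have h2 : ∀ᵐ V ∂rowsLaw {i // i ≠ i₀} J, stdVec J ((fun x => (x, V)) ⁻¹' E) =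
      s.indicator (fun b => ENNReal.ofReal (condCdf (k + 1) (‖m‖ ^ 2) b (g b))) (B V) := by
    filter_upwards [hBpos, ae_linearIndependent (ι := {i // i ≠ i₀})
      (LinearMap.id : (J → ℂ) →ₗ[ℂ] (J → ℂ)) Function.surjective_id (by omega)] with V hb hV
    by_cases hbs : B V ∈ s
    · have hVu := isUnit_mul_conjTranspose_of_linearIndependent (V := (Matrix.of V)) hV
      have htr : (rowPerp (Matrix.of V)).trace = k + 2 := by
        rw [trace_rowPerp hVu, hJ, hι']
        push_cast
        ring
      have hbe : star e ⬝ᵥ (rowPerp (Matrix.of V) *ᵥ e) = (B V : ℂ) := by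
        have h : star (star e ⬝ᵥ (rowPerp (Matrix.of V) *ᵥ e)) =
            star e ⬝ᵥ (rowPerp (Matrix.of V) *ᵥ e) := by
          rw [← star_dotProduct, star_mulVec, (rowPerp_isHermitian _).eq, ← dotProduct_mulVec]
        exact (Complex.conj_eq_iff_re.1 h).symm
      obtain ⟨μ, hμ, hlaw⟩ := exists_measure_ratio_eq (rowPerp_isHermitian _)
        (rowPerp_mul_self hVu) htr hb hbe m
      rw [Set.indicator_of_mem hbs, ← measure_ratio_eq_condCdf k (hg0 _) hμ,
        ← hlaw _ measurableSet_Iic]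
      congr 1
      ext x
      exact and_iff_right hbs
    · rw [Set.indicator_of_notMem hbs]
      convert measure_empty (μ := stdVec J) using 2
      ext x
      simp only [hE, Set.mem_preimage, Set.mem_ofPred_eq, Set.mem_empty_iff_false, iff_false]
      exact fun h => hbs h.1
  have hcm : Measurable fun b => ENNReal.ofReal (condCdf (k + 1) (‖m‖ ^ 2) b (g b)) :=
    (measurable_condCdf _ _ hg).ennreal_ofReal
  rw [h1, Measure.prod_apply_symm hEm, lintegral_congr_ae h2, ← lintegral_indicator hs, ← hmap,
    lintegral_map (hcm.indicator hs) hBm]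

end Whitened

/-! ### From measures to integrals of densities -/

section Densities

lemma fB_eq (k q : ℕ) (b : ℝ) : fB (k + 1) (q + 2) b =
    ((k + 1 + q + 1).factorial / ((k + 1).factorial * q.factorial) : ℝ) *
      (b ^ (k + 1) * (1 - b) ^ q) := by
  have h1 : Real.Gamma (((k + 1 : ℕ) : ℝ) + 1) = (k + 1).factorial := Real.Gamma_nat_eq_factorial _
  have h2 : ((q + 2 : ℕ) : ℝ) - 1 = (q : ℝ) + 1 := by push_cast; ring
  have h3 : ((k + 1 : ℕ) : ℝ) + 1 + ((q : ℝ) + 1) = ((k + 1 + q + 1 : ℕ) : ℝ) + 1 := by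
    push_cast; ring
  rw [fB, ProbabilityTheory.beta, h2, h3, h1, Real.Gamma_nat_eq_factorial,
    Real.Gamma_nat_eq_factorial, Nat.add_sub_cancel]
  field_simp

lemma fB_nonneg (k q : ℕ) {b : ℝ} (hb : b ∈ Set.Ioo (0 : ℝ) 1) : 0 ≤ fB (k + 1) (q + 2) b := by
  have h0 := hb.1.le
  have h1 : 0 ≤ 1 - b := by linarith [hb.2]
  rw [fB_eq]
  positivity

lemma continuous_fB (k q : ℕ) : Continuous (fB (k + 1) (q + 2)) := by
  rw [show fB (k + 1) (q + 2) = _ from funext (fB_eq k q)]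
  fun_prop

/-- Passage from extended nonnegative integrals to Bochner integrals; nonnegativity of `h` is
required only where the beta density lives. -/
lemma toReal_lintegral_betaNat (k q : ℕ) {s : Set ℝ} (hs : MeasurableSet s) {h : ℝ → ℝ}
    (hm : Measurable h) (h0 : ∀ b ∈ s ∩ Set.Ioo 0 1, 0 ≤ h b) :
    (∫⁻ b in s, ENNReal.ofReal (h b) ∂betaNat (k + 1) q).toReal =
      ∫ b in s ∩ Set.Ioo 0 1, h b * fB (k + 1) (q + 2) b := by
  have hmes := hs.inter (measurableSet_Ioo (a := (0 : ℝ)) (b := 1))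
  have hd : betaNat (k + 1) q = (volume.restrict (Set.Ioo 0 1)).withDensity fun b =>
      ENNReal.ofReal (fB (k + 1) (q + 2) b) := by
    rw [betaNat]
    simp only [fB_eq]
  have hfm : Measurable fun b => ENNReal.ofReal (fB (k + 1) (q + 2) b) :=
    (continuous_fB k q).measurable.ennreal_ofReal
  rw [hd, setLIntegral_withDensity_eq_setLIntegral_mul _ hfm hm.ennreal_ofReal hs,
    Measure.restrict_restrict hs, integral_eq_lintegral_of_nonneg_ae]
  · congr 1
    refine setLIntegral_congr_fun hmes fun b hb => ?_
    rw [Pi.mul_apply, mul_comm, ENNReal.ofReal_mul (h0 b hb)]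
  · filter_upwards [ae_restrict_mem hmes] with b hb
    exact mul_nonneg (h0 b hb) (fB_nonneg k q hb.2)
  · exact (hm.mul (continuous_fB k q).measurable).aestronglyMeasurable

lemma toReal_betaNat (k q : ℕ) {s : Set ℝ} (hs : MeasurableSet s) :
    (betaNat (k + 1) q s).toReal = ∫ b in s ∩ Set.Ioo 0 1, fB (k + 1) (q + 2) b := by
  have h := toReal_lintegral_betaNat k q hs (h := fun _ => 1) measurable_const
    fun _ _ => zero_le_one
  simpa using h

lemma toReal_betaNat_zero_Ioi (q : ℕ) {x : ℝ} (hx : x ∈ Set.Icc (0 : ℝ) 1) :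
    (betaNat 0 q (Set.Ioi x)).toReal = (1 - x) ^ (q + 1) := by
  have hset : Set.Ioi x ∩ Set.Ioo 0 1 = Set.Ioo x 1 := by
    ext b
    simp only [Set.mem_inter_iff, Set.mem_Ioi, Set.mem_Ioo]
    exact ⟨fun h => ⟨h.1, h.2.2⟩, fun h => ⟨h.1, hx.1.trans_lt h.1, h.2⟩⟩
  have hfac : (((0 + q + 1).factorial : ℝ) / ((0 : ℕ).factorial * q.factorial)) = q + 1 := by
    rw [zero_add, Nat.factorial_succ, Nat.factorial_zero]
    push_cast
    field_simp
  have hderiv : ∀ b ∈ Set.uIcc x 1,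
      HasDerivAt (fun b : ℝ => -(1 - b) ^ (q + 1)) (((q : ℝ) + 1) * (1 - b) ^ q) b := by
    intro b _
    have h := (((hasDerivAt_id b).const_sub 1).pow (q + 1)).neg
    refine h.congr_deriv ?_
    simp
  have hint : IntervalIntegrable (fun b : ℝ => ((q : ℝ) + 1) * (1 - b) ^ q) volume x 1 :=
    Continuous.intervalIntegrable (by fun_prop) _ _
  have h := intervalIntegral.integral_eq_sub_of_hasDerivAt hderiv hint
  rw [intervalIntegral.integral_of_le hx.2, integral_Ioc_eq_integral_Ioo] at h
  rw [betaNat, withDensity_apply _ measurableSet_Ioi, Measure.restrict_restrict measurableSet_Ioi,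
    hset]
  simp only [hfac, pow_zero, one_mul]
  rw [← integral_eq_lintegral_of_nonneg_ae, h]
  · simp
  · filter_upwards [ae_restrict_mem measurableSet_Ioo] with b hb
    have : 0 ≤ 1 - b := by linarith [hb.2]
    simp only [Pi.zero_apply]
    positivity
  · exact Continuous.aestronglyMeasurable (by fun_prop)

end Densities

/-! ### Transfer to the radar data -/

section Transfer

set_option linter.unusedSectionVars false

variable {ι κ τ : Type*} [Fintype ι] [DecidableEq ι] [Fintype κ] [DecidableEq κ] [Fintype τ]
  [DecidableEq τ]

lemma unitDoppler_unit {ω : κ → ℂ} (hω : 0 < sqNorm ω) :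
    star (unitDoppler τ ω) ⬝ᵥ unitDoppler τ ω = 1 := by
  have hs : (Real.sqrt (sqNorm ω) : ℂ) ≠ 0 := by
    exact_mod_cast (Real.sqrt_pos.2 hω).ne'
  have hs2 : (sqNorm ω : ℂ) = (Real.sqrt (sqNorm ω) : ℂ) ^ 2 := by
    exact_mod_cast (Real.sq_sqrt hω.le).symm
  have h : star (unitDoppler τ ω) = Sum.elim (((Real.sqrt (sqNorm ω))⁻¹ : ℂ) • ω) 0 := by
    ext j
    cases j <;> simp [unitDoppler]
  rw [h, unitDoppler, sumElim_dotProduct_sumElim, zero_dotProduct, add_zero, smul_dotProduct,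
    dotProduct_smul, dotProduct_star_eq_sqNorm, hs2]
  simp only [smul_eq_mul]
  field_simp

/-- The unit Doppler vector vanishes on training columns, so the shift leaves the training block
untouched. -/
lemma shiftRow_eq_fromCols (i₀ : ι) (m : ℂ) (ω : κ → ℂ) (w : ι → κ ⊕ τ → ℂ) :
    shiftRow i₀ m (unitDoppler τ ω) w =
      fromCols (Matrix.of fun i k => shiftRow i₀ m (unitDoppler τ ω) w i (Sum.inl k))
        (Matrix.of fun i l => w i (Sum.inr l)) := by
  ext i j
  cases j with
  | inl k => simp
  | inr l =>
    rw [fromCols_apply_inr, shiftRow, of_apply, of_apply]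
    by_cases h : i = i₀
    · subst h
      simp [unitDoppler]
    · rw [Function.update_of_ne h]

/-- Apply almost sure independence to the rows restricted to the training coordinates, a surjective
projection. -/
lemma ae_isUnit_scm (hcard : Fintype.card ι ≤ Fintype.card τ) :
    ∀ᵐ w ∂rowsLaw ι (κ ⊕ τ), IsUnit (scm (Matrix.of fun (i : ι) (l : τ) => w i (Sum.inr l))) := by
  filter_upwards [ae_linearIndependent (ι := ι)
    (LinearMap.funLeft ℂ ℂ (Sum.inr : τ → κ ⊕ τ))
    (LinearMap.funLeft_surjective_of_injective _ _ _ Sum.inr_injective) hcard] with w hw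
  exact isUnit_mul_conjTranspose_of_linearIndependent
    (V := Matrix.of fun (i : ι) (l : τ) => w i (Sum.inr l)) hw

lemma ae_shiftRow (hcard : Fintype.card ι ≤ Fintype.card τ) (i₀ : ι) (m : ℂ) {ω : κ → ℂ}
    (hω : 0 < sqNorm ω) :
    ∀ᵐ w ∂rowsLaw ι (κ ⊕ τ),
      IsUnit (shiftRow i₀ m (unitDoppler τ ω) w * (shiftRow i₀ m (unitDoppler τ ω) w)ᴴ) ∧
      0 < residual (shiftRow i₀ m (unitDoppler τ ω) w) (unitDoppler τ ω) ∧
      0 ≤ raoForm (shiftRow i₀ m (unitDoppler τ ω) w) (Pi.single i₀ 1) (unitDoppler τ ω) := by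
  filter_upwards [ae_isUnit_scm (ι := ι) (κ := κ) hcard] with w hw
  have h := statistics_eq (a := Pi.single i₀ 1) (by simp) hω
    (Matrix.of fun i k => shiftRow i₀ m (unitDoppler τ ω) w i (Sum.inl k)) hw
  rw [← shiftRow_eq_fromCols] at h
  refine ⟨?_, h.2.1, h.2.2.1⟩
  rw [shiftRow_eq_fromCols, fromCols_mul_conjTranspose]
  exact ((posDef_scm hw).posSemidef_add (Matrix.posSemidef_self_mul_conjTranspose _)).isUnit

/-- The signal `ξ a ωᵀ` becomes `ξ c e_{i₀} ωᵀ`, and `ωᵀ` is `√(ωᵀω*)` times the test part of `e†`.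
This explains the shift amplitude. -/
lemma mul_fromCols_eq_shiftRow {A : Matrix ι ι ℂ} {a : ι → ℂ} {i₀ : ι} {c : ℝ}
    (hAa : A *ᵥ a = (c : ℂ) • Pi.single i₀ 1) {ω : κ → ℂ} (hω : 0 < sqNorm ω) (ξ : ℂ)
    (w : κ ⊕ τ → ι → ℂ) :
    A * fromCols (ξ • vecMulVec a ω + Matrix.of fun i k => w (Sum.inl k) i)
        (Matrix.of fun i l => w (Sum.inr l) i) =
      shiftRow i₀ (ξ * c * Real.sqrt (sqNorm ω)) (unitDoppler τ ω)
        (fun i j => (A *ᵥ w j) i) := by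
  have hs : (Real.sqrt (sqNorm ω) : ℂ) ≠ 0 := by
    exact_mod_cast (Real.sqrt_pos.2 hω).ne'
  ext i j
  cases j with
  | inl k =>
    have h1 : (A * fromCols (ξ • vecMulVec a ω + Matrix.of fun i k => w (Sum.inl k) i)
        (Matrix.of fun i l => w (Sum.inr l) i)) i (Sum.inl k) =
        ξ * (A *ᵥ a) i * ω k + (A *ᵥ w (Sum.inl k)) i := by
      simp only [Matrix.mul_apply, fromCols_apply_inl, Matrix.add_apply, Matrix.smul_apply,
        vecMulVec_apply, of_apply, smul_eq_mul, mulVec, dotProduct, mul_add,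
        Finset.sum_add_distrib, Finset.mul_sum, Finset.sum_mul]
      congr 1
      exact Finset.sum_congr rfl fun _ _ => by ring
    rw [h1, hAa, shiftRow, of_apply]
    by_cases h : i = i₀
    · subst h
      simp only [Pi.smul_apply, Pi.single_eq_same, smul_eq_mul, Function.update_self, Pi.add_apply,
        Pi.star_apply, unitDoppler, Sum.elim_inl, star_mul', Complex.star_def,
        map_inv₀, Complex.conj_ofReal, Complex.conj_conj]
      field_simp
      ring
    · rw [Function.update_of_ne h]
      simp [h]
  | inr l =>
    rw [shiftRow_eq_fromCols, fromCols_apply_inr, of_apply]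
    simp [Matrix.mul_apply, mulVec, dotProduct]

/-- The radar statistics are statistics of independent standard Gaussian rows, one of them
shifted. -/
lemma exists_whitened_statistics {R : Matrix ι ι ℂ} (hR : R.PosDef) {a : ι → ℂ} (ha : a ≠ 0)
    (i₀ : ι) {ω : κ → ℂ} (hω : 0 < sqNorm ω) (hcard : Fintype.card ι ≤ Fintype.card τ) (ξ : ℂ) :
    ∃ (m : ℂ) (Θ : (κ ⊕ τ → ι → ℂ) → ι → κ ⊕ τ → ℂ),
      ‖m‖ ^ 2 = ‖ξ‖ ^ 2 * sqNorm ω * (star a ⬝ᵥ (R⁻¹ *ᵥ a)).re ∧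
      MeasurePreserving Θ (Measure.pi fun _ => complexGaussian R) (rowsLaw ι (κ ⊕ τ)) ∧
      ∀ᵐ w ∂(Measure.pi fun _ : κ ⊕ τ => complexGaussian R),
        IsUnit (scm (Matrix.of fun i l => w (Sum.inr l) i)) ∧
        raoStatistic a ω (ξ • vecMulVec a ω + Matrix.of fun i k => w (Sum.inl k) i)
            (Matrix.of fun i l => w (Sum.inr l) i) =
          raoForm (shiftRow i₀ m (unitDoppler τ ω) (Θ w)) (Pi.single i₀ 1) (unitDoppler τ ω) ∧
        lambdaTwo a ω (ξ • vecMulVec a ω + Matrix.of fun i k => w (Sum.inl k) i)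
            (Matrix.of fun i l => w (Sum.inr l) i) =
          raoForm (shiftRow i₀ m (unitDoppler τ ω) (Θ w)) (Pi.single i₀ 1) (unitDoppler τ ω) /
            residual (shiftRow i₀ m (unitDoppler τ ω) (Θ w)) (unitDoppler τ ω) ∧
        scriptB a ω (ξ • vecMulVec a ω + Matrix.of fun i k => w (Sum.inl k) i)
            (Matrix.of fun i l => w (Sum.inr l) i) =
          if raoForm (shiftRow i₀ m (unitDoppler τ ω) (Θ w)) (Pi.single i₀ 1)
            (unitDoppler τ ω) = 0 then 0 else
          residual (shiftRow i₀ m (unitDoppler τ ω) (Θ w)) (unitDoppler τ ω) +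
          raoForm (shiftRow i₀ m (unitDoppler τ ω) (Θ w)) (Pi.single i₀ 1) (unitDoppler τ ω) := by
  obtain ⟨A, hA, hAR, c, hc, hAa, hc2⟩ := exists_whitening hR ha i₀
  have hmp := measurePreserving_whiten (J := κ ⊕ τ) hA hAR
  refine ⟨ξ * c * Real.sqrt (sqNorm ω), fun w i j => (A *ᵥ w j) i, ?_, hmp, ?_⟩
  · rw [norm_mul, norm_mul, Complex.norm_real, Complex.norm_real, mul_pow, mul_pow,
      Real.norm_eq_abs, Real.norm_eq_abs, sq_abs, sq_abs, Real.sq_sqrt hω.le, hc2]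
    ring
  · filter_upwards [hmp.quasiMeasurePreserving.ae (ae_isUnit_scm (ι := ι) (κ := κ) hcard)] with w hw
    have hY : (Matrix.of fun (i : ι) (l : τ) => (A *ᵥ w (Sum.inr l)) i) =
        A * Matrix.of fun i l => w (Sum.inr l) i := by
      ext i l
      simp [Matrix.mul_apply, mulVec, dotProduct]
    -- The whitened sample covariance is `A S A†`; a determinant factor of a unit is a unit, so `S`
    -- is invertible as well.
    rw [hY, scm, conjTranspose_mul, Matrix.isUnit_iff_isUnit_det, ← Matrix.mul_assoc, det_mul,
      Matrix.mul_assoc A, det_mul] at hw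
    have hu : IsUnit (scm (Matrix.of fun (i : ι) (l : τ) => w (Sum.inr l) i)) :=
      (Matrix.isUnit_iff_isUnit_det _).2
        (isUnit_of_mul_isUnit_right (isUnit_of_mul_isUnit_left hw))
    have hst := statistics_eq ha hω
      (ξ • vecMulVec a ω + Matrix.of fun i k => w (Sum.inl k) i) hu
    have hforms := forms_mul_left hA
      (fromCols (ξ • vecMulVec a ω + Matrix.of fun i k => w (Sum.inl k) i)
        (Matrix.of fun i l => w (Sum.inr l) i)) a (unitDoppler τ ω)
    rw [mul_fromCols_eq_shiftRow hAa hω, hAa, raoForm_smul hc] at hforms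
    rw [← hforms.1, ← hforms.2] at hst
    exact ⟨hu, hst.1, hst.2.2.2.1, hst.2.2.2.2⟩

end Transfer

/-! ### Laws of the radar statistics -/

section Laws

set_option linter.unusedSectionVars false

variable {ι κ τ : Type*} [Fintype ι] [DecidableEq ι] [Fintype κ] [DecidableEq κ] [Fintype τ]
  [DecidableEq τ]

lemma measurable_shiftRow_apply {J : Type*} [Fintype J] (i₀ : ι) (m : ℂ) (e : J → ℂ) (i : ι)
    (j : J) : Measurable fun w : ι → J → ℂ => shiftRow i₀ m e w i j := by
  simp only [shiftRow, of_apply]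
  by_cases h : i = i₀
  · subst h
    simp only [Function.update_self, Pi.add_apply]
    fun_prop
  · simp only [Function.update_of_ne h]
    fun_prop

lemma measurable_raoForm {J Ω : Type*} [Fintype J] [DecidableEq J] [MeasurableSpace Ω]
    {f : Ω → Matrix ι J ℂ} (hf : ∀ i j, Measurable fun w => f w i j) (a : ι → ℂ) (e : J → ℂ) :
    Measurable fun w => raoForm (f w) a e := by
  have h1 : Measurable fun w => crossTerm (f w) a e :=
    measurable_dotProduct (fun _ => measurable_const) (measurable_mulVec_apply
      (measurable_gram_inv_apply hf) (measurable_mulVec_apply hf fun _ => measurable_const))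
  have h2 : Measurable fun w => star a ⬝ᵥ ((f w * (f w)ᴴ)⁻¹ *ᵥ a) :=
    measurable_dotProduct (fun _ => measurable_const) (measurable_mulVec_apply
      (measurable_gram_inv_apply hf) fun _ => measurable_const)
  exact (h1.norm.pow_const 2).div (Complex.measurable_re.comp h2)

lemma measurable_residual {J Ω : Type*} [Fintype J] [DecidableEq J] [MeasurableSpace Ω]
    {f : Ω → Matrix ι J ℂ} (hf : ∀ i j, Measurable fun w => f w i j) (e : J → ℂ) :
    Measurable fun w => residual (f w) e := by
  have h1 : ∀ i, Measurable fun w => (f w *ᵥ e) i :=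
    measurable_mulVec_apply hf fun _ => measurable_const
  have h2 : Measurable fun w => star (f w *ᵥ e) ⬝ᵥ ((f w * (f w)ᴴ)⁻¹ *ᵥ (f w *ᵥ e)) :=
    measurable_dotProduct (measurable_star_apply h1) (measurable_mulVec_apply
      (measurable_gram_inv_apply hf) h1)
  exact measurable_const.sub (Complex.measurable_re.comp h2)

/-- The conditional threshold for the ratio statistic. -/
noncomputable def ratioThreshold (x b : ℝ) : ℝ := max 0 (x / (b - x))

lemma measurable_ratioThreshold (x : ℝ) : Measurable (ratioThreshold x) := by
  unfold ratioThreshold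
  fun_prop

lemma ratioThreshold_nonneg (x b : ℝ) : 0 ≤ ratioThreshold x b := le_max_left _ _

/-- With `b = r + ρ`, cross-multiplying `ρ/r > x/(b - x)` gives `(ρ - x)(ρ + r) > 0`. The clamp at
zero is inactive once `b > x`; it only keeps the threshold nonnegative for all `b`. -/
lemma lt_iff_ratioThreshold_lt {x r ρ : ℝ} (hx : 0 ≤ x) (hr : 0 < r) (hρ : 0 ≤ ρ) :
    x < ρ ↔ x < r + ρ ∧ ¬ ρ / r ≤ ratioThreshold x (r + ρ) := by
  constructor
  · intro h
    refine ⟨by linarith, not_le.2 ?_⟩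
    have h1 : 0 < r + ρ - x := by linarith
    refine max_lt (div_pos (hx.trans_lt h) hr) ?_
    rw [div_lt_div_iff₀ h1 hr]
    nlinarith
  · rintro ⟨h1, h2⟩
    have h3 := (le_max_right _ _).trans_lt (not_le.1 h2)
    rw [div_lt_div_iff₀ (by linarith) hr] at h3
    nlinarith

lemma condCdf_zero (d : ℕ) (α b : ℝ) : condCdf d α b 0 = 0 := by
  simp [condCdf]

/-- The conditional distribution function vanishes at zero, so the ratio is almost surely positive.
This discards the event on which the convention `0/0 = 0` intervenes. -/
lemma ae_raoForm_ne_zero (i₀ : ι) (m : ℂ) {ω : κ → ℂ} (hω : 0 < sqNorm ω) {k q : ℕ}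
    (hι : Fintype.card ι = q + 2) (hJ : Fintype.card (κ ⊕ τ) = k + 1 + (q + 2))
    (hcard : Fintype.card ι ≤ Fintype.card τ) :
    ∀ᵐ w ∂rowsLaw ι (κ ⊕ τ),
      raoForm (shiftRow i₀ m (unitDoppler τ ω) w) (Pi.single i₀ 1) (unitDoppler τ ω) ≠ 0 := by
  have h := measure_lossFactor_ratio i₀ m (unitDoppler_unit (τ := τ) hω) hι hJ
    ((ae_shiftRow hcard i₀ m hω).mono fun _ h => h.1) MeasurableSet.univ
    (g := fun _ => 0) measurable_const fun _ => le_rfl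
  simp only [condCdf_zero, ENNReal.ofReal_zero, lintegral_zero, Set.mem_univ, true_and] at h
  filter_upwards [measure_eq_zero_iff_ae_notMem.1 h] with w hw h0
  exact hw (by simp [h0])

variable {R : Matrix ι ι ℂ} {a : ι → ℂ} {ω : κ → ℂ}

lemma measure_raoStatistic_noise (hR : R.PosDef) (ha : a ≠ 0) (i₀ : ι) (hω : 0 < sqNorm ω)
    (hcard : Fintype.card ι ≤ Fintype.card τ) {q : ℕ} (hJ : Fintype.card (κ ⊕ τ) = q + 2)
    {s : Set ℝ} (hs : MeasurableSet s) :
    (Measure.pi fun _ : κ ⊕ τ => complexGaussian R)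
      {w | raoStatistic a ω ((0 : ℂ) • vecMulVec a ω + Matrix.of fun i k => w (Sum.inl k) i)
        (Matrix.of fun i l => w (Sum.inr l) i) ∈ s} = betaNat 0 q s := by
  obtain ⟨m, Θ, hm, hΘ, hae⟩ := exists_whitened_statistics hR ha i₀ hω hcard 0
  -- Without a target the shift disappears and the law of unshifted Gaussian rows applies.
  have hm0 : m = 0 := by
    rw [norm_zero, zero_pow two_ne_zero, zero_mul, zero_mul] at hm
    exact norm_eq_zero.1 (pow_eq_zero_iff two_ne_zero |>.1 hm)
  have hshift : ∀ w, shiftRow i₀ m (unitDoppler τ ω) w = Matrix.of w := by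
    intro w
    rw [shiftRow, hm0, zero_smul, add_zero, Function.update_eq_self]
  simp only [hshift] at hae
  have hcard' : Fintype.card ι ≤ Fintype.card (κ ⊕ τ) := by
    rw [Fintype.card_sum]; omega
  rw [← measure_raoForm (unitDoppler_unit hω) i₀ hcard' hJ hs]
  refine Eq.trans (measure_congr ?_) (hΘ.measure_preimage
    ((measurable_raoForm measurable_entry _ _) hs).nullMeasurableSet)
  filter_upwards [hae] with w hw
  refine propext ?_
  change _ ∈ s ↔ _ ∈ s
  rw [hw.2.1]

lemma measure_scriptB_lambdaTwo (hR : R.PosDef) (ha : a ≠ 0) (i₀ : ι) (hω : 0 < sqNorm ω)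
    (hcard : Fintype.card ι ≤ Fintype.card τ) {k q : ℕ}
    (hι : Fintype.card ι = q + 2) (hJ : Fintype.card (κ ⊕ τ) = k + 1 + (q + 2)) (ξ : ℂ)
    {s : Set ℝ} (hs : MeasurableSet s) {γ : ℝ} (hγ : 0 ≤ γ) :
    (Measure.pi fun _ : κ ⊕ τ => complexGaussian R)
      {w | scriptB a ω (ξ • vecMulVec a ω + Matrix.of fun i k => w (Sum.inl k) i)
        (Matrix.of fun i l => w (Sum.inr l) i) ∈ s} = betaNat (k + 1) q s ∧
    (Measure.pi fun _ : κ ⊕ τ => complexGaussian R)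
      {w | scriptB a ω (ξ • vecMulVec a ω + Matrix.of fun i k => w (Sum.inl k) i)
          (Matrix.of fun i l => w (Sum.inr l) i) ∈ s ∧
        lambdaTwo a ω (ξ • vecMulVec a ω + Matrix.of fun i k => w (Sum.inl k) i)
          (Matrix.of fun i l => w (Sum.inr l) i) ≤ γ} =
      ∫⁻ b in s, ENNReal.ofReal (condCdf (k + 1)
        (‖ξ‖ ^ 2 * sqNorm ω * (star a ⬝ᵥ (R⁻¹ *ᵥ a)).re) b γ) ∂betaNat (k + 1) q := by
  obtain ⟨m, Θ, hm, hΘ, hae⟩ := exists_whitened_statistics hR ha i₀ hω hcard ξ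
  have hX := (ae_shiftRow (κ := κ) hcard i₀ m hω).mono fun _ h => h.1
  have hrao := measurable_raoForm (measurable_shiftRow_apply i₀ m (unitDoppler τ ω))
    (Pi.single i₀ 1) (unitDoppler τ ω)
  have hres := measurable_residual (measurable_shiftRow_apply i₀ m (unitDoppler τ ω))
    (unitDoppler τ ω)
  have hne := hΘ.quasiMeasurePreserving.ae (ae_raoForm_ne_zero (κ := κ) i₀ m hω hι hJ hcard)
  constructor
  · rw [← measure_lossFactor i₀ m (unitDoppler_unit hω) hι hJ hX hs]
    refine Eq.trans (measure_congr ?_)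
      (hΘ.measure_preimage ((hres.add hrao) hs).nullMeasurableSet)
    filter_upwards [hae, hne] with w hw hw0
    refine propext ?_
    change _ ∈ s ↔ _ ∈ s
    rw [hw.2.2.2, if_neg hw0]
  · have hset : MeasurableSet {w | residual (shiftRow i₀ m (unitDoppler τ ω) w) (unitDoppler τ ω) +
        raoForm (shiftRow i₀ m (unitDoppler τ ω) w) (Pi.single i₀ 1) (unitDoppler τ ω) ∈ s ∧
      raoForm (shiftRow i₀ m (unitDoppler τ ω) w) (Pi.single i₀ 1) (unitDoppler τ ω) /
        residual (shiftRow i₀ m (unitDoppler τ ω) w) (unitDoppler τ ω) ≤ γ} :=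
      ((hres.add hrao) hs).inter (measurableSet_le (hrao.div hres) measurable_const)
    rw [← hm, ← measure_lossFactor_ratio i₀ m (unitDoppler_unit hω) hι hJ hX hs
      (g := fun _ => γ) measurable_const fun _ => hγ, ← hΘ.measure_preimage hset.nullMeasurableSet]
    refine measure_congr ?_
    filter_upwards [hae, hne] with w hw hw0
    refine propext ?_
    change (_ ∈ s ∧ _ ≤ γ) ↔ (_ ∈ s ∧ _ ≤ γ)
    rw [hw.2.2.2, hw.2.2.1, if_neg hw0]

/-- The event that the loss factor exceeds `x` is split by the ratio threshold. The additive form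
avoids subtraction of extended nonnegative reals. -/
lemma measure_raoStatistic_add (hR : R.PosDef) (ha : a ≠ 0) (i₀ : ι) (hω : 0 < sqNorm ω)
    (hcard : Fintype.card ι ≤ Fintype.card τ) {k q : ℕ}
    (hι : Fintype.card ι = q + 2) (hJ : Fintype.card (κ ⊕ τ) = k + 1 + (q + 2)) (ξ : ℂ)
    {x : ℝ} (hx : 0 ≤ x) :
    ∫⁻ b in Set.Ioi x, ENNReal.ofReal (condCdf (k + 1)
        (‖ξ‖ ^ 2 * sqNorm ω * (star a ⬝ᵥ (R⁻¹ *ᵥ a)).re) b (ratioThreshold x b))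
        ∂betaNat (k + 1) q +
      (Measure.pi fun _ : κ ⊕ τ => complexGaussian R)
        {w | x < raoStatistic a ω (ξ • vecMulVec a ω + Matrix.of fun i k => w (Sum.inl k) i)
          (Matrix.of fun i l => w (Sum.inr l) i)} = betaNat (k + 1) q (Set.Ioi x) := by
  obtain ⟨m, Θ, hm, hΘ, hae⟩ := exists_whitened_statistics hR ha i₀ hω hcard ξ
  have hX := ae_shiftRow (κ := κ) hcard i₀ m hω
  have hrao := measurable_raoForm (measurable_shiftRow_apply i₀ m (unitDoppler τ ω))
    (Pi.single i₀ 1) (unitDoppler τ ω)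
  have hres := measurable_residual (measurable_shiftRow_apply i₀ m (unitDoppler τ ω))
    (unitDoppler τ ω)
  rw [← hm, ← measure_lossFactor_ratio i₀ m (unitDoppler_unit hω) hι hJ (hX.mono fun _ h => h.1)
      measurableSet_Ioi (measurable_ratioThreshold x) (ratioThreshold_nonneg x),
    ← measure_lossFactor i₀ m (unitDoppler_unit hω) hι hJ (hX.mono fun _ h => h.1)
      measurableSet_Ioi]
  have hset : MeasurableSet {w |
      raoForm (shiftRow i₀ m (unitDoppler τ ω) w) (Pi.single i₀ 1) (unitDoppler τ ω) /
        residual (shiftRow i₀ m (unitDoppler τ ω) w) (unitDoppler τ ω) ≤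
      ratioThreshold x (residual (shiftRow i₀ m (unitDoppler τ ω) w) (unitDoppler τ ω) +
        raoForm (shiftRow i₀ m (unitDoppler τ ω) w) (Pi.single i₀ 1) (unitDoppler τ ω))} :=
    measurableSet_le (hrao.div hres) ((measurable_ratioThreshold x).comp (hres.add hrao))
  rw [← measure_inter_add_sdiff {w |
    residual (shiftRow i₀ m (unitDoppler τ ω) w) (unitDoppler τ ω) +
      raoForm (shiftRow i₀ m (unitDoppler τ ω) w) (Pi.single i₀ 1) (unitDoppler τ ω) ∈
        Set.Ioi x} hset]
  congr 1
  have h1 : (Measure.pi fun _ : κ ⊕ τ => complexGaussian R)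
      {w | x < raoStatistic a ω (ξ • vecMulVec a ω + Matrix.of fun i k => w (Sum.inl k) i)
        (Matrix.of fun i l => w (Sum.inr l) i)} = rowsLaw ι (κ ⊕ τ)
      {w | x < raoForm (shiftRow i₀ m (unitDoppler τ ω) w) (Pi.single i₀ 1)
        (unitDoppler τ ω)} := by
    rw [← hΘ.measure_preimage (measurableSet_lt measurable_const hrao).nullMeasurableSet]
    refine measure_congr ?_
    filter_upwards [hae] with w hw
    refine propext ?_
    change x < _ ↔ x < _
    rw [hw.2.1]
  rw [h1]
  refine measure_congr ?_
  filter_upwards [hX] with w hw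
  exact propext (lt_iff_ratioThreshold_lt hx hw.2.1 hw.2.2)

end Laws

/-! ### Steering and Doppler vectors of the radar. -/

section Radar

lemma norm_phase (x : ℝ) : ‖phase x‖ = 1 := by
  rw [phase, show (2 * Real.pi * x * Complex.I : ℂ) = ((2 * Real.pi * x : ℝ) : ℂ) * Complex.I by
    push_cast; ring]
  exact Complex.norm_exp_ofReal_mul_I _

lemma steering_ne_zero {M N : ℕ} (hM : 0 < M) (hN : 0 < N) (p : Radar) (t : Target) :
    steering M N p t ≠ 0 := by
  intro h
  have h1 := congrArg norm (congrFun h (⟨0, hM⟩, ⟨0, hN⟩))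
  simp [steering, txVec, txAngleVec, txRangeVec, rxVec, norm_phase] at h1

lemma sqNorm_dopplerVec (K : ℕ) (p : Radar) (t : Target) : sqNorm (dopplerVec K p t) = K := by
  simp [sqNorm, dotProduct, dopplerVec, Complex.mul_conj, Complex.normSq_eq_norm_sq, norm_phase]

end Radar

/-- On `(x, 1)` the clamp in the threshold is inactive, and `0 ≤ condCdf ≤ 1` makes the product
integrable by comparison with the beta density. -/
lemma integral_sub_condCdf {k q : ℕ} {α : ℝ} (hα : 0 ≤ α) {x : ℝ} (hx : x ∈ Set.Icc (0 : ℝ) 1) :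
    (∫ b in Set.Ioi x ∩ Set.Ioo 0 1, fB (k + 1) (q + 2) b) -
      ∫ b in Set.Ioi x ∩ Set.Ioo 0 1,
        condCdf (k + 1) α b (ratioThreshold x b) * fB (k + 1) (q + 2) b =
      ∫ b in x..1, (1 - condCdf (k + 1) α b (x / (b - x))) * fB (k + 1) (q + 2) b := by
  have hset : Set.Ioi x ∩ Set.Ioo 0 1 = Set.Ioo x 1 := by
    ext b
    simp only [Set.mem_inter_iff, Set.mem_Ioi, Set.mem_Ioo]
    exact ⟨fun h => ⟨h.1, h.2.2⟩, fun h => ⟨h.1, hx.1.trans_lt h.1, h.2⟩⟩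
  have hf : IntegrableOn (fB (k + 1) (q + 2)) (Set.Ioo x 1) :=
    (continuous_fB k q).integrableOn_Icc.mono_set Set.Ioo_subset_Icc_self
  have hcm : Measurable fun b => condCdf (k + 1) α b (ratioThreshold x b) :=
    measurable_condCdf _ _ (measurable_ratioThreshold x)
  have hg : IntegrableOn (fun b => condCdf (k + 1) α b (ratioThreshold x b) *
      fB (k + 1) (q + 2) b) (Set.Ioo x 1) := by
    refine Integrable.mono' hf (hcm.mul (continuous_fB k q).measurable).aestronglyMeasurable ?_
    filter_upwards [ae_restrict_mem measurableSet_Ioo] with b hb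
    have hb0 : 0 < b := hx.1.trans_lt hb.1
    have hfb := fB_nonneg k q (b := b) ⟨hb0, hb.2⟩
    rw [Real.norm_eq_abs, abs_of_nonneg (mul_nonneg
      (condCdf_nonneg _ hα hb0.le (ratioThreshold_nonneg x b)) hfb)]
    exact mul_le_of_le_one_left hfb (condCdf_le_one k hα hb0.le (ratioThreshold_nonneg x b))
  rw [hset, ← integral_sub hf hg, intervalIntegral.integral_of_le hx.2,
    integral_Ioc_eq_integral_Ioo]
  refine setIntegral_congr_fun measurableSet_Ioo fun b hb => ?_
  have h : ratioThreshold x b = x / (b - x) :=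
    max_eq_right (div_nonneg hx.1 (by linarith [hb.1]))
  simp only [h]
  ring

end FDAMIMO

theorem mainTheorem5 (M N K L : ℕ) (hM : 0 < M) (hN : 0 < N) (hLK : M * N < L * K)
    (p : FDAMIMO.Radar) (t : FDAMIMO.Target) :
    -- decomposition of the statistic, for all data with invertible sample covariance matrix
    (∀ (Z : Matrix (Fin M × Fin N) (Fin K) ℂ) (Y : Matrix (Fin M × Fin N) (Fin L × Fin K) ℂ),
      IsUnit (FDAMIMO.scm Y) →
      FDAMIMO.raoStatistic (FDAMIMO.steering M N p t) (FDAMIMO.dopplerVec K p t) Z Y =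
        FDAMIMO.scriptB (FDAMIMO.steering M N p t) (FDAMIMO.dopplerVec K p t) Z Y *
          FDAMIMO.lambdaTwo (FDAMIMO.steering M N p t) (FDAMIMO.dopplerVec K p t) Z Y /
          (1 + FDAMIMO.lambdaTwo (FDAMIMO.steering M N p t) (FDAMIMO.dopplerVec K p t) Z Y)) ∧
    -- the sample covariance matrix is almost surely invertible
    (∀ R : Matrix (Fin M × Fin N) (Fin M × Fin N) ℂ, R.PosDef →
      ∀ᵐ w ∂(FDAMIMO.noiseLaw K L R), IsUnit (FDAMIMO.scm (FDAMIMO.trainingData w))) ∧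
    -- CFAR with respect to the noise covariance matrix
    (∀ R R' : Matrix (Fin M × Fin N) (Fin M × Fin N) ℂ, R.PosDef → R'.PosDef → ∀ lam : ℝ,
      FDAMIMO.pfa K L p t R lam = FDAMIMO.pfa K L p t R' lam) ∧
    -- false alarm probability
    (∀ R : Matrix (Fin M × Fin N) (Fin M × Fin N) ℂ, R.PosDef → ∀ lam ∈ Set.Icc (0 : ℝ) 1,
      FDAMIMO.pfa K L p t R lam = (1 - lam) ^ ((L + 1) * K - 1)) ∧
    (2 ≤ M * N → ∀ R : Matrix (Fin M × Fin N) (Fin M × Fin N) ℂ, R.PosDef → ∀ ξ : ℂ,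
      -- `f_ℬ` is the density of `ℬ`
      (∀ A : Set ℝ, MeasurableSet A →
        (FDAMIMO.noiseLaw K L R).real
          {w | FDAMIMO.scriptB (FDAMIMO.steering M N p t) (FDAMIMO.dopplerVec K p t)
            (FDAMIMO.testData p t ξ w) (FDAMIMO.trainingData w) ∈ A} =
          ∫ b in A ∩ Set.Ioo 0 1, FDAMIMO.fB (FDAMIMO.dof M N K L) (M * N) b) ∧
      -- `P_{H₁,ℬ}` is the conditional distribution function of `Λ''` given `ℬ`
      (∀ A : Set ℝ, MeasurableSet A → ∀ γ : ℝ, 0 ≤ γ →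
        (FDAMIMO.noiseLaw K L R).real
          {w | FDAMIMO.scriptB (FDAMIMO.steering M N p t) (FDAMIMO.dopplerVec K p t)
              (FDAMIMO.testData p t ξ w) (FDAMIMO.trainingData w) ∈ A ∧
            FDAMIMO.lambdaTwo (FDAMIMO.steering M N p t) (FDAMIMO.dopplerVec K p t)
              (FDAMIMO.testData p t ξ w) (FDAMIMO.trainingData w) ≤ γ} =
          ∫ b in A ∩ Set.Ioo 0 1,
            FDAMIMO.condCdf (FDAMIMO.dof M N K L) (FDAMIMO.alpha K p t R ξ) b γ *
              FDAMIMO.fB (FDAMIMO.dof M N K L) (M * N) b) ∧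
      -- detection probability
      (∀ lam ∈ Set.Icc (0 : ℝ) 1,
        FDAMIMO.pd K L p t R ξ lam =
          ∫ b in lam..1,
            (1 - FDAMIMO.condCdf (FDAMIMO.dof M N K L) (FDAMIMO.alpha K p t R ξ) b
                (lam / (b - lam))) *
              FDAMIMO.fB (FDAMIMO.dof M N K L) (M * N) b)) := by
  have ha := FDAMIMO.steering_ne_zero hM hN p t
  have hK : 0 < K := by
    rcases Nat.eq_zero_or_pos K with h | h
    · simp [h] at hLK
    · exact h
  have hω : 0 < FDAMIMO.sqNorm (FDAMIMO.dopplerVec K p t) := by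
    rw [FDAMIMO.sqNorm_dopplerVec]
    exact_mod_cast hK
  have hι : Fintype.card (Fin M × Fin N) = M * N := by simp
  have hcard : Fintype.card (Fin M × Fin N) ≤ Fintype.card (Fin L × Fin K) := by
    simpa using hLK.le
  have hJ : Fintype.card (Fin K ⊕ (Fin L × Fin K)) = (L + 1) * K := by
    simp only [Fintype.card_sum, Fintype.card_prod, Fintype.card_fin]
    ring
  have hMN : 0 < M * N := Nat.mul_pos hM hN
  have hLK' : (L + 1) * K = L * K + K := by ring
  have i₀ : Fin M × Fin N := (⟨0, hM⟩, ⟨0, hN⟩)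
  -- The right-hand side does not involve the covariance, so both CFAR and the closed form follow.
  -- The truncated subtraction is exact since `LK > MN ≥ 1`.
  have hpfa : ∀ R : Matrix (Fin M × Fin N) (Fin M × Fin N) ℂ, R.PosDef → ∀ lam : ℝ,
      FDAMIMO.pfa K L p t R lam =
        (FDAMIMO.betaNat 0 ((L + 1) * K - 2) (Set.Ioi lam)).toReal := by
    intro R hR lam
    exact congrArg ENNReal.toReal (FDAMIMO.measure_raoStatistic_noise hR ha i₀ hω hcard
      (q := (L + 1) * K - 2) (by omega) measurableSet_Ioi)
  refine ⟨?_, ?_, ?_, ?_, ?_⟩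
  · intro Z Y hY
    obtain ⟨h1, h2, h3, h4, h5⟩ := FDAMIMO.statistics_eq ha hω Z hY
    rw [h1, h4, h5]
    -- On the degenerate event both sides vanish; otherwise the identity is `(r + ρ)(ρ/r)/(1 + ρ/r)
    -- = ρ`.
    split_ifs with h
    · simp [h]
    · field_simp
  · intro R hR
    obtain ⟨m, Θ, -, -, hae⟩ := FDAMIMO.exists_whitened_statistics hR ha i₀ hω hcard 0
    exact hae.mono fun w hw => hw.1
  · intro R R' hR hR' lam
    rw [hpfa R hR, hpfa R' hR']
  · intro R hR lam hlam
    rw [hpfa R hR, FDAMIMO.toReal_betaNat_zero_Ioi _ hlam]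
    congr 1
    omega
  · intro h2 R hR ξ
    obtain ⟨q, hq⟩ := Nat.exists_eq_add_of_le' h2
    obtain ⟨k, hk⟩ : ∃ k, FDAMIMO.dof M N K L = k + 1 :=
      Nat.exists_eq_succ_of_ne_zero (by unfold FDAMIMO.dof; omega)
    have hι' : Fintype.card (Fin M × Fin N) = q + 2 := hι.trans hq
    have hJ' : Fintype.card (Fin K ⊕ (Fin L × Fin K)) = k + 1 + (q + 2) := by
      rw [hJ, ← hk, ← hq, FDAMIMO.dof]
      omega
    have hα : 0 ≤ FDAMIMO.alpha K p t R ξ := by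
      obtain ⟨m, Θ, hm, -⟩ := FDAMIMO.exists_whitened_statistics hR ha i₀ hω hcard ξ
      exact (sq_nonneg ‖m‖).trans hm.le
    rw [hk, hq]
    refine ⟨fun A hA => ?_, fun A hA γ hγ => ?_, fun lam hlam => ?_⟩
    · rw [← FDAMIMO.toReal_betaNat k q hA]
      exact congrArg ENNReal.toReal (FDAMIMO.measure_scriptB_lambdaTwo hR ha i₀ hω hcard hι' hJ' ξ
        hA le_rfl).1
    · rw [← FDAMIMO.toReal_lintegral_betaNat k q hA (FDAMIMO.measurable_condCdf _ _
        measurable_const) fun b hb => FDAMIMO.condCdf_nonneg _ hα hb.2.1.le hγ]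
      exact congrArg ENNReal.toReal (FDAMIMO.measure_scriptB_lambdaTwo hR ha i₀ hω hcard hι' hJ' ξ
        hA hγ).2
    · have h : ∫⁻ b in Set.Ioi lam, ENNReal.ofReal (FDAMIMO.condCdf (k + 1)
            (FDAMIMO.alpha K p t R ξ) b (FDAMIMO.ratioThreshold lam b)) ∂FDAMIMO.betaNat (k + 1) q +
          FDAMIMO.noiseLaw K L R {w | lam < FDAMIMO.raoStatistic (FDAMIMO.steering M N p t)
            (FDAMIMO.dopplerVec K p t) (FDAMIMO.testData p t ξ w) (FDAMIMO.trainingData w)} =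
          FDAMIMO.betaNat (k + 1) q (Set.Ioi lam) :=
        FDAMIMO.measure_raoStatistic_add hR ha i₀ hω hcard hι' hJ' ξ hlam.1
      -- Finiteness is borrowed from the noise law: this mass is the probability that `ℬ > lam`.
      have htop : FDAMIMO.betaNat (k + 1) q (Set.Ioi lam) ≠ ⊤ := by
        rw [← (FDAMIMO.measure_scriptB_lambdaTwo hR ha i₀ hω hcard hι' hJ' ξ
          (measurableSet_Ioi (a := lam)) le_rfl).1]
        obtain ⟨A, hA, hAR, -⟩ := FDAMIMO.exists_whitening hR ha i₀
        have := FDAMIMO.isProbabilityMeasure_complexGaussian hA hAR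
        exact measure_ne_top _ _
      rw [← h, ENNReal.add_ne_top] at htop
      have h' := congrArg ENNReal.toReal h
      rw [ENNReal.toReal_add htop.1 htop.2, FDAMIMO.toReal_betaNat k q measurableSet_Ioi,
        FDAMIMO.toReal_lintegral_betaNat k q measurableSet_Ioi (FDAMIMO.measurable_condCdf _ _
        (FDAMIMO.measurable_ratioThreshold lam)) fun b hb => FDAMIMO.condCdf_nonneg _ hα
          hb.2.1.le (FDAMIMO.ratioThreshold_nonneg lam b)] at h'
      rw [← FDAMIMO.integral_sub_condCdf hα hlam, ← h']
      exact (add_sub_cancel_left _ _).symm
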